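/- **Setting.** Let $G$ be a connected simple undirected graph on $n\ge 2$ vertices with integer edge weights in $\{1,\dots,W\}$, $W\ge 1$, $\sqrt W\le n$, and average degree $d=2|E|/n$. Let $w_1\le\dots\le w_{n-1}$ be the sorted edge weights of a minimum spanning tree, $\mathrm{cost}_k=\sum_{i=1}^{n-k}w_i$ (the cost of the $k$-single-linkage clustering), and $\mathrm{cost}(G)=\sum_{k=1}^n\mathrm{cost}_k$. The algorithms read $G$ through adjacency lists (with weights) whose entries are read sequentially, each read being one query; they can flip fair coins and draw uniform vertices, and time is counted in steps of a real RAM. **Component estimator** $\mathrm{ACC}(H,\varepsilon,k,d)$, for a subgraph $H$ given by a condition on the weights. Put $r=\lceil 64k/\varepsilon^2\rceil$, $\Gamma=\lceil 4k/\varepsilon\rceil$. For each of $r$ independent uniform vertices $u$, read all $d_u$ edges at $u$; if $u$ is isolated in $H$ set $\beta=1$. Otherwise repeat: flip a coin; on tails, or if at least $\Gamma$ vertices or a vertex of degree $>d\Gamma$ in $G$ have been met, stop with $\beta=0$; else continue the breadth-first search in $H$ until the number of visited edges of $G$ (adjacency-list entries) has doubled, and if this completes the component of $u$, stop with $\beta=d_u2^{\#\text{flips}}/\#\text{visited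 edges}$. Return $n/r$ times the sum of the values $\beta$. For $\kappa>0$, the amplified estimator returns the median of $\lceil\kappa\log(1/\delta)\rceil$ independent runs. **Algorithm** $\mathrm{AppProfile}(G,\varepsilon,W,d)$. Let $t_1=\lfloor\log_{1+\varepsilon}\sqrt W+1\rfloor$, $t_2=\lfloor 1/\varepsilon-1\rfloor$, $t=t_1+t_2+1$, and $B_i=n(1+\varepsilon)^{-(i-1)}$ for $1\le i\le t_1$, $B_i=\frac n{\sqrt W}(1-\varepsilon(i-t_1))$ for $t_1<i\le t_1+t_2$, $B_t=1$. For $1\le j\le W$ let $\hat c_j$ be the output, clamped to $[1,n]$, of the amplified estimator for the subgraph $G_j$ of edges of weight at most $j$, with parameters $\varepsilon/8$, $k=\sqrt W$, $d$, $\delta=1/(4W)$; it is computed only when first needed, and then stored. For each $i$, let $\hat j_i$ be the index returned by binary search on $\{1,\dots,W\}$ that keeps the left half, including the midpoint $m$, if $\hat c_m\le B_i$, and the right half without $m$ otherwise. Output the pairs $(B_i,\overline{\mathrm{cost}}_{B_i})$, $1\le i\le t$, where $\overline{\mathrm{cost}}_{B_1}=0$ and $\overline{\mathrm{cost}}_{B_i}=n-B_i\hat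 j_i+\sum_{a=1}^{i-1}(\hat j_{a+1}-\hat j_a)B_a$ for $i\ge 2$. This list represents the vector $(\widehat{\mathrm{cost}}_1,\dots,\widehat{\mathrm{cost}}_n)$ with $\widehat{\mathrm{cost}}_k=\overline{\mathrm{cost}}_{B_{i+1}}$ for the $i$ with $B_{i+1}\le k<B_i$ (where $B_0=\infty$). **Theorem.** There are absolute constants $\kappa>0$, $c_0\in(0,1]$ and $C>0$ such that for all $G,n,W,d$ as above, every adjacency-list representation of $G$, and every $0<\varepsilon<1$, algorithm $\mathrm{AppProfile}(G,c_0\varepsilon,W,d)$ (with median constant $\kappa$) has the following properties. 1. With probability at least $3/4$, $$\sum_{k=1}^{n}\bigl|\widehat{\mathrm{cost}}_k-\mathrm{cost}_k\bigr|\le\varepsilon\cdot\mathrm{cost}(G).$$ 2. Its expected running time and its expected number of queries are both at most $C\,\frac{\sqrt W\,d}{\varepsilon^3}\log^4\bigl(\frac{2Wd}{\varepsilon}\bigr)$. 3. The representation that it outputs always consists of at most $C\,\frac{1+\log W}{\varepsilon}$ pairs of numbers. -/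

import Mathlib

open scoped ENNReal

/-! ## Randomized computations with a step count -/

/-- A randomized computation: the joint law of its output, its running time and its number of
adjacency-list queries. Running time is counted in steps of a real RAM: arithmetic and comparisons
of numbers, table and queue accesses (including the sparse-set tables, which need no
initialization, used for the visited vertices and for the stored estimates), a fair coin flip,
drawing a uniform vertex, and following one pointer of an adjacency list each take constant time. -/
def RandComp (α : Type) : Type := PMF (α × ℕ × ℕ)

namespace RandComp

/-- Sequential composition adds up the running times and the query counts. -/
noncomputable instance : Monad RandComp where
  pure a := PMF.pure (a, 0, 0)
  bind p f := PMF.bind p fun x =>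
    PMF.map (fun y => (y.1, x.2.1 + y.2.1, x.2.2 + y.2.2)) (f x.1)

/-- Spend `t` time steps, `q` of which read an entry of an adjacency list. -/
noncomputable def charge (t q : ℕ) : RandComp Unit := PMF.pure ((), t, q)

/-- Flip a fair coin (one step). -/
noncomputable def coin : RandComp Bool :=
  PMF.map (fun b => (b, 1, 0)) (PMF.uniformOfFintype Bool)

/-- Draw a vertex uniformly at random (one step). -/
noncomputable def vertex (n : ℕ) [NeZero n] : RandComp (Fin n) :=
  PMF.map (fun v => (v, 1, 0)) (PMF.uniformOfFintype (Fin n))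

/-- The probability that the output satisfies `S`. -/
noncomputable def prob {α : Type} (p : RandComp α) (S : α → Prop) : ℝ≥0∞ :=
  PMF.toOuterMeasure p {x | S x.1}

/-- The expected running time. -/
noncomputable def expTime {α : Type} (p : RandComp α) : ℝ≥0∞ :=
  ∑' x : α × ℕ × ℕ, (show PMF (α × ℕ × ℕ) from p) x * (x.2.1 : ℝ≥0∞)

/-- The expected number of queries. -/
noncomputable def expQueries {α : Type} (p : RandComp α) : ℝ≥0∞ :=
  ∑' x : α × ℕ × ℕ, (show PMF (α × ℕ × ℕ) from p) x * (x.2.2 : ℝ≥0∞)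

/-- Every output that occurs with positive probability satisfies `S`. -/
def Always {α : Type} (p : RandComp α) (S : α → Prop) : Prop :=
  ∀ x ∈ PMF.support p, S x.1

end RandComp

/-! ## Weighted graphs and the single-linkage clustering profile -/

section Graphs

variable {n : ℕ}

/-- The edges of a graph on `{0, …, n - 1}` as a finset. -/
noncomputable def edgesOf (T : SimpleGraph (Fin n)) : Finset (Sym2 (Fin n)) :=
  (Set.toFinite T.edgeSet).toFinset

/-- `T` is a minimum spanning tree of the graph `G` with edge weights `w`. -/
def IsMinSpanningTree (G : SimpleGraph (Fin n)) (w : Sym2 (Fin n) → ℕ)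
    (T : SimpleGraph (Fin n)) : Prop :=
  T ≤ G ∧ T.IsTree ∧
    ∀ T' : SimpleGraph (Fin n), T' ≤ G → T'.IsTree →
      ∑ e ∈ edgesOf T, w e ≤ ∑ e ∈ edgesOf T', w e

/-- The edge weights `w₁ ≤ w₂ ≤ … ≤ w_{n-1}` of the tree `T` in non-decreasing order. -/
noncomputable def sortedWeights (w : Sym2 (Fin n) → ℕ) (T : SimpleGraph (Fin n)) : List ℕ :=
  ((edgesOf T).val.map w).sort (· ≤ ·)

/-- `cost_k = w₁ + … + w_{n-k}`, where `w₁ ≤ … ≤ w_{n-1}` are the edge weights of the minimum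
spanning tree `T`. -/
noncomputable def kClusteringCost (w : Sym2 (Fin n) → ℕ) (T : SimpleGraph (Fin n)) (k : ℕ) : ℕ :=
  ((sortedWeights w T).take (n - k)).sum

/-- `cost(G) = cost_1 + … + cost_n`, in terms of a minimum spanning tree `T` of `G`. -/
noncomputable def hierarchyCost (w : Sym2 (Fin n) → ℕ) (T : SimpleGraph (Fin n)) : ℕ :=
  ∑ k ∈ Finset.Icc 1 n, kClusteringCost w T k

/-- The average (unweighted) degree `2 |E| / n`. -/
noncomputable def averageDegree (G : SimpleGraph (Fin n)) : ℝ :=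
  2 * (G.edgeSet.ncard : ℝ) / n

/-- `adj` is an adjacency-list representation of `G` with weights `w`: the list of `v` contains,
in an arbitrary order, each neighbour of `v` once, together with the weight of the edge. -/
structure IsAdjList (G : SimpleGraph (Fin n)) (w : Sym2 (Fin n) → ℕ)
    (adj : Fin n → List (Fin n × ℕ)) : Prop where
  nodup : ∀ v, (adj v).Nodup
  mem_iff : ∀ v u x, (u, x) ∈ adj v ↔ G.Adj v u ∧ x = w s(v, u)

end Graphs

/-! ## Estimating the number of connected components of a subgraph

The subgraph `H` consists of the edges whose weight satisfies `inH`. -/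

/-- The state of a breadth-first search in `H`. -/
structure BFS (n : ℕ) where
  /-- the visited vertices -/
  seen : Finset (Fin n)
  /-- the visited vertices whose adjacency lists have not been opened yet -/
  queue : List (Fin n)
  /-- the unread rest of the adjacency list of the current vertex -/
  rest : List (Fin n × ℕ)
  /-- the number of entries read so far in the list of the current vertex -/
  cur : ℕ
  /-- the total number of entries read so far (the number of edges visited in `G`) -/
  read : ℕ
  /-- whether a vertex with more than `dG` neighbours in `G` has been met -/
  big : Bool

namespace BFS

variable {n : ℕ}

/-- The search has explored the whole component. -/
def finished (s : BFS n) : Bool := s.rest.isEmpty && s.queue.isEmpty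

/-- If the current list is exhausted, open the list of the next vertex of the queue. -/
def next (adj : Fin n → List (Fin n × ℕ)) (s : BFS n) : BFS n :=
  match s.rest, s.queue with
  | [], v :: q => { s with queue := q, rest := adj v, cur := 0 }
  | _, _ => s

/-- Read one more entry (constant time, one query); nothing happens once the search is
finished. -/
noncomputable def readEntry (adj : Fin n → List (Fin n × ℕ)) (inH : ℕ → Bool) (dG : ℝ)
    (s : BFS n) : BFS n :=
  match s.rest with
  | [] => s
  | (v, x) :: rest =>
    let fresh : Bool := inH x && decide (v ∉ s.seen)
    next adj
      { seen := if fresh then insert v s.seen else s.seen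
        queue := if fresh then s.queue ++ [v] else s.queue
        rest := rest
        cur := s.cur + 1
        read := s.read + 1
        big := s.big || decide (dG < ((s.cur + 1 : ℕ) : ℝ)) }

/-- The search from `u` before any entry has been read. -/
def start (adj : Fin n → List (Fin n × ℕ)) (u : Fin n) : BFS n :=
  { seen := {u}, queue := [], rest := adj u, cur := 0, read := 0, big := false }

end BFS

section Components

variable {n : ℕ}

/-- The coin-flipping loop for one sampled vertex of degree `du`: on heads, and as long as fewer
than `Γ` vertices and no vertex of degree larger than `dG` have been visited, resume the search
and double the number of visited edges. `flips` is the number of coin flips so far. The first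
argument only makes the recursion structural. -/
noncomputable def coinLoop (adj : Fin n → List (Fin n × ℕ)) (inH : ℕ → Bool) (Γ : ℕ) (dG : ℝ)
    (du : ℕ) : ℕ → ℕ → BFS n → RandComp ℝ
  | 0, _, _ => pure 0
  | fuel + 1, flips, s => do
    let heads ← RandComp.coin
    if heads = true ∧ s.seen.card < Γ ∧ s.big = false then
      let s' := (BFS.readEntry adj inH dG)^[s.read] s
      RandComp.charge (s'.read - s.read + 1) (s'.read - s.read)
      if s'.finished = true then
        pure ((du : ℝ) * 2 ^ (flips + 1) / (s'.read : ℝ))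
      else coinLoop adj inH Γ dG du fuel (flips + 1) s'
    else pure 0

/-- The value `β` for the sampled vertex `u`. The recursion bound handed to `coinLoop` exceeds the
number of entries of all lists, and is never reached: each round but the last reads new entries. -/
noncomputable def vertexEstimate (adj : Fin n → List (Fin n × ℕ)) (inH : ℕ → Bool) (Γ : ℕ)
    (dG : ℝ) (u : Fin n) : RandComp ℝ := do
  let du := (adj u).length
  let s := (BFS.readEntry adj inH dG)^[du] (BFS.start adj u)
  RandComp.charge (du + 1) du
  if s.finished = true then pure 1
  else coinLoop adj inH Γ dG du ((∑ v, (adj v).length) + 1) 0 s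

/-- The sum of the values `β` over `r` independent uniform vertices. -/
noncomputable def sampleSum [NeZero n] (adj : Fin n → List (Fin n × ℕ)) (inH : ℕ → Bool) (Γ : ℕ)
    (dG : ℝ) : ℕ → RandComp ℝ
  | 0 => pure 0
  | r + 1 => do
    let u ← RandComp.vertex n
    let β ← vertexEstimate adj inH Γ dG u
    RandComp.charge 1 0
    let S ← sampleSum adj inH Γ dG r
    pure (β + S)

/-- `ApproximateConnectedComponents(G, H, ε, k, d)`. -/
noncomputable def approxComponents [NeZero n] (adj : Fin n → List (Fin n × ℕ)) (inH : ℕ → Bool)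
    (ε k d : ℝ) : RandComp ℝ := do
  let r := ⌈64 * k / ε ^ 2⌉₊
  let Γ := ⌈4 * k / ε⌉₊
  RandComp.charge 1 0
  let S ← sampleSum adj inH Γ (d * Γ) r
  pure ((n : ℝ) / r * S)

/-- The list of the outputs of `R` independent runs of `p`. -/
noncomputable def repeatRuns (p : RandComp ℝ) : ℕ → RandComp (List ℝ)
  | 0 => pure []
  | R + 1 => do
    let x ← p
    RandComp.charge 1 0
    let l ← repeatRuns p R
    pure (x :: l)

/-- The median of a list of reals. -/
noncomputable def median (l : List ℝ) : ℝ :=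
  (l.insertionSort (· ≤ ·)).getD (l.length / 2) 0

/-- `AppNCCMedianTrick(G, H, ε, k, d, δ)`: the median of `κ log (1/δ)` independent runs, where `κ`
is an absolute constant. Sorting is charged quadratically. -/
noncomputable def medianTrick [NeZero n] (adj : Fin n → List (Fin n × ℕ)) (inH : ℕ → Bool)
    (κ ε k d δ : ℝ) : RandComp ℝ := do
  let R := ⌈κ * Real.log (1 / δ)⌉₊
  let l ← repeatRuns (approxComponents adj inH ε k d) R
  RandComp.charge (R ^ 2 + 1) 0
  pure (median l)

end Components

/-! ## The profile algorithm -/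

section Profile

variable {n : ℕ}

/-- `t₁`, the largest integer with `n / (1 + ε) ^ (t₁ - 1) ≥ n / √W`. -/
noncomputable def tOne (ε : ℝ) (W : ℕ) : ℕ := ⌊Real.logb (1 + ε) (√(W : ℝ)) + 1⌋₊

/-- `t₂`, the largest integer with `1 - ε t₂ ≥ ε`. -/
noncomputable def tTwo (ε : ℝ) : ℕ := ⌊1 / ε - 1⌋₊

/-- The number `t = t₁ + t₂ + 1` of interval endpoints. -/
noncomputable def numEndpoints (ε : ℝ) (W : ℕ) : ℕ := tOne ε W + tTwo ε + 1

/-- The interval endpoints `B_1, …, B_t`. -/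
noncomputable def endpoint (n : ℕ) (ε : ℝ) (W : ℕ) (i : ℕ) : ℝ :=
  if i ≤ tOne ε W then (n : ℝ) / (1 + ε) ^ (i - 1)
  else if i ≤ tOne ε W + tTwo ε then
    (n : ℝ) / √(W : ℝ) * (1 - ε * ((i : ℝ) - (tOne ε W : ℝ)))
  else 1

/-- The estimate `ĉ_j` of the number of components of the subgraph `G_j` of the edges of weight at
most `j`, clamped to `[1, n]`. Estimates that were made before are reused: `memo` is the table of
the stored values, and the new table is returned with the estimate. -/
noncomputable def componentEstimate [NeZero n] (adj : Fin n → List (Fin n × ℕ)) (κ ε : ℝ) (W : ℕ)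
    (d : ℝ) (j : ℕ) (memo : ℕ → Option ℝ) : RandComp (ℝ × (ℕ → Option ℝ)) :=
  match memo j with
  | some c => do
    RandComp.charge 1 0
    pure (c, memo)
  | none => do
    let c' ← medianTrick adj (fun x => decide (x ≤ j)) κ (ε / 8) (√(W : ℝ)) d (1 / (4 * (W : ℝ)))
    RandComp.charge 1 0
    let c := min (max c' 1) (n : ℝ)
    pure (c, Function.update memo j (some c))

/-- `BinarySearch(Ĉ, l, r, B)` on the sequence of the estimates `ĉ_j`. -/
noncomputable def binarySearch [NeZero n] (adj : Fin n → List (Fin n × ℕ)) (κ ε : ℝ) (W : ℕ)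
    (d B : ℝ) (l r : ℕ) (memo : ℕ → Option ℝ) : RandComp (ℕ × (ℕ → Option ℝ)) :=
  if h : r ≤ l then do
    RandComp.charge 1 0
    pure (l, memo)
  else do
    let p ← componentEstimate adj κ ε W d ((l + r) / 2) memo
    RandComp.charge 1 0
    if p.1 ≤ B then binarySearch adj κ ε W d B l ((l + r) / 2) p.2
    else binarySearch adj κ ε W d B ((l + r) / 2 + 1) r p.2
termination_by r - l

/-- Search for a list of keys, one after the other, in `ĉ_1, …, ĉ_W`. -/
noncomputable def searchKeys [NeZero n] (adj : Fin n → List (Fin n × ℕ)) (κ ε : ℝ) (W : ℕ)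
    (d : ℝ) : List ℝ → (ℕ → Option ℝ) → RandComp (List ℕ)
  | [], _ => pure []
  | B :: keys, memo => do
    let p ← binarySearch adj κ ε W d B 1 W memo
    let js ← searchKeys adj κ ε W d keys p.2
    pure (p.1 :: js)

/-- The part of `AppCost(G, ε, W, d)` that the profile algorithm uses: compute the endpoints and
output the indices `ĵ_1, …, ĵ_t` found by the binary searches for `B_1, …, B_t`. -/
noncomputable def appCostIndices [NeZero n] (adj : Fin n → List (Fin n × ℕ)) (κ ε : ℝ) (W : ℕ)
    (d : ℝ) : RandComp (List ℕ) := do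
  let t := numEndpoints ε W
  RandComp.charge (t + 1) 0
  searchKeys adj κ ε W d ((List.range t).map fun i => endpoint n ε W (i + 1)) fun _ => none

/-- The value computed for the endpoint `B_i` from the indices `ĵ_1, …, ĵ_t`. -/
noncomputable def endpointCost (n : ℕ) (ε : ℝ) (W : ℕ) (js : List ℕ) (i : ℕ) : ℝ :=
  if i = 1 then 0
  else
    let j : ℕ → ℝ := fun a => (js.getD (a - 1) 0 : ℕ)
    (n : ℝ) - endpoint n ε W i * j i +
      ∑ a ∈ Finset.Ico 1 i, (j (a + 1) - j a) * endpoint n ε W a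

/-- `AppProfile(G, ε, W, d)`. The output is the list of the pairs `(B_i, costBar_{B_i})`,
`i = 1, …, t`. -/
noncomputable def appProfile [NeZero n] (adj : Fin n → List (Fin n × ℕ)) (κ ε : ℝ) (W : ℕ)
    (d : ℝ) : RandComp (List (ℝ × ℝ)) := do
  let t := numEndpoints ε W
  let js ← appCostIndices adj κ ε W d
  RandComp.charge (t ^ 2 + t + 1) 0
  pure ((List.range t).map fun i => (endpoint n ε W (i + 1), endpointCost n ε W js (i + 1)))

/-- The estimate of `cost_k` that a representation encodes: the value at the endpoint `B_{i+1}`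
with `B_{i+1} ≤ k < B_i` (where `B_0 = ∞`), that is, at the first endpoint that is at most `k`. -/
noncomputable def profileOracle (rep : List (ℝ × ℝ)) (k : ℕ) : ℝ :=
  match rep.find? fun p => decide (p.1 ≤ (k : ℝ)) with
  | some p => p.2
  | none => 0

end Profile

/-! ## Expectations of randomized computations -/

/-! Let c_j be the number of components of G_j, c_0 = n, and L = n/√W. By an exchange argument the
light edges of a minimum spanning tree span the components of G_j, so cost_k = ∑_{j<W} max(c_j - k,
0) (`kClusteringCost_eq_sum`): the area above height k under the decreasing staircase j ↦ c_j. Abel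
summation turns the output at B_i into ∑_{a<i} ĵ_{a+1} (B_a - B_{a+1}) (`endpointCost_eq_sum`), the
same area cut into horizontal strips, where ĵ_a is roughly the place at which the staircase crosses
height B_a.

Accuracy. Comparing the two areas column by column, column m is wrong by O(e · max(c_m, L)), and
only for k ≤ 2 max(c_m, L) (`abs_contribution_sub_le`). Summed over k this is O(e · (c_m² + L²)).
The c_m² part is paid for by ∑_m c_m (c_m - 1)/2 ≤ cost(G), and W L² = n² by the term m = 0 alone,
which is n (n - 1)/2 (`sum_abs_sub_le`). The estimates need not be monotone in j: a search result is
constrained only by the estimates next to it, and the monotonicity of the true counts does the rest.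
At most W distinct estimates are ever made, each failing with probability at most 1/(4W), so all are
accurate with probability 3/4, however adaptively they are chosen (`ev_searchKeys_le`).

Component estimator. Each coin halves the survival probability and doubles the reported value, so
for a component that is not truncated β has mean d_u / vol, vol being the total degree of the
component of u; these ratios sum to 1 over each component (`exists_law_sample`). Truncated
components are few, because each holds Γ vertices or a vertex of degree above dΓ. As 0 ≤ β ≤ 2, the
variance is at most twice the mean, and Chebyshev followed by a median gives the error bound
(`prob_approxComponents_le`, `prob_medianTrick_le`).

Time. A round of the search costs twice the previous one but is reached half as often, so a sampled
vertex costs its degree times the number of possible doublings (`expTime_coinLoop_le`); the mean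
degree is d. The four logarithms come from the doublings, the runs of the median, the depth of a
binary search and the number of endpoints. -/

theorem PMF.tsum_bind_mul {α β : Type*} (p : PMF α) (f : α → PMF β) (G : β → ℝ≥0∞) :
    ∑' y, (p.bind f) y * G y = ∑' x, p x * ∑' y, f x y * G y := by
  simp_rw [PMF.bind_apply, ← ENNReal.tsum_mul_right, ← ENNReal.tsum_mul_left]
  rw [ENNReal.tsum_comm]
  simp_rw [mul_assoc]

theorem PMF.tsum_pure_mul {α : Type*} (a : α) (G : α → ℝ≥0∞) :
    ∑' y, (PMF.pure a) y * G y = G a := by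
  rw [tsum_eq_single a]
  · simp
  · intro b hb
    simp [PMF.pure_apply, hb]

theorem PMF.tsum_map_mul {α β : Type*} (p : PMF α) (h : α → β) (G : β → ℝ≥0∞) :
    ∑' y, (p.map h) y * G y = ∑' x, p x * G (h x) := by
  rw [← PMF.bind_pure_comp, PMF.tsum_bind_mul]
  simp

namespace RandComp

variable {α β : Type}

/-- The joint law of the output, the running time and the number of queries. -/
def law (p : RandComp α) : PMF (α × ℕ × ℕ) := p

/-- The expectation of a function of the output. -/
noncomputable def ev (p : RandComp α) (g : α → ℝ≥0∞) : ℝ≥0∞ := ∑' x, p.law x * g x.1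

theorem ev_pure (a : α) (g : α → ℝ≥0∞) : ev (pure a) g = g a :=
  PMF.tsum_pure_mul (a, 0, 0) fun x => g x.1

theorem ev_charge (t q : ℕ) (g : Unit → ℝ≥0∞) : ev (charge t q) g = g () :=
  PMF.tsum_pure_mul ((), t, q) fun x => g x.1

theorem tsum_law_bind (p : RandComp α) (f : α → RandComp β) (G : β × ℕ × ℕ → ℝ≥0∞) :
    ∑' y, (p >>= f).law y * G y = ∑' x, p.law x * ∑' y, (f x.1).law y *
      G (y.1, x.2.1 + y.2.1, x.2.2 + y.2.2) := by
  refine (PMF.tsum_bind_mul p.law _ G).trans ?_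
  exact tsum_congr fun x => congrArg (p.law x * ·) (PMF.tsum_map_mul (f x.1).law _ G)

theorem ev_bind (p : RandComp α) (f : α → RandComp β) (g : β → ℝ≥0∞) :
    ev (p >>= f) g = ev p fun a => ev (f a) g :=
  tsum_law_bind p f fun x => g x.1

theorem ev_coin (g : Bool → ℝ≥0∞) : ev coin g = 2⁻¹ * g true + 2⁻¹ * g false := by
  refine (PMF.tsum_map_mul (PMF.uniformOfFintype Bool) _ fun x : _ × ℕ × ℕ => g x.1).trans ?_
  simp [tsum_fintype]

theorem ev_vertex (n : ℕ) [NeZero n] (g : Fin n → ℝ≥0∞) :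
    ev (vertex n) g = ∑ v, (n : ℝ≥0∞)⁻¹ * g v := by
  refine (PMF.tsum_map_mul (PMF.uniformOfFintype (Fin n)) _ fun x : _ × ℕ × ℕ => g x.1).trans ?_
  simp [tsum_fintype]

theorem ev_const (p : RandComp α) (c : ℝ≥0∞) : ev p (fun _ => c) = c := by
  rw [ev, ENNReal.tsum_mul_right, PMF.tsum_coe, one_mul]

theorem ev_mono (p : RandComp α) {g h : α → ℝ≥0∞} (hgh : ∀ a, g a ≤ h a) : ev p g ≤ ev p h :=
  ENNReal.tsum_le_tsum fun x => mul_le_mul_right (hgh x.1) _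

theorem ev_le (p : RandComp α) {g : α → ℝ≥0∞} {c : ℝ≥0∞} (hg : ∀ a, g a ≤ c) : ev p g ≤ c :=
  (ev_mono p hg).trans (ev_const p c).le

theorem ev_add (p : RandComp α) (g h : α → ℝ≥0∞) :
    ev p (fun a => g a + h a) = ev p g + ev p h := by
  simp_rw [ev, mul_add]
  exact ENNReal.tsum_add

theorem ev_const_mul (p : RandComp α) (c : ℝ≥0∞) (g : α → ℝ≥0∞) :
    ev p (fun a => c * g a) = c * ev p g := by
  simp_rw [ev, ← ENNReal.tsum_mul_left, mul_left_comm]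

theorem prob_eq_ev (p : RandComp α) (S : α → Prop) [DecidablePred S] :
    p.prob S = ev p fun a => if S a then 1 else 0 := by
  refine (PMF.toOuterMeasure_apply p.law _).trans (tsum_congr fun x => ?_)
  by_cases h : S x.1 <;> simp [Set.indicator, h, law]

theorem prob_add_prob_not (p : RandComp α) (S : α → Prop) :
    p.prob S + p.prob (fun a => ¬ S a) = 1 := by
  classical
  rw [prob_eq_ev, prob_eq_ev, ← ev_add]
  convert ev_const p 1 using 2
  ext a
  by_cases h : S a <;> simp [h]

theorem prob_mono (p : RandComp α) {S T : α → Prop} (h : ∀ a, S a → T a) :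
    p.prob S ≤ p.prob T := by
  classical
  rw [prob_eq_ev, prob_eq_ev]
  refine ev_mono p fun a => ?_
  by_cases hS : S a
  · simp [hS, h a hS]
  · simp [hS]

/-! ### Expected running time -/

theorem expTime_pure (a : α) : expTime (pure a : RandComp α) = 0 :=
  (PMF.tsum_pure_mul (a, 0, 0) fun x : α × ℕ × ℕ => (x.2.1 : ℝ≥0∞)).trans (by simp)

theorem expTime_charge (t q : ℕ) : expTime (charge t q) = t :=
  PMF.tsum_pure_mul ((), t, q) fun x => (x.2.1 : ℝ≥0∞)

theorem expTime_coin : expTime coin = 1 := by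
  refine (PMF.tsum_map_mul (PMF.uniformOfFintype Bool) _
    fun x : _ × ℕ × ℕ => (x.2.1 : ℝ≥0∞)).trans ?_
  simp [tsum_fintype, ENNReal.mul_inv_cancel]

theorem expTime_vertex (n : ℕ) [NeZero n] : expTime (vertex n) = 1 := by
  refine (PMF.tsum_map_mul (PMF.uniformOfFintype (Fin n)) _
    fun x : _ × ℕ × ℕ => (x.2.1 : ℝ≥0∞)).trans ?_
  simp only [Nat.cast_one, mul_one]
  exact PMF.tsum_coe _

theorem expTime_bind (p : RandComp α) (f : α → RandComp β) :
    expTime (p >>= f) = expTime p + ev p fun a => expTime (f a) := by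
  refine (tsum_law_bind p f fun x => (x.2.1 : ℝ≥0∞)).trans ?_
  unfold expTime ev
  rw [← ENNReal.tsum_add]
  refine tsum_congr fun x => ?_
  simp only [Nat.cast_add, mul_add]
  rw [ENNReal.tsum_add, ENNReal.tsum_mul_right, PMF.tsum_coe, one_mul, mul_add]
  rfl

theorem expTime_bind_le (p : RandComp α) (f : α → RandComp β) {a b : ℝ≥0∞}
    (hp : expTime p ≤ a) (hf : ∀ x, expTime (f x) ≤ b) : expTime (p >>= f) ≤ a + b := by
  rw [expTime_bind]
  exact add_le_add hp (ev_le p hf)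

/-! ### Queries never outnumber steps -/

/-- Every run makes at most as many queries as it takes steps. -/
def QueryBounded (p : RandComp α) : Prop := ∀ x ∈ PMF.support p, x.2.2 ≤ x.2.1

theorem QueryBounded.pure (a : α) : QueryBounded (pure a : RandComp α) := by
  intro x hx
  have : x = (a, 0, 0) := by simpa using (PMF.mem_support_pure_iff (a, 0, 0) x).1 hx
  simp [this]

theorem QueryBounded.charge {t q : ℕ} (h : q ≤ t) : QueryBounded (charge t q) := by
  intro x hx
  have : x = ((), t, q) := (PMF.mem_support_pure_iff ((), t, q) x).1 hx
  simpa [this] using h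

theorem QueryBounded.coin : QueryBounded coin := by
  intro x hx
  obtain ⟨b, -, rfl⟩ := (PMF.mem_support_map_iff _ _ _).1 hx
  simp

theorem QueryBounded.vertex (n : ℕ) [NeZero n] : QueryBounded (vertex n) := by
  intro x hx
  obtain ⟨b, -, rfl⟩ := (PMF.mem_support_map_iff _ _ _).1 hx
  simp

theorem QueryBounded.bind {p : RandComp α} {f : α → RandComp β} (hp : QueryBounded p)
    (hf : ∀ a, QueryBounded (f a)) : QueryBounded (p >>= f) := by
  intro x hx
  obtain ⟨y, hy, hx⟩ := (PMF.mem_support_bind_iff p _ _).1 hx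
  obtain ⟨z, hz, rfl⟩ := (PMF.mem_support_map_iff _ _ _).1 hx
  exact add_le_add (hp y hy) (hf y.1 z hz)

theorem QueryBounded.ite {c : Prop} [Decidable c] {p q : RandComp α} (hp : QueryBounded p)
    (hq : QueryBounded q) : QueryBounded (if c then p else q) := by
  split_ifs
  exacts [hp, hq]

theorem QueryBounded.expQueries_le {p : RandComp α} (hp : QueryBounded p) :
    expQueries p ≤ expTime p := by
  refine ENNReal.tsum_le_tsum fun x => ?_
  by_cases hx : x ∈ PMF.support p
  · exact mul_le_mul_right (by exact_mod_cast hp x hx) _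
  · have : (show PMF (α × ℕ × ℕ) from p) x = 0 :=
      not_not.1 fun h => hx ((PMF.mem_support_iff p.law x).2 h)
    simp [this]

theorem Always.pure {a : α} {S : α → Prop} (h : S a) : Always (pure a : RandComp α) S := by
  intro x hx
  have : x = (a, 0, 0) := by simpa using (PMF.mem_support_pure_iff (a, 0, 0) x).1 hx
  simpa [this] using h

theorem Always.bind {p : RandComp α} {f : α → RandComp β} {S : β → Prop}
    (hf : ∀ a, Always (f a) S) : Always (p >>= f) S := by
  intro x hx
  obtain ⟨y, hy, hx⟩ := (PMF.mem_support_bind_iff p _ _).1 hx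
  obtain ⟨z, hz, rfl⟩ := (PMF.mem_support_map_iff _ _ _).1 hx
  exact hf y.1 z hz

end RandComp

/-! ## Concentration of sample sums and medians -/

section Concentration

open RandComp

variable {n : ℕ} [NeZero n] {adj : Fin n → List (Fin n × ℕ)} {inH : ℕ → Bool} {Γ : ℕ} {dG : ℝ}

theorem ev_sampleSum_succ (r : ℕ) (g : ℝ → ℝ≥0∞) :
    ev (sampleSum adj inH Γ dG (r + 1)) g =
      ev (vertex n) fun u => ev (vertexEstimate adj inH Γ dG u) fun β =>
        ev (sampleSum adj inH Γ dG r) fun S => g (β + S) := by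
  simp only [sampleSum, ev_bind, ev_charge, ev_pure]

/-- The variance of a sum of independent values, each equal to `b i` with probability `q i`. The
shift `x` carries the deviation of the values already drawn, which lets the induction follow the
recursion of `sampleSum`; the cross terms vanish because the deviations have mean zero. -/
theorem ev_sq_sampleSum {ι : Type*} [Fintype ι] {q b : ι → ℝ} (hq : ∀ i, 0 ≤ q i)
    (hq1 : ∑ i, q i = 1)
    (hlaw : ∀ g, ev (vertex n) (fun u => ev (vertexEstimate adj inH Γ dG u) g) =
      ∑ i, ENNReal.ofReal (q i) * g (b i)) (r : ℕ) (x : ℝ) :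
    ev (sampleSum adj inH Γ dG r)
        (fun S => ENNReal.ofReal ((x + S - r * ∑ i, q i * b i) ^ 2)) =
      ENNReal.ofReal (x ^ 2 + r * ∑ i, q i * (b i - ∑ i, q i * b i) ^ 2) := by
  set μ := ∑ i, q i * b i with hμ
  have hV : 0 ≤ ∑ i, q i * (b i - μ) ^ 2 :=
    Finset.sum_nonneg fun i _ => mul_nonneg (hq i) (sq_nonneg _)
  induction r generalizing x with
  | zero => simp [sampleSum, ev_pure]
  | succ r ih =>
    rw [ev_sampleSum_succ, hlaw]
    have h1 : ∀ i, ev (sampleSum adj inH Γ dG r) (fun S =>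
        ENNReal.ofReal ((x + (b i + S) - ((r + 1 : ℕ) : ℝ) * μ) ^ 2)) =
        ENNReal.ofReal ((x + b i - μ) ^ 2 + r * ∑ i, q i * (b i - μ) ^ 2) := by
      intro i
      rw [← ih]
      congr 1
      ext S
      push_cast
      ring_nf
    simp_rw [h1]
    simp_rw [← ENNReal.ofReal_mul (hq _)]
    rw [← ENNReal.ofReal_sum_of_nonneg]
    · congr 1
      have h2 : ∀ i, q i * ((x + b i - μ) ^ 2 + r * ∑ i, q i * (b i - μ) ^ 2) =
          q i * (x ^ 2 - 2 * x * μ + r * ∑ i, q i * (b i - μ) ^ 2) + 2 * x * (q i * b i) +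
            q i * (b i - μ) ^ 2 := fun i => by ring
      simp_rw [h2, Finset.sum_add_distrib]
      rw [← Finset.sum_mul, hq1, ← Finset.mul_sum, ← hμ]
      push_cast
      ring
    · intro i _
      exact mul_nonneg (hq i) (add_nonneg (sq_nonneg _) (mul_nonneg (Nat.cast_nonneg _) hV))

/-- Chebyshev's inequality for the sum of the sampled values. -/
theorem prob_sampleSum_le {ι : Type*} [Fintype ι] {q b : ι → ℝ} (hq : ∀ i, 0 ≤ q i)
    (hq1 : ∑ i, q i = 1)
    (hlaw : ∀ g, ev (vertex n) (fun u => ev (vertexEstimate adj inH Γ dG u) g) =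
      ∑ i, ENNReal.ofReal (q i) * g (b i)) (hb0 : ∀ i, 0 ≤ b i) (hb2 : ∀ i, b i ≤ 2) (r : ℕ)
    {a : ℝ} (ha : 0 < a) :
    (sampleSum adj inH Γ dG r).prob (fun S => a ≤ |S - r * ∑ i, q i * b i|) ≤
      ENNReal.ofReal (2 * r * (∑ i, q i * b i) / a ^ 2) := by
  classical
  have hsq := ev_sq_sampleSum hq hq1 hlaw r 0
  set μ := ∑ i, q i * b i with hμ
  -- Since 0 ≤ b ≤ 2, b² ≤ 2b; the variance is controlled by the mean.
  have hV : ∑ i, q i * (b i - μ) ^ 2 ≤ 2 * μ := by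
    have h1 : ∀ i, q i * (b i - μ) ^ 2 = q i * b i * b i - 2 * μ * (q i * b i) + μ ^ 2 * q i :=
      fun i => by ring
    have h2 : ∑ i, q i * b i * b i ≤ ∑ i, q i * b i * 2 :=
      Finset.sum_le_sum fun i _ => mul_le_mul_of_nonneg_left (hb2 i) (mul_nonneg (hq i) (hb0 i))
    simp_rw [h1, Finset.sum_add_distrib, Finset.sum_sub_distrib, ← Finset.mul_sum, ← hμ, hq1]
    rw [← Finset.sum_mul, ← hμ] at h2
    nlinarith [sq_nonneg μ]
  rw [prob_eq_ev]
  calc _ ≤ ev (sampleSum adj inH Γ dG r) fun S => ENNReal.ofReal ((a ^ 2)⁻¹) *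
          ENNReal.ofReal ((0 + S - r * μ) ^ 2) := by
        refine ev_mono _ fun S => ?_
        split_ifs with h
        · rw [← ENNReal.ofReal_mul (by positivity), ← ENNReal.ofReal_one]
          refine ENNReal.ofReal_le_ofReal ?_
          rw [inv_mul_eq_div, one_le_div (by positivity), zero_add, ← sq_abs (S - r * μ)]
          gcongr
        · exact zero_le
    _ ≤ _ := by
        rw [ev_const_mul, hsq, ← ENNReal.ofReal_mul (by positivity)]
        refine ENNReal.ofReal_le_ofReal ?_
        rw [inv_mul_eq_div]
        gcongr
        have : (r : ℝ) * ∑ i, q i * (b i - μ) ^ 2 ≤ r * (2 * μ) := by gcongr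
        linarith

/-! ### The median -/

/-- A bad median forces half of the list to be bad. A good point `x` decides the side: if the median
exceeds `x`, a good entry above the median would make the median good by convexity, so the whole
upper half is bad; otherwise the same holds for the lower half. -/
theorem length_le_two_mul_countP_of_median {l : List ℝ} {P : ℝ → Bool}
    (hP : Set.OrdConnected {x | P x = false}) (hl : P (median l) = true)
    (hne : ∃ x, P x = false) : l.length ≤ 2 * l.countP P := by
  obtain ⟨x, hx⟩ := hne
  set L := l.insertionSort (· ≤ ·) with hL
  have hperm : L.Perm l := List.perm_insertionSort _ l
  have hsort : L.Pairwise (· ≤ ·) := List.pairwise_insertionSort _ l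
  rw [← hperm.countP_eq, ← hperm.length_eq]
  rw [median, ← hL, ← hperm.length_eq] at hl
  rcases Nat.eq_zero_or_pos L.length with h0 | h0
  · omega
  have hm : L.length / 2 < L.length := by omega
  rw [List.getD_eq_getElem _ _ hm] at hl
  have hmono : ∀ {i j : ℕ} (hj : j < L.length) (hij : i ≤ j), L[i] ≤ L[j] := by
    intro i j hj hij
    rcases hij.eq_or_lt with rfl | h
    · exact le_rfl
    · exact List.pairwise_iff_getElem.1 hsort i j _ hj h
  rcases lt_or_ge x L[L.length / 2] with h | h
  · have h1 : ∀ y ∈ L.drop (L.length / 2), P y = true := by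
      intro y hy
      obtain ⟨i, hi, rfl⟩ := List.mem_iff_getElem.1 hy
      by_contra hc
      rw [List.getElem_drop] at hc
      have := hP.out hx (by simpa using hc) ⟨h.le, hmono _ (by omega)⟩
      simp_all
    have h2 := (List.drop_sublist (L.length / 2) L).countP_le (p := P)
    rw [List.countP_eq_length.2 h1, List.length_drop] at h2
    omega
  · have h1 : ∀ y ∈ L.take (L.length / 2 + 1), P y = true := by
      intro y hy
      obtain ⟨i, hi, rfl⟩ := List.mem_iff_getElem.1 hy
      by_contra hc
      rw [List.getElem_take] at hc
      have := hP.out (by simpa using hc) hx ⟨hmono hm (by simp at hi; omega), h⟩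
      simp_all
    have h2 := (List.take_sublist (L.length / 2 + 1) L).countP_le (p := P)
    rw [List.countP_eq_length.2 h1, List.length_take] at h2
    omega

/-- A median of independent runs lies outside an interval with probability decaying exponentially
in the number of runs. -/
theorem prob_median_repeatRuns_le {p : RandComp ℝ} {I : ℝ → Prop}
    (hI : Set.OrdConnected {x | I x}) (hne : ∃ x, I x)
    (hp : p.prob (fun x => ¬ I x) ≤ 8⁻¹) (R : ℕ) :
    (repeatRuns p R).prob (fun l => ¬ I (median l)) ≤ ENNReal.ofReal ((11 / 16) ^ R) := by
  classical
  let P : ℝ → Bool := fun x => decide (¬ I x)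
  -- A Chernoff bound: a bad run contributes a factor 2 and a good one 1/2, so the product is at
  -- least 1 when half of the runs are bad, while each factor has mean at most 1/2 + (3/2)(1/8) =
  -- 11/16.
  let h : List ℝ → ℝ≥0∞ := fun l => (l.map fun x => if I x then 2⁻¹ else 2).prod
  have h1 : ∀ l : List ℝ, h l = ENNReal.ofReal ((2 : ℝ) ^ (2 * l.countP P) / 2 ^ l.length) := by
    intro l
    induction l with
    | nil => simp [h]
    | cons x l ih =>
      have : h (x :: l) = (if I x then 2⁻¹ else 2) * h l := by simp [h]
      rw [this, ih]
      by_cases hx : I x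
      · rw [if_pos hx, show (2⁻¹ : ℝ≥0∞) = ENNReal.ofReal 2⁻¹ by
          rw [ENNReal.ofReal_inv_of_pos (by norm_num)]; simp, ← ENNReal.ofReal_mul (by norm_num)]
        congr 1
        simp only [List.countP_cons, List.length_cons, P, hx, not_true_eq_false, decide_false]
        norm_num
        rw [pow_succ]
        field_simp
      · rw [if_neg hx, show (2 : ℝ≥0∞) = ENNReal.ofReal 2 by simp,
          ← ENNReal.ofReal_mul (by norm_num)]
        congr 1
        simp only [List.countP_cons, List.length_cons, P, hx, not_false_eq_true, decide_true]
        norm_num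
        rw [mul_add, pow_add, pow_succ]
        field_simp
        ring
  have h2 : ∀ R, ev (repeatRuns p R) h ≤ ENNReal.ofReal (11 / 16) ^ R := by
    intro R
    induction R with
    | zero => simp [repeatRuns, ev_pure, h]
    | succ R ih =>
      have : ev (repeatRuns p (R + 1)) h =
          ev p (fun x => if I x then 2⁻¹ else 2) * ev (repeatRuns p R) h := by
        simp only [repeatRuns, ev_bind, ev_charge, ev_pure, h, List.map_cons, List.prod_cons,
          ev_const_mul]
        simp_rw [mul_comm _ (ev (repeatRuns p R) _), ev_const_mul]
      rw [this, pow_succ']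
      refine mul_le_mul' ?_ ih
      have h3 : ∀ x, (if I x then 2⁻¹ else 2 : ℝ≥0∞) ≤
          2⁻¹ + ENNReal.ofReal (3 / 2) * (if ¬ I x then 1 else 0) := by
        intro x
        by_cases hx : I x
        · simp [hx]
        · simp only [hx, if_false, not_false_eq_true, if_true, mul_one]
          rw [show (2⁻¹ : ℝ≥0∞) = ENNReal.ofReal 2⁻¹ by
            rw [ENNReal.ofReal_inv_of_pos (by norm_num)]; simp,
            ← ENNReal.ofReal_add (by norm_num) (by norm_num)]
          norm_num
      refine (ev_mono p h3).trans ?_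
      rw [ev_add, ev_const, ev_const_mul, ← prob_eq_ev]
      refine (add_le_add_right (mul_le_mul_right hp _) _).trans (le_of_eq ?_)
      rw [show (2⁻¹ : ℝ≥0∞) = ENNReal.ofReal 2⁻¹ by
            rw [ENNReal.ofReal_inv_of_pos (by norm_num)]; simp,
          show (8⁻¹ : ℝ≥0∞) = ENNReal.ofReal 8⁻¹ by
            rw [ENNReal.ofReal_inv_of_pos (by norm_num)]; simp,
          ← ENNReal.ofReal_mul (by norm_num), ← ENNReal.ofReal_add (by norm_num) (by norm_num)]
      norm_num
  rw [prob_eq_ev, ENNReal.ofReal_pow (by norm_num)]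
  refine (ev_mono _ fun l => ?_).trans (h2 R)
  split_ifs with hl
  · exact zero_le
  · rw [h1, ← ENNReal.ofReal_one]
    refine ENNReal.ofReal_le_ofReal ?_
    rw [one_le_div (by positivity)]
    refine pow_le_pow_right₀ (by norm_num) ?_
    exact length_le_two_mul_countP_of_median (l := l) (P := P) (by simpa [P] using hI)
      (by simpa [P] using hl) (by simpa [P] using hne)

end Concentration

/-! ## Correctness of the breadth-first search -/

section Search

variable {n : ℕ}

open Classical in
/-- The vertices of the component of `u`. -/
noncomputable def componentOf (H : SimpleGraph (Fin n)) (u : Fin n) : Finset (Fin n) :=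
  Finset.univ.filter (H.Reachable u)

theorem mem_componentOf {H : SimpleGraph (Fin n)} {u v : Fin n} :
    v ∈ componentOf H u ↔ H.Reachable u v := by
  simp [componentOf]

/-- The number of adjacency-list entries of the vertices in the component of `u`. -/
noncomputable def componentVolume (adj : Fin n → List (Fin n × ℕ)) (H : SimpleGraph (Fin n))
    (u : Fin n) : ℕ :=
  ∑ v ∈ componentOf H u, (adj v).length

namespace BFS

variable (adj : Fin n → List (Fin n × ℕ)) (inH : ℕ → Bool) (dG : ℝ) (H : SimpleGraph (Fin n))
  (u : Fin n)

/-- The invariant of a search in `H` from `u` that has read the part `pre` of the list of `v`. -/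
structure Inv (s : BFS n) (v : Fin n) (pre : List (Fin n × ℕ)) : Prop where
  nodup : s.queue.Nodup
  queue_subset : ∀ q ∈ s.queue, q ∈ s.seen
  cur_mem : v ∈ s.seen
  cur_notMem : v ∉ s.queue
  start_mem : u ∈ s.seen
  reachable : ∀ x ∈ s.seen, H.Reachable u x
  split : adj v = pre ++ s.rest
  cur_eq : s.cur = pre.length
  closed : ∀ x ∈ s.seen, x ∉ s.queue → x ≠ v → ∀ p ∈ adj x, inH p.2 = true → p.1 ∈ s.seen
  closed_cur : ∀ p ∈ pre, inH p.2 = true → p.1 ∈ s.seen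
  read_eq : s.read = s.cur + ∑ x ∈ (s.seen \ s.queue.toFinset).erase v, (adj x).length
  big_true : s.big = true → ∃ x ∈ s.seen, dG < (adj x).length
  cur_le : s.big = false → (s.cur : ℝ) ≤ dG
  length_le : s.big = false → ∀ x ∈ s.seen, x ∉ s.queue → x ≠ v → ((adj x).length : ℝ) ≤ dG

/-- The state satisfies the invariant, and a vertex of the queue is opened as soon as possible. -/
def Good (s : BFS n) : Prop :=
  (∃ v pre, Inv adj inH dG H u s v pre) ∧ (s.rest = [] → s.queue = [])

variable {adj inH dG H u}

theorem inv_start (hdG : 0 ≤ dG) : Inv adj inH dG H u (start adj u) u [] where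
  nodup := by simp [start]
  queue_subset := by simp [start]
  cur_mem := by simp [start]
  cur_notMem := by simp [start]
  start_mem := by simp [start]
  reachable := by
    intro x hx
    obtain rfl : x = u := by simpa [start] using hx
    rfl
  split := by simp [start]
  cur_eq := by simp [start]
  closed := by simp +contextual [start]
  closed_cur := by simp
  read_eq := by simp [start]
  big_true := by simp [start]
  cur_le := by simpa [start] using hdG
  length_le := by simp +contextual [start]

theorem good_start (hdG : 0 ≤ dG) : Good adj inH dG H u (start adj u) :=
  ⟨⟨u, [], inv_start hdG⟩, fun _ => rfl⟩

/-- When the list of `v` is exhausted, `v` joins the closed vertices and its length joins the sum in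
`read_eq`, so the total is unchanged. No list is empty, hence a newly opened vertex always leaves
something to read, as `Good` demands. -/
theorem Inv.next {s : BFS n} {v : Fin n} {pre : List (Fin n × ℕ)}
    (h : Inv adj inH dG H u s v pre) (hadj : ∀ v, adj v ≠ []) :
    Good adj inH dG H u (next adj s) ∧ (next adj s).read = s.read := by
  rcases hr : s.rest with _ | ⟨p, rest⟩
  · rcases hq : s.queue with _ | ⟨x, q⟩
    · have : BFS.next adj s = s := by simp [BFS.next, hr, hq]
      rw [this]
      exact ⟨⟨⟨v, pre, h⟩, fun _ => hq⟩, rfl⟩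
    · have hn : BFS.next adj s = { s with queue := q, rest := adj x, cur := 0 } := by
        simp [BFS.next, hr, hq]
      rw [hn]
      refine ⟨⟨⟨x, [], ?_⟩, fun h0 => absurd h0 (hadj x)⟩, rfl⟩
      have hnd := h.nodup
      have hsub := h.queue_subset
      have hcn := h.cur_notMem
      rw [hq] at hnd hsub hcn
      have hsplit := h.split
      rw [hr, List.append_nil] at hsplit
      have hxq : x ∉ q := (List.nodup_cons.1 hnd).1
      have hold : ∀ y, y ∉ q → y ≠ x → y ∉ s.queue := by
        intro y h1 h2
        rw [hq]
        simp [h1, h2]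
      refine
        { nodup := (List.nodup_cons.1 hnd).2
          queue_subset := fun y hy => hsub y (List.mem_cons_of_mem _ hy)
          cur_mem := hsub x List.mem_cons_self
          cur_notMem := hxq
          start_mem := h.start_mem
          reachable := h.reachable
          split := by simp
          cur_eq := rfl
          closed := ?_
          closed_cur := by simp
          read_eq := ?_
          big_true := h.big_true
          cur_le := fun hb => (Nat.cast_nonneg s.cur).trans (h.cur_le hb) |>.trans' (by simp)
          length_le := ?_ }
      · intro y hy hyq hyx
        by_cases hyv : y = v
        · subst hyv
          rw [hsplit]
          exact h.closed_cur
        · exact h.closed y hy (hold y hyq hyx) hyv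
      · have h1 : (s.seen \ q.toFinset).erase x = s.seen \ s.queue.toFinset := by
          ext y
          simp [hq]
          tauto
        have h2 : v ∈ s.seen \ s.queue.toFinset := by
          simp [h.cur_mem, h.cur_notMem]
        simp only
        rw [h1, ← Finset.add_sum_erase _ _ h2, h.read_eq, h.cur_eq, hsplit, zero_add]
      · intro hb y hy hyq hyx
        by_cases hyv : y = v
        · subst hyv
          rw [hsplit, ← h.cur_eq]
          exact h.cur_le hb
        · exact h.length_le hb y hy (hold y hyq hyx) hyv
  · have : BFS.next adj s = s := by simp [BFS.next, hr]
    rw [this]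
    exact ⟨⟨⟨v, pre, h⟩, fun h0 => by simp [hr] at h0⟩, rfl⟩

theorem Inv.readEntry {s : BFS n} {v : Fin n} {pre : List (Fin n × ℕ)}
    (h : Inv adj inH dG H u s v pre) (hadj : ∀ v, adj v ≠ [])
    (hH : ∀ u v x, (v, x) ∈ adj u → inH x = true → H.Adj u v) (hr : s.rest ≠ []) :
    Good adj inH dG H u (readEntry adj inH dG s) ∧
      (readEntry adj inH dG s).read = s.read + 1 := by
  obtain ⟨⟨y, z⟩, rest, hr⟩ := List.exists_cons_of_ne_nil hr
  have hsplit : adj v = (pre ++ [(y, z)]) ++ rest := by rw [h.split, hr]; simp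
  have hlen : (s.cur : ℝ) + 1 ≤ (adj v).length := by
    rw [hsplit, h.cur_eq]
    simp only [List.append_assoc, List.length_append, List.length_cons, List.length_nil]
    push_cast
    linarith [(Nat.cast_nonneg rest.length : (0 : ℝ) ≤ rest.length)]
  have hyadj : (y, z) ∈ adj v := by rw [h.split, hr]; simp
  set s' : BFS n :=
    { seen := if (inH z && decide (y ∉ s.seen)) = true then insert y s.seen else s.seen
      queue := if (inH z && decide (y ∉ s.seen)) = true then s.queue ++ [y] else s.queue
      rest := rest
      cur := s.cur + 1
      read := s.read + 1
      big := s.big || decide (dG < ((s.cur + 1 : ℕ) : ℝ)) } with hs'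
  have hstep : BFS.readEntry adj inH dG s = BFS.next adj s' := by
    simp only [BFS.readEntry, hr, hs']
  have hbig : s'.big = false → s.big = false ∧ ((s.cur + 1 : ℕ) : ℝ) ≤ dG := by
    intro hb
    simpa [hs'] using hb
  have hbig' : s'.big = true → s.big = true ∨ dG < (adj v).length := by
    intro hb
    have : s.big = true ∨ dG < (s.cur : ℝ) + 1 := by simpa [hs'] using hb
    exact this.imp_right fun h => h.trans_le hlen
  suffices hinv : Inv adj inH dG H u s' v (pre ++ [(y, z)]) by
    rw [hstep]
    exact hinv.next hadj
  have hcur : s'.cur = (pre ++ [(y, z)]).length := by simp [hs', h.cur_eq]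
  by_cases hf : inH z = true ∧ y ∉ s.seen
  · have hseen : s'.seen = insert y s.seen := by simp [hs', hf]
    have hqueue : s'.queue = s.queue ++ [y] := by simp [hs', hf]
    have hyq : y ∉ s.queue := fun hy => hf.2 (h.queue_subset y hy)
    have hvy : v ≠ y := fun hvy => hf.2 (hvy ▸ h.cur_mem)
    have hseen' : ∀ x ∈ s'.seen, x ∉ s'.queue → x ∈ s.seen ∧ x ∉ s.queue := by
      intro x hx hxq
      rw [hseen] at hx
      rw [hqueue] at hxq
      simp only [List.mem_append, List.mem_singleton, not_or] at hxq
      exact ⟨(Finset.mem_insert.1 hx).resolve_left hxq.2, hxq.1⟩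
    refine
      { nodup := by
          rw [hqueue]
          exact List.Nodup.append h.nodup (by simp) (by simpa using hyq)
        queue_subset := ?_
        cur_mem := by rw [hseen]; exact Finset.mem_insert_of_mem h.cur_mem
        cur_notMem := by
          rw [hqueue]
          simp [h.cur_notMem, hvy]
        start_mem := by rw [hseen]; exact Finset.mem_insert_of_mem h.start_mem
        reachable := ?_
        split := hsplit
        cur_eq := hcur
        closed := ?_
        closed_cur := ?_
        read_eq := ?_
        big_true := ?_
        cur_le := fun hb => (hbig hb).2
        length_le := fun hb x hx hxq hxv => h.length_le (hbig hb).1 x (hseen' x hx hxq).1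
          (hseen' x hx hxq).2 hxv }
    · intro q hq
      rw [hqueue] at hq
      rw [hseen]
      rcases List.mem_append.1 hq with hq | hq
      · exact Finset.mem_insert_of_mem (h.queue_subset q hq)
      · simp_all
    · intro x hx
      rw [hseen] at hx
      rcases Finset.mem_insert.1 hx with rfl | hx
      · exact (h.reachable v h.cur_mem).trans (hH v x z hyadj hf.1).reachable
      · exact h.reachable x hx
    · intro x hx hxq hxv p hp hpH
      rw [hseen]
      exact Finset.mem_insert_of_mem
        (h.closed x (hseen' x hx hxq).1 (hseen' x hx hxq).2 hxv p hp hpH)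
    · intro p hp hpH
      rw [hseen]
      rcases List.mem_append.1 hp with hp | hp
      · exact Finset.mem_insert_of_mem (h.closed_cur p hp hpH)
      · simp_all
    -- A fresh vertex enters `seen` and `queue` together, so the set of opened vertices does not
    -- change.
    · have h1 : s'.seen \ s'.queue.toFinset = s.seen \ s.queue.toFinset := by
        rw [hseen, hqueue]
        ext x
        simp only [Finset.mem_sdiff, Finset.mem_insert, List.mem_toFinset, List.mem_append,
          List.mem_singleton, not_or]
        constructor
        · rintro ⟨h1 | h1, h2, h3⟩
          · exact absurd h1 h3
          · exact ⟨h1, h2⟩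
        · rintro ⟨h1, h2⟩
          exact ⟨Or.inr h1, h2, fun h3 => hf.2 (h3 ▸ h1)⟩
      rw [h1]
      simp only [hs']
      rw [h.read_eq]
      omega
    · intro hb
      rw [hseen]
      rcases hbig' hb with hb | hb
      · obtain ⟨x, hx, hxd⟩ := h.big_true hb
        exact ⟨x, Finset.mem_insert_of_mem hx, hxd⟩
      · exact ⟨v, Finset.mem_insert_of_mem h.cur_mem, hb⟩
  · have hff : (inH z && decide (y ∉ s.seen)) = false := by
      simpa using hf
    have hseen : s'.seen = s.seen := by simp only [hs', hff]; simp
    have hqueue : s'.queue = s.queue := by simp only [hs', hff]; simp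
    refine
      { nodup := by rw [hqueue]; exact h.nodup
        queue_subset := by rw [hqueue, hseen]; exact h.queue_subset
        cur_mem := by rw [hseen]; exact h.cur_mem
        cur_notMem := by rw [hqueue]; exact h.cur_notMem
        start_mem := by rw [hseen]; exact h.start_mem
        reachable := by rw [hseen]; exact h.reachable
        split := hsplit
        cur_eq := hcur
        closed := by rw [hseen, hqueue]; exact h.closed
        closed_cur := ?_
        read_eq := ?_
        big_true := ?_
        cur_le := fun hb => (hbig hb).2
        length_le := by
          rw [hseen, hqueue]
          exact fun hb => h.length_le (hbig hb).1 }
    · intro p hp hpH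
      rw [hseen]
      rcases List.mem_append.1 hp with hp | hp
      · exact h.closed_cur p hp hpH
      · obtain rfl : p = (y, z) := by simpa using hp
        exact not_not.1 fun hy => hf ⟨hpH, hy⟩
    · rw [hseen, hqueue]
      simp only [hs']
      rw [h.read_eq]
      omega
    · intro hb
      rw [hseen]
      rcases hbig' hb with hb | hb
      · exact h.big_true hb
      · exact ⟨v, h.cur_mem, hb⟩

/-- The left side is exactly the total length of the lists opened so far, all of which belong to the
component of `u`. -/
theorem Inv.read_le {s : BFS n} {v : Fin n} {pre : List (Fin n × ℕ)}
    (h : Inv adj inH dG H u s v pre) : s.read + s.rest.length ≤ componentVolume adj H u := by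
  have h2 : v ∈ s.seen \ s.queue.toFinset := by
    simp [h.cur_mem, h.cur_notMem]
  have h3 : s.read + s.rest.length = ∑ x ∈ s.seen \ s.queue.toFinset, (adj x).length := by
    rw [← Finset.add_sum_erase _ _ h2, h.read_eq, h.cur_eq, h.split, List.length_append]
    omega
  rw [h3, componentVolume]
  refine Finset.sum_le_sum_of_subset fun x hx => mem_componentOf.2 (h.reachable x ?_)
  exact (Finset.mem_sdiff.1 hx).1

/-- Once nothing is left to read, the queue is empty too, so `seen` is closed under adjacency in `H`
and is the whole component. Conversely, after as many reads as the volume, `Inv.read_le` leaves no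
room for unread entries. -/
theorem Good.finished_iff {s : BFS n} (h : Good adj inH dG H u s)
    (hH : ∀ u v, H.Adj u v → ∃ x, (v, x) ∈ adj u ∧ inH x = true) :
    s.read ≤ componentVolume adj H u ∧ (s.finished = true ↔ s.read = componentVolume adj H u) ∧
      (s.finished = true ↔ s.rest = []) := by
  obtain ⟨⟨v, pre, h⟩, hq⟩ := h
  have hle := h.read_le
  have hfin : s.finished = true ↔ s.rest = [] := by
    simp only [finished, Bool.and_eq_true, List.isEmpty_iff]
    exact ⟨fun h => h.1, fun h => ⟨h, hq h⟩⟩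
  refine ⟨by omega, ?_, hfin⟩
  rw [hfin]
  constructor
  · intro hr
    have hq := hq hr
    have hcl : ∀ x ∈ s.seen, ∀ y, H.Adj x y → y ∈ s.seen := by
      intro x hx y hxy
      obtain ⟨z, hz, hzH⟩ := hH x y hxy
      by_cases hxv : x = v
      · subst hxv
        have := h.split
        rw [hr, List.append_nil] at this
        exact h.closed_cur (y, z) (this ▸ hz) hzH
      · exact h.closed x hx (by simp [hq]) hxv (y, z) hz hzH
    have hall : ∀ x y, H.Reachable x y → x ∈ s.seen → y ∈ s.seen := by
      rintro x y ⟨p⟩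
      induction p with
      | nil => exact id
      | cons hxy _ ih => exact fun hx => ih (hcl _ hx _ hxy)
    have hcomp : componentOf H u = s.seen := by
      ext x
      rw [mem_componentOf]
      exact ⟨fun hx => hall u x hx h.start_mem, h.reachable x⟩
    have h2 : v ∈ s.seen := h.cur_mem
    have := h.split
    rw [hr, List.append_nil] at this
    rw [componentVolume, hcomp, h.read_eq, hq, h.cur_eq, List.toFinset_nil, Finset.sdiff_empty,
      ← Finset.add_sum_erase _ _ h2, this]
  · intro hr
    exact List.length_eq_zero_iff.1 (by omega)

/-- A finished search ignores further requests, hence the cap at the volume: a doubling may ask for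
more entries than exist. -/
theorem Good.iterate {s : BFS n} (h : Good adj inH dG H u s) (hadj : ∀ v, adj v ≠ [])
    (hH : ∀ u v, H.Adj u v ↔ ∃ x, (v, x) ∈ adj u ∧ inH x = true) (k : ℕ) :
    Good adj inH dG H u ((readEntry adj inH dG)^[k] s) ∧
      ((readEntry adj inH dG)^[k] s).read = min (s.read + k) (componentVolume adj H u) := by
  induction k with
  | zero =>
    have := (h.finished_iff fun u v => (hH u v).1).1
    exact ⟨h, by simpa using this⟩
  | succ k ih =>
    rw [Function.iterate_succ_apply']
    obtain ⟨hg, hread⟩ := ih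
    obtain ⟨h1, h2, h3⟩ := hg.finished_iff fun u v => (hH u v).1
    set s' := (BFS.readEntry adj inH dG)^[k] s
    by_cases hr : s'.rest = []
    · have : BFS.readEntry adj inH dG s' = s' := by simp [BFS.readEntry, hr]
      rw [this]
      refine ⟨hg, ?_⟩
      have := h2.1 (h3.2 hr)
      omega
    · obtain ⟨v, pre, hi⟩ := hg.1
      obtain ⟨h4, h5⟩ := hi.readEntry hadj (fun u v x hx hz => (hH u v).2 ⟨x, hx, hz⟩) hr
      refine ⟨h4, ?_⟩
      have : s'.read ≠ componentVolume adj H u := fun h => hr (h3.1 (h2.2 h))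
      omega

/-- As long as no large degree has been met, each opened vertex accounts for at most `dG` entries.
Together with the bound `Γ` on the seen vertices this limits the number of doublings. -/
theorem Good.read_le_mul {s : BFS n} (h : Good adj inH dG H u s) (hb : s.big = false)
    (hdG : 0 ≤ dG) : (s.read : ℝ) ≤ s.seen.card * dG := by
  obtain ⟨⟨v, pre, h⟩, -⟩ := h
  have h2 : v ∈ s.seen := h.cur_mem
  have h3 : ∑ x ∈ (s.seen \ s.queue.toFinset).erase v, ((adj x).length : ℝ) ≤
      ∑ x ∈ s.seen.erase v, dG := by
    refine (Finset.sum_le_sum fun x hx => ?_).trans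
      (Finset.sum_le_sum_of_subset_of_nonneg
        (Finset.erase_subset_erase v Finset.sdiff_subset) fun _ _ _ => hdG)
    simp only [Finset.mem_erase, Finset.mem_sdiff, List.mem_toFinset] at hx
    exact h.length_le hb x hx.2.1 hx.2.2 hx.1
  have h4 := Finset.add_sum_erase s.seen (fun _ => dG) h2
  simp only [Finset.sum_const, nsmul_eq_mul] at h3 h4
  rw [h.read_eq]
  push_cast
  linarith [h.cur_le hb]

/-- Whatever stops the search was seen inside the component, so truncation is a defect of the
component and not of the run. -/
theorem Good.truncated {s : BFS n} (h : Good adj inH dG H u s) {Γ : ℕ}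
    (ht : ¬ (s.seen.card < Γ ∧ s.big = false)) :
    Γ ≤ (componentOf H u).card ∨ ∃ x ∈ componentOf H u, dG < (adj x).length := by
  obtain ⟨⟨v, pre, h⟩, -⟩ := h
  have hsub : s.seen ⊆ componentOf H u := fun x hx => mem_componentOf.2 (h.reachable x hx)
  by_cases hc : s.seen.card < Γ
  · obtain ⟨x, hx, hd⟩ := h.big_true (by simpa [hc] using ht)
    exact Or.inr ⟨x, hsub hx, hd⟩
  · exact Or.inl ((not_lt.1 hc).trans (Finset.card_le_card hsub))

end BFS

end Search

/-! ## The value sampled for one vertex -/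

section VertexEstimate

open RandComp

variable {n : ℕ} {adj : Fin n → List (Fin n × ℕ)} {inH : ℕ → Bool} {dG : ℝ}
  {H : SimpleGraph (Fin n)} {u : Fin n} {Γ : ℕ}

theorem ENNReal.ofReal_half : ENNReal.ofReal (1 / 2) = 2⁻¹ := by
  rw [one_div, ENNReal.ofReal_inv_of_pos (by norm_num)]
  simp

/-- The law of the coin-flipping loop: it returns a value `b` with probability `p`, else `0`. -/
theorem exists_law_coinLoop (hadj : ∀ v, adj v ≠ [])
    (hH : ∀ u v, H.Adj u v ↔ ∃ x, (v, x) ∈ adj u ∧ inH x = true) {du : ℕ} (hdu : 0 < du)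
    (fuel : ℕ) :
    ∀ (flips : ℕ) (s : BFS n), BFS.Good adj inH dG H u s → s.read = du * 2 ^ flips →
      s.read < componentVolume adj H u → componentVolume adj H u < s.read + fuel →
      ∃ p b : ℝ, 0 ≤ p ∧ p ≤ 1 ∧ 0 ≤ b ∧ b ≤ 2 ∧
        p * b ≤ du * 2 ^ flips / componentVolume adj H u ∧
        ((componentOf H u).card < Γ → (∀ x ∈ componentOf H u, ((adj x).length : ℝ) ≤ dG) →
          p * b = du * 2 ^ flips / componentVolume adj H u) ∧
        ∀ g, ev (coinLoop adj inH Γ dG du fuel flips s) g =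
          ENNReal.ofReal p * g b + ENNReal.ofReal (1 - p) * g 0 := by
  induction fuel with
  -- The fuel cannot run out: the two inequalities on the volume contradict each other here, and
  -- each unfinished round doubles `read`.
  | zero =>
    intro flips s _ _ h1 h2
    omega
  | succ fuel ih =>
    intro flips s hs hread hlt hfuel
    have hadd : ∀ z : ℝ≥0∞, 2⁻¹ * z + 2⁻¹ * z = z := by
      intro z
      rw [← add_mul, ENNReal.inv_two_add_inv_two, one_mul]
    by_cases hc : s.seen.card < Γ ∧ s.big = false
    · obtain ⟨hg, hr⟩ := hs.iterate hadj hH s.read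
      obtain ⟨h1, h2, -⟩ := hg.finished_iff fun u v => (hH u v).1
      have hev : ∀ g, ev (coinLoop adj inH Γ dG du (fuel + 1) flips s) g =
          2⁻¹ * ev (if ((BFS.readEntry adj inH dG)^[s.read] s).finished = true then
            pure ((du : ℝ) * 2 ^ (flips + 1) / (((BFS.readEntry adj inH dG)^[s.read] s).read : ℝ))
            else coinLoop adj inH Γ dG du fuel (flips + 1)
              ((BFS.readEntry adj inH dG)^[s.read] s)) g + 2⁻¹ * g 0 := by
        intro g
        rw [coinLoop, ev_bind, ev_coin]
        simp only [hc, and_self, if_true, Bool.false_eq_true, false_and, if_false, ev_bind,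
          ev_charge, ev_pure]
      set s' := (BFS.readEntry adj inH dG)^[s.read] s
      have hvol : (0 : ℝ) < componentVolume adj H u := by
        exact_mod_cast (Nat.zero_le _).trans_lt hlt
      by_cases hfin : s'.finished = true
      · have hrv := h2.1 hfin
        -- The next head finishes the component. Its probability 1/2 cancels the extra factor 2 in
        -- the value, and the value is at most 2 because the `du * 2 ^ flips` entries read before
        -- this round were fewer than the volume.
        refine ⟨1 / 2, du * 2 ^ (flips + 1) / componentVolume adj H u, by norm_num, by norm_num,
          by positivity, ?_, ?_, ?_, ?_⟩
        · rw [div_le_iff₀ hvol]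
          have : (du * 2 ^ flips : ℝ) < componentVolume adj H u := by
            exact_mod_cast hread ▸ hlt
          rw [pow_succ]
          linarith
        · rw [pow_succ]
          exact (by ring : _ = _).le
        · intro _ _
          rw [pow_succ]
          ring
        · intro g
          rw [hev, if_pos hfin, ev_pure, hrv, ENNReal.ofReal_half,
            show (1 : ℝ) - 1 / 2 = 1 / 2 by norm_num, ENNReal.ofReal_half]
      · have hne : s'.read ≠ componentVolume adj H u := fun h => hfin (h2.2 h)
        have hpos : 0 < s.read := by
          rw [hread]
          positivity
        obtain ⟨p, b, hp0, hp1, hb0, hb2, hle, heq, hlaw⟩ := ih (flips + 1) s' hg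
          (by rw [pow_succ, ← mul_assoc, ← hread]; omega) (by omega) (by omega)
        refine ⟨p / 2, b, by linarith, by linarith, hb0, hb2, ?_, ?_, ?_⟩
        · calc p / 2 * b = p * b / 2 := by ring
            _ ≤ (du * 2 ^ (flips + 1) / componentVolume adj H u) / 2 := by gcongr
            _ = _ := by rw [pow_succ]; ring
        · intro h3 h4
          calc p / 2 * b = p * b / 2 := by ring
            _ = (du * 2 ^ (flips + 1) / componentVolume adj H u) / 2 := by rw [heq h3 h4]
            _ = _ := by rw [pow_succ]; ring
        · intro g
          rw [hev, if_neg hfin, hlaw, mul_add, add_assoc, ← mul_assoc, ← mul_assoc, ← add_mul,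
            ← ENNReal.ofReal_half, ← ENNReal.ofReal_mul (by norm_num),
            ← ENNReal.ofReal_mul (by norm_num),
            ← ENNReal.ofReal_add (by linarith) (by norm_num)]
          congr 3 <;> ring
    -- The search is truncated: the value is 0, and the component violates a condition under which
    -- equality is claimed.
    · refine ⟨0, 0, le_rfl, zero_le_one, le_rfl, zero_le_two, ?_, ?_, ?_⟩
      · rw [mul_zero]
        positivity
      · intro h1 h2
        exfalso
        rcases hs.truncated hc with h | ⟨x, hx, h⟩
        · omega
        · exact absurd (h2 x hx) (not_le.2 h)
      · intro g
        rw [coinLoop, ev_bind, ev_coin]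
        simp only [hc, and_false, if_false, ev_pure, hadd]
        simp

theorem componentVolume_ge (u : Fin n) : (adj u).length ≤ componentVolume adj H u :=
  Finset.single_le_sum (f := fun v => (adj v).length) (fun _ _ => Nat.zero_le _)
    (mem_componentOf.2 (SimpleGraph.Reachable.refl u))

theorem exists_law_vertexEstimate (hadj : ∀ v, adj v ≠ []) (hdG : 0 ≤ dG)
    (hH : ∀ u v, H.Adj u v ↔ ∃ x, (v, x) ∈ adj u ∧ inH x = true) (u : Fin n) :
    ∃ p b : ℝ, 0 ≤ p ∧ p ≤ 1 ∧ 0 ≤ b ∧ b ≤ 2 ∧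
        p * b ≤ (adj u).length / componentVolume adj H u ∧
        ((componentOf H u).card < Γ → (∀ x ∈ componentOf H u, ((adj x).length : ℝ) ≤ dG) →
          p * b = (adj u).length / componentVolume adj H u) ∧
        ∀ g, ev (vertexEstimate adj inH Γ dG u) g =
          ENNReal.ofReal p * g b + ENNReal.ofReal (1 - p) * g 0 := by
  obtain ⟨hg, hr⟩ := (BFS.good_start (adj := adj) (inH := inH) (H := H) (u := u) hdG).iterate
    hadj hH (adj u).length
  obtain ⟨h1, h2, -⟩ := hg.finished_iff fun u v => (hH u v).1
  have hge : (adj u).length ≤ componentVolume adj H u := componentVolume_ge u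
  have hpos := List.length_pos_of_ne_nil (hadj u)
  have hev : ∀ g, ev (vertexEstimate adj inH Γ dG u) g =
      ev (if ((BFS.readEntry adj inH dG)^[(adj u).length] (BFS.start adj u)).finished = true then
        pure 1 else coinLoop adj inH Γ dG (adj u).length ((∑ v, (adj v).length) + 1) 0
        ((BFS.readEntry adj inH dG)^[(adj u).length] (BFS.start adj u))) g := by
    intro g
    rw [vertexEstimate]
    simp only [ev_bind, ev_charge]
  set s := (BFS.readEntry adj inH dG)^[(adj u).length] (BFS.start adj u)
  have hr : s.read = (adj u).length := by
    rw [hr]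
    simp [BFS.start, hge]
  by_cases hfin : s.finished = true
  -- Finishing within the first list means that the volume is the degree of `u`, so the value 1 is
  -- the correct ratio.
  · have : ((adj u).length : ℝ) / componentVolume adj H u = 1 := by
      rw [← h2.1 hfin, hr]
      exact div_self (by exact_mod_cast hpos.ne')
    refine ⟨1, 1, by norm_num, by norm_num, by norm_num, by norm_num, by rw [this]; norm_num,
      fun _ _ => by rw [this]; norm_num, fun g => ?_⟩
    rw [hev, if_pos hfin, ev_pure]
    simp
  · have hne : s.read ≠ componentVolume adj H u := fun h => hfin (h2.2 h)
    have hle : componentVolume adj H u ≤ ∑ v, (adj v).length :=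
      Finset.sum_le_sum_of_subset (Finset.subset_univ _)
    obtain ⟨p, b, hp0, hp1, hb0, hb2, hle, heq, hlaw⟩ :=
      exists_law_coinLoop (Γ := Γ) hadj hH hpos ((∑ v, (adj v).length) + 1) 0 s hg
        (by simpa using hr) (by omega) (by omega)
    simp only [pow_zero, mul_one] at hle heq
    refine ⟨p, b, hp0, hp1, hb0, hb2, hle, heq, fun g => ?_⟩
    rw [hev, if_neg hfin, hlaw]

/-! ### Expected running time -/

/-- Here `l` bounds the rounds that can still follow: entering a round requires `s.read ≤ Γ * dG` by
`Good.read_le_mul`. A round reads at most `s.read` new entries and is entered with probability at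
most 1/2; if it does not finish, `read` has doubled. The halving and the doubling cancel, so every
round adds at most the same amount `s.read` to the expected time. -/
theorem expTime_coinLoop_le (hadj : ∀ v, adj v ≠ []) (hdG : 0 ≤ dG)
    (hH : ∀ u v, H.Adj u v ↔ ∃ x, (v, x) ∈ adj u ∧ inH x = true) (du : ℕ) (fuel : ℕ) :
    ∀ (flips : ℕ) (s : BFS n) (l : ℕ), BFS.Good adj inH dG H u s → Γ * dG < s.read * 2 ^ l →
      expTime (coinLoop adj inH Γ dG du fuel flips s) ≤ (3 + s.read * l : ℕ) := by
  induction fuel with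
  | zero =>
    intro flips s l _ _
    rw [coinLoop, expTime_pure]
    exact zero_le
  | succ fuel ih =>
    intro flips s l hs hl
    rw [coinLoop, expTime_bind, expTime_coin, ev_coin]
    by_cases hc : s.seen.card < Γ ∧ s.big = false
    · obtain ⟨hg, hr⟩ := hs.iterate hadj hH s.read
      obtain ⟨h1, h2, -⟩ := hg.finished_iff fun u v => (hH u v).1
      simp only [hc, and_self, if_true, Bool.false_eq_true, false_and, if_false, expTime_pure,
        mul_zero, add_zero, expTime_bind, expTime_charge, ev_charge]
      have hread : (s.read : ℝ) ≤ Γ * dG := (hs.read_le_mul hc.2 hdG).trans (by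
        have : (s.seen.card : ℝ) ≤ Γ := by exact_mod_cast hc.1.le
        gcongr)
      obtain _ | l := l
      · simp only [pow_zero, mul_one] at hl
        linarith
      set s' := (BFS.readEntry adj inH dG)^[s.read] s
      have key : expTime (if s'.finished = true then
          pure ((du : ℝ) * 2 ^ (flips + 1) / (s'.read : ℝ))
          else coinLoop adj inH Γ dG du fuel (flips + 1) s') ≤ (3 + 2 * s.read * l : ℕ) := by
        split_ifs with hfin
        · rw [expTime_pure]
          exact zero_le
        · have hne : s'.read ≠ componentVolume adj H u := fun h => hfin (h2.2 h)
          have h2r : s'.read = 2 * s.read := by omega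
          rw [← h2r]
          refine ih _ _ _ hg ?_
          rw [h2r]
          push_cast
          rw [pow_succ] at hl
          linarith
      calc _ ≤ (1 : ℝ≥0∞) + 2⁻¹ * ((2 * (2 + s.read * (l + 1)) : ℕ) : ℝ≥0∞) := by
            gcongr
            refine (add_le_add_right key _).trans ?_
            rw [← Nat.cast_add]
            have : s'.read - s.read + 1 + (3 + 2 * s.read * l) ≤ 2 * (2 + s.read * (l + 1)) := by
              have : s'.read - s.read ≤ s.read := by omega
              nlinarith
            exact_mod_cast this
        _ = _ := by
            rw [Nat.cast_mul, ← mul_assoc, Nat.cast_ofNat,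
              ENNReal.inv_mul_cancel (by norm_num) (by norm_num), one_mul]
            push_cast
            ring
    · simp only [hc, and_false, if_false, expTime_pure, mul_zero, add_zero]
      have : 1 ≤ 3 + s.read * l := by omega
      exact_mod_cast this

theorem expTime_vertexEstimate_le (hadj : ∀ v, adj v ≠ []) (hdG : 0 ≤ dG)
    (hH : ∀ u v, H.Adj u v ↔ ∃ x, (v, x) ∈ adj u ∧ inH x = true) (u : Fin n) {l : ℕ}
    (hl : Γ * dG < 2 ^ l) :
    expTime (vertexEstimate adj inH Γ dG u) ≤ ((adj u).length * (l + 5) : ℕ) := by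
  obtain ⟨hg, hr⟩ := (BFS.good_start (adj := adj) (inH := inH) (H := H) (u := u) hdG).iterate
    hadj hH (adj u).length
  have hge : (adj u).length ≤ componentVolume adj H u := componentVolume_ge u
  have hpos := List.length_pos_of_ne_nil (hadj u)
  have hr' : ((BFS.readEntry adj inH dG)^[(adj u).length] (BFS.start adj u)).read =
      (adj u).length := by
    rw [hr]
    simp [BFS.start, hge]
  have hl' : Γ * dG < (adj u).length * 2 ^ l := hl.trans_le (by
    have : (1 : ℝ) ≤ (adj u).length := by exact_mod_cast hpos
    nlinarith [pow_pos (zero_lt_two' ℝ) l])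
  rw [vertexEstimate]
  simp only [expTime_bind, expTime_charge, ev_charge]
  have key : expTime (if ((BFS.readEntry adj inH dG)^[(adj u).length]
      (BFS.start adj u)).finished = true then pure 1 else
        coinLoop adj inH Γ dG (adj u).length ((∑ v, (adj v).length) + 1) 0
        ((BFS.readEntry adj inH dG)^[(adj u).length] (BFS.start adj u))) ≤
      (3 + (adj u).length * l : ℕ) := by
    split_ifs
    · rw [expTime_pure]
      exact zero_le
    · have := expTime_coinLoop_le (Γ := Γ) hadj hdG hH (adj u).length
        ((∑ v, (adj v).length) + 1) 0 _ l hg (by rwa [hr'])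
      rwa [hr'] at this
  refine (add_le_add_right key _).trans ?_
  rw [← Nat.cast_add]
  have : (adj u).length + 1 + (3 + (adj u).length * l) ≤ (adj u).length * (l + 5) := by nlinarith
  exact_mod_cast this

end VertexEstimate

/-! ## Accuracy of the component estimator -/

section ComponentEstimator

open RandComp

variable {n : ℕ} {adj : Fin n → List (Fin n × ℕ)} {inH : ℕ → Bool} {dG : ℝ}
  {H : SimpleGraph (Fin n)} {u : Fin n} {Γ : ℕ}

open Classical in
-- Inside a component the ratios of degree to volume sum to 1, so this weighting of vertices counts
-- every component once. It is the source of unbiasedness, and with a general `f` also of the bound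
-- on the bias.
theorem sum_div_componentVolume (hadj : ∀ v, adj v ≠ []) [Fintype H.ConnectedComponent]
    (f : H.ConnectedComponent → ℝ) :
    ∑ u, ((adj u).length : ℝ) / componentVolume adj H u * f (H.connectedComponentMk u) =
      ∑ C, f C := by
  rw [← Finset.sum_fiberwise Finset.univ H.connectedComponentMk]
  refine Finset.sum_congr rfl fun C _ => ?_
  induction C using SimpleGraph.ConnectedComponent.ind with
  | h v =>
    have hset : Finset.univ.filter (fun u => H.connectedComponentMk u = H.connectedComponentMk v) =
        componentOf H v := by
      ext u
      simp only [Finset.mem_filter, Finset.mem_univ, true_and, mem_componentOf,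
        SimpleGraph.ConnectedComponent.eq]
      exact SimpleGraph.reachable_comm
    rw [hset]
    have hvol : ∀ u ∈ componentOf H v, componentVolume adj H u = componentVolume adj H v := by
      intro u hu
      have huv := mem_componentOf.1 hu
      have : componentOf H u = componentOf H v := by
        ext x
        rw [mem_componentOf, mem_componentOf]
        exact ⟨huv.trans, huv.symm.trans⟩
      rw [componentVolume, this, componentVolume]
    have hmk : ∀ u ∈ componentOf H v, H.connectedComponentMk u = H.connectedComponentMk v :=
      fun u hu => SimpleGraph.ConnectedComponent.eq.2 (mem_componentOf.1 hu).symm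
    rw [Finset.sum_congr rfl fun u hu => by rw [hvol u hu, hmk u hu]]
    rw [← Finset.sum_mul, ← Finset.sum_div, ← Nat.cast_sum, ← componentVolume, div_self, one_mul]
    have := componentVolume_ge (adj := adj) (H := H) v
    have hpos := List.length_pos_of_ne_nil (hadj v)
    exact_mod_cast (hpos.trans_le this).ne'

theorem componentOf_eq_filter (u : Fin n)
    [DecidablePred fun v => H.connectedComponentMk v = H.connectedComponentMk u] :
    componentOf H u =
      Finset.univ.filter (fun v => H.connectedComponentMk v = H.connectedComponentMk u) := by
  ext v
  simp only [Finset.mem_filter, Finset.mem_univ, true_and, mem_componentOf,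
    SimpleGraph.ConnectedComponent.eq]
  exact SimpleGraph.reachable_comm

/-- The law of the value sampled for a random vertex, and its mean. -/
theorem exists_law_sample [NeZero n] (hadj : ∀ v, adj v ≠ []) (hdG : 0 < dG) (hΓ : 0 < Γ)
    (hH : ∀ u v, H.Adj u v ↔ ∃ x, (v, x) ∈ adj u ∧ inH x = true) :
    ∃ q b : Fin n × Bool → ℝ, (∀ i, 0 ≤ q i) ∧ ∑ i, q i = 1 ∧ (∀ i, 0 ≤ b i) ∧ (∀ i, b i ≤ 2) ∧
      (∀ g, ev (vertex n) (fun u => ev (vertexEstimate adj inH Γ dG u) g) =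
        ∑ i, ENNReal.ofReal (q i) * g (b i)) ∧
      n * ∑ i, q i * b i ≤ Nat.card H.ConnectedComponent ∧
      Nat.card H.ConnectedComponent - (n / Γ + (∑ v, ((adj v).length : ℝ)) / dG) ≤
        n * ∑ i, q i * b i := by
  classical
  have : Fintype H.ConnectedComponent := Fintype.ofFinite _
  choose p b hp0 hp1 hb0 hb2 hle heq hlaw using
    exists_law_vertexEstimate (Γ := Γ) hadj hdG.le hH
  have hn : (0 : ℝ) < n := by exact_mod_cast Nat.pos_of_ne_zero (NeZero.ne n)
  have hmean : (n : ℝ) * ∑ i : Fin n × Bool,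
      (if i.2 then p i.1 / n else (1 - p i.1) / n) * (if i.2 then b i.1 else 0) =
        ∑ u, p u * b u := by
    rw [Fintype.sum_prod_type, Finset.mul_sum]
    refine Finset.sum_congr rfl fun u _ => ?_
    simp only [Fintype.sum_bool, if_true, Bool.false_eq_true, if_false, mul_zero, add_zero]
    field_simp
  -- The sample space is a vertex together with a bit telling whether the loop returned `b u` or 0.
  refine ⟨fun i => if i.2 then p i.1 / n else (1 - p i.1) / n, fun i => if i.2 then b i.1 else 0,
    ?_, ?_, ?_, ?_, ?_, ?_, ?_⟩
  · rintro ⟨u, _ | _⟩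
    · simpa using div_nonneg (sub_nonneg.2 (hp1 u)) hn.le
    · simpa using div_nonneg (hp0 u) hn.le
  · rw [Fintype.sum_prod_type]
    simp only [Fintype.sum_bool, if_true, Bool.false_eq_true, if_false]
    have : ∀ u, p u / n + (1 - p u) / n = (1 : ℝ) / n := fun u => by ring
    simp_rw [this]
    simp [hn.ne']
  · rintro ⟨u, _ | _⟩
    · simp
    · simpa using hb0 u
  · rintro ⟨u, _ | _⟩
    · simp
    · simpa using hb2 u
  · intro g
    rw [ev_vertex, Fintype.sum_prod_type]
    refine Finset.sum_congr rfl fun u _ => ?_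
    have hinv : (n : ℝ≥0∞)⁻¹ = ENNReal.ofReal (n : ℝ)⁻¹ := by
      rw [ENNReal.ofReal_inv_of_pos hn, ENNReal.ofReal_natCast]
    simp only [Fintype.sum_bool, if_true, Bool.false_eq_true, if_false]
    rw [hlaw, mul_add, ← mul_assoc, ← mul_assoc, hinv, ← ENNReal.ofReal_mul (by positivity),
      ← ENNReal.ofReal_mul (by positivity), inv_mul_eq_div, inv_mul_eq_div]
  · rw [hmean]
    have h1 := sum_div_componentVolume (H := H) hadj fun _ => 1
    simp only [mul_one, Finset.sum_const, Finset.card_univ, nsmul_eq_mul] at h1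
    rw [Nat.card_eq_fintype_card, ← h1]
    exact Finset.sum_le_sum fun u _ => hle u
  · rw [hmean]
    -- Each vertex `v` carries the charge 1/Γ + deg(v)/dG. A truncated component holds `Γ` vertices
    -- or one of degree above `dG`, so its charges sum to at least 1 and its weight here is at most
    -- 0; every other weight is at most 1. The total charge bounds the bias.
    have h1 := sum_div_componentVolume (H := H) hadj fun C =>
      1 - ∑ v with H.connectedComponentMk v = C, (1 / (Γ : ℝ) + (adj v).length / dG)
    have hfib : ∑ C, ∑ v with H.connectedComponentMk v = C, (1 / (Γ : ℝ) + (adj v).length / dG) =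
        ∑ v, (1 / (Γ : ℝ) + (adj v).length / dG) := by
      convert Finset.sum_fiberwise Finset.univ H.connectedComponentMk _
    rw [Finset.sum_sub_distrib, hfib, Finset.sum_add_distrib] at h1
    simp only [Finset.sum_const, Finset.card_univ, nsmul_eq_mul, mul_one, Fintype.card_fin] at h1
    rw [← Finset.sum_div, mul_one_div] at h1
    rw [Nat.card_eq_fintype_card, ← h1]
    refine Finset.sum_le_sum fun u _ => ?_
    rw [← componentOf_eq_filter]
    have hΓ' : (0 : ℝ) < Γ := by exact_mod_cast hΓ
    have hnn : ∀ v, (0 : ℝ) ≤ 1 / (Γ : ℝ) + (adj v).length / dG := fun v => by positivity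
    have hvn : (0 : ℝ) ≤ ((adj u).length : ℝ) / componentVolume adj H u := by positivity
    by_cases hfine : (componentOf H u).card < Γ ∧
        ∀ x ∈ componentOf H u, ((adj x).length : ℝ) ≤ dG
    · rw [heq u hfine.1 hfine.2]
      have : 0 ≤ ∑ v ∈ componentOf H u, (1 / (Γ : ℝ) + (adj v).length / dG) :=
        Finset.sum_nonneg fun v _ => hnn v
      exact mul_le_of_le_one_right hvn (by linarith)
    · refine le_trans (mul_nonpos_of_nonneg_of_nonpos hvn (sub_nonpos.2 ?_))
        (mul_nonneg (hp0 u) (hb0 u))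
      by_cases hc : (componentOf H u).card < Γ
      · have : ∃ x ∈ componentOf H u, dG < (adj x).length := by
          by_contra hcon
          push Not at hcon
          exact hfine ⟨hc, hcon⟩
        obtain ⟨x, hx, hd⟩ := this
        refine le_trans ?_ (Finset.single_le_sum (fun v _ => hnn v) hx)
        have : 1 ≤ ((adj x).length : ℝ) / dG := (one_le_div hdG).2 hd.le
        have : 0 < 1 / (Γ : ℝ) := by positivity
        linarith
      · calc (1 : ℝ) ≤ ∑ v ∈ componentOf H u, 1 / (Γ : ℝ) := by
              rw [Finset.sum_const, nsmul_eq_mul, mul_one_div, one_le_div hΓ']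
              exact_mod_cast not_lt.1 hc
          _ ≤ _ := Finset.sum_le_sum fun v _ => le_add_of_nonneg_right (by positivity)

/-- With probability at least `7/8` the component estimator is accurate. -/
theorem prob_approxComponents_le [NeZero n] (hadj : ∀ v, adj v ≠ [])
    (hH : ∀ u v, H.Adj u v ↔ ∃ x, (v, x) ∈ adj u ∧ inH x = true) {ε k d : ℝ} (hε : 0 < ε)
    (hk : 0 < k) (hd : 0 < d) (hsum : ∑ v, ((adj v).length : ℝ) = d * n) :
    (approxComponents adj inH ε k d).prob (fun x =>
      ¬ |x - Nat.card H.ConnectedComponent| ≤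
        ε * max (Nat.card H.ConnectedComponent : ℝ) (n / k)) ≤ 8⁻¹ := by
  classical
  set c : ℝ := (Nat.card H.ConnectedComponent : ℝ) with hc
  set M := max c (n / k) with hM
  set r := ⌈64 * k / ε ^ 2⌉₊ with hr
  set Γ := ⌈4 * k / ε⌉₊ with hΓ
  have hn : (0 : ℝ) < n := by exact_mod_cast Nat.pos_of_ne_zero (NeZero.ne n)
  have hr0 : 0 < r := Nat.ceil_pos.2 (by positivity)
  have hΓ0 : 0 < Γ := Nat.ceil_pos.2 (by positivity)
  have hr0' : (0 : ℝ) < r := by exact_mod_cast hr0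
  have hΓ0' : (0 : ℝ) < Γ := by exact_mod_cast hΓ0
  obtain ⟨q, b, hq0, hq1, hb0, hb2, hlaw, hup, hlo⟩ :=
    exists_law_sample (H := H) (inH := inH) (dG := d * Γ) hadj (by positivity) hΓ0 hH
  set μ := ∑ i, q i * b i with hμ
  have hμ0 : 0 ≤ μ := Finset.sum_nonneg fun i _ => mul_nonneg (hq0 i) (hb0 i)
  have hM0 : 0 < M := lt_max_of_lt_right (by positivity)
  have hcM : c ≤ M := le_max_left _ _
  have hnM : n / k ≤ M := le_max_right _ _
  -- The degrees sum to d n, so both kinds of charge total n/Γ, and Γ ≥ 4k/ε.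
  have hbias : (n : ℝ) / Γ + (∑ v, ((adj v).length : ℝ)) / (d * Γ) ≤ ε / 2 * M := by
    rw [hsum]
    have h1 : (n : ℝ) / Γ + d * n / (d * Γ) = 2 * n / Γ := by
      field_simp
      ring
    rw [h1, div_le_iff₀ hΓ0']
    have h2 : 4 * k / ε ≤ Γ := Nat.le_ceil _
    calc 2 * (n : ℝ) = ε / 2 * (n / k) * (4 * k / ε) := by field_simp; ring
      _ ≤ ε / 2 * M * Γ := by gcongr
  -- Half of the allowed error goes to the bias and half to the deviation; `a` is that half before
  -- scaling by n/r.
  set a := r / n * (ε / 2 * M) with ha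
  have ha0 : 0 < a := by positivity
  have hcheb := prob_sampleSum_le hq0 hq1 hlaw hb0 hb2 r ha0
  rw [← hμ] at hcheb
  -- With μ ≤ M/n the quotient is at most 8n / (r ε² M), and r ε² ≥ 64k together with M k ≥ n brings
  -- it to 1/8.
  have hfin : 2 * r * μ / a ^ 2 ≤ 1 / 8 := by
    rw [div_le_iff₀ (by positivity)]
    have h2 : 64 * k / ε ^ 2 ≤ r := Nat.le_ceil _
    have h3 : μ ≤ M / n := by
      rw [le_div_iff₀ hn]
      linarith
    have h4 : 64 * k ≤ r * ε ^ 2 := by rwa [div_le_iff₀ (by positivity)] at h2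
    have h5 : (n : ℝ) ≤ M * k := by rwa [div_le_iff₀ hk] at hnM
    have h6 : 64 * n ≤ r * ε ^ 2 * M := by nlinarith
    calc 2 * r * μ ≤ 2 * r * (M / n) := by gcongr
      _ = (64 * n) * (r * M / (32 * n ^ 2)) := by field_simp; ring
      _ ≤ (r * ε ^ 2 * M) * (r * M / (32 * n ^ 2)) := by gcongr
      _ = 1 / 8 * a ^ 2 := by rw [ha]; field_simp; ring
  have hout : ∀ S : ℝ, ¬ |n / r * S - c| ≤ ε * M → a ≤ |S - r * μ| := by
    intro S hS
    by_contra hcon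
    refine hS ?_
    have h1 : |S - r * μ| * (n / r) ≤ ε / 2 * M := by
      have : |S - r * μ| * (n / r) ≤ a * (n / r) := by
        gcongr
        exact (not_le.1 hcon).le
      refine this.trans (le_of_eq ?_)
      rw [ha]
      field_simp
    have h2 : |n / r * S - n * μ| ≤ ε / 2 * M := by
      refine le_trans (le_of_eq ?_) h1
      rw [← abs_of_pos (show (0 : ℝ) < n / r by positivity), ← abs_mul,
        abs_of_pos (show (0 : ℝ) < n / r by positivity)]
      congr 1
      field_simp
    rw [abs_le] at h2 ⊢
    constructor <;> linarith [h2.1, h2.2]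
  calc _ = (sampleSum adj inH Γ (d * Γ) r).prob fun S => ¬ |n / r * S - c| ≤ ε * M := by
        rw [prob_eq_ev, prob_eq_ev, approxComponents]
        simp only [ev_bind, ev_charge, ev_pure]
        rfl
    _ ≤ (sampleSum adj inH Γ (d * Γ) r).prob fun S => a ≤ |S - r * μ| := prob_mono _ hout
    _ ≤ ENNReal.ofReal (1 / 8) := hcheb.trans (ENNReal.ofReal_le_ofReal hfin)
    _ = 8⁻¹ := by
        rw [one_div, ENNReal.ofReal_inv_of_pos (by norm_num)]
        simp

/-- The amplified estimator fails with probability at most `δ`. -/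
theorem prob_medianTrick_le [NeZero n] (hadj : ∀ v, adj v ≠ [])
    (hH : ∀ u v, H.Adj u v ↔ ∃ x, (v, x) ∈ adj u ∧ inH x = true) {ε k d : ℝ} (hε : 0 < ε)
    (hk : 0 < k) (hd : 0 < d) (hsum : ∑ v, ((adj v).length : ℝ) = d * n) {δ : ℝ}
    (hδ : 0 < δ) :
    (medianTrick adj inH 4 ε k d δ).prob (fun x =>
      ¬ |x - Nat.card H.ConnectedComponent| ≤
        ε * max (Nat.card H.ConnectedComponent : ℝ) (n / k)) ≤ ENNReal.ofReal δ := by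
  classical
  set c : ℝ := (Nat.card H.ConnectedComponent : ℝ) with hc
  set M := max c (n / k) with hM
  have hM0 : 0 ≤ M := le_max_of_le_left (Nat.cast_nonneg _)
  have hset : {x | |x - c| ≤ ε * M} = Set.Icc (c - ε * M) (c + ε * M) := by
    ext x
    simp only [Set.mem_ofPred_eq, Set.mem_Icc, abs_le]
    constructor <;> rintro ⟨h1, h2⟩ <;> constructor <;> linarith
  have h := prob_median_repeatRuns_le (p := approxComponents adj inH ε k d)
    (I := fun x => |x - c| ≤ ε * M) (by rw [hset]; exact Set.ordConnected_Icc)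
    ⟨c, by simpa using mul_nonneg hε.le hM0⟩
    (prob_approxComponents_le hadj hH hε hk hd hsum) ⌈4 * Real.log (1 / δ)⌉₊
  calc _ = (repeatRuns (approxComponents adj inH ε k d) ⌈4 * Real.log (1 / δ)⌉₊).prob
        fun l => ¬ |median l - c| ≤ ε * M := by
        rw [prob_eq_ev, prob_eq_ev, medianTrick]
        simp only [ev_bind, ev_charge, ev_pure]
    _ ≤ _ := h.trans (ENNReal.ofReal_le_ofReal ?_)
  -- The choice κ = 4 comes from here: 4 log(1/δ) runs, each gaining a factor of at most e^(-1/4).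
  have hlog : Real.log (11 / 16) ≤ -(1 / 4) := by
    have := Real.log_le_sub_one_of_pos (show (0 : ℝ) < 11 / 16 by norm_num)
    linarith
  rw [← Real.log_le_log_iff (by positivity) hδ, Real.log_pow]
  have h1 : 4 * Real.log (1 / δ) ≤ ⌈4 * Real.log (1 / δ)⌉₊ := Nat.le_ceil _
  rw [one_div, Real.log_inv] at h1 ⊢
  nlinarith [(Nat.cast_nonneg ⌈4 * -Real.log δ⌉₊ : (0 : ℝ) ≤ _)]

end ComponentEstimator

/-! ## Minimum spanning trees and threshold graphs -/

section SpanningTrees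

open SimpleGraph

variable {n : ℕ}

/-- The edges of weight at most `j`. -/
def thresholdGraph (G : SimpleGraph (Fin n)) (w : Sym2 (Fin n) → ℕ) (j : ℕ) :
    SimpleGraph (Fin n) where
  Adj u v := G.Adj u v ∧ w s(u, v) ≤ j
  symm := ⟨fun u v h => ⟨h.1.symm, by rw [Sym2.eq_swap]; exact h.2⟩⟩
  loopless := ⟨fun u h => G.loopless.irrefl u h.1⟩

/-- The number of connected components. -/
noncomputable def componentCount (G : SimpleGraph (Fin n)) : ℕ := Nat.card G.ConnectedComponent

theorem mem_edgesOf {T : SimpleGraph (Fin n)} {e : Sym2 (Fin n)} :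
    e ∈ edgesOf T ↔ e ∈ T.edgeSet := by
  simp [edgesOf]

theorem thresholdGraph_mono {F G : SimpleGraph (Fin n)} (h : F ≤ G) (w : Sym2 (Fin n) → ℕ)
    (j : ℕ) : thresholdGraph F w j ≤ thresholdGraph G w j :=
  fun _ _ hxy => ⟨h hxy.1, hxy.2⟩

theorem thresholdGraph_le (G : SimpleGraph (Fin n)) (w : Sym2 (Fin n) → ℕ) (j : ℕ) :
    thresholdGraph G w j ≤ G :=
  fun _ _ hxy => hxy.1

theorem edgesOf_thresholdGraph (G : SimpleGraph (Fin n)) (w : Sym2 (Fin n) → ℕ) (j : ℕ) :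
    edgesOf (thresholdGraph G w j) = (edgesOf G).filter fun e => w e ≤ j := by
  ext e
  induction e using Sym2.ind with
  | h u v => simp [mem_edgesOf, thresholdGraph]

theorem edgesOf_mono {F G : SimpleGraph (Fin n)} (h : F ≤ G) : edgesOf F ⊆ edgesOf G :=
  fun _ he => mem_edgesOf.2 (edgeSet_mono h (mem_edgesOf.1 he))

theorem componentCount_le (G : SimpleGraph (Fin n)) : componentCount G ≤ n := by
  have := Nat.card_le_card_of_surjective G.connectedComponentMk
    (fun C => C.ind fun v => ⟨v, rfl⟩)
  simpa [componentCount] using this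

theorem edgesOf_deleteEdge (T : SimpleGraph (Fin n)) (e : Sym2 (Fin n)) :
    edgesOf (T.deleteEdges {e}) = (edgesOf T).erase e := by
  ext x
  simp [mem_edgesOf, edgeSet_deleteEdges, and_comm]

/-- Every edge of a forest is a bridge: deleting it splits the component of its endpoints, so the
surjection between the sets of components is not injective. -/
theorem componentCount_lt_deleteEdge {F : SimpleGraph (Fin n)} (hF : F.IsAcyclic)
    {e : Sym2 (Fin n)} (he : e ∈ F.edgeSet) :
    componentCount F < componentCount (F.deleteEdges {e}) := by
  classical
  induction e using Sym2.ind with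
  | h a b =>
    have hb := isAcyclic_iff_forall_isBridge.1 hF he
    rw [isBridge_iff] at hb
    have := Fintype.ofFinite F.ConnectedComponent
    have := Fintype.ofFinite (F.deleteEdges {s(a, b)}).ConnectedComponent
    rw [componentCount, componentCount, Nat.card_eq_fintype_card, Nat.card_eq_fintype_card]
    refine Fintype.card_lt_of_surjective_not_injective _
      (ConnectedComponent.surjective_map_ofLE (deleteEdges_le {s(a, b)})) fun hinj => hb ?_
    refine ConnectedComponent.eq.1 (hinj ?_)
    rw [ConnectedComponent.map_mk, ConnectedComponent.map_mk]
    exact ConnectedComponent.eq.2 (Adj.reachable he)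

/-- Enlarging a forest inside a forest lowers the number of components by at least the number of
new edges. -/
theorem componentCount_add_card_edgesOf_le {F F' : SimpleGraph (Fin n)} (h : F ≤ F')
    (hF' : F'.IsAcyclic) :
    componentCount F' + (edgesOf F').card ≤ componentCount F + (edgesOf F).card := by
  induction hk : (edgesOf F').card generalizing F' with
  | zero =>
    have h1 : edgesOf F = ∅ := Finset.subset_empty.1
      (Finset.card_eq_zero.1 hk ▸ edgesOf_mono h)
    have h2 : F' ≤ F := by
      rw [← edgeSet_subset_edgeSet]
      intro e he
      rw [← mem_edgesOf, Finset.card_eq_zero.1 hk] at he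
      simp at he
    rw [le_antisymm h2 h]
    omega
  | succ k ih =>
    by_cases hFF : F' ≤ F
    · rw [le_antisymm hFF h] at hk ⊢
      omega
    · obtain ⟨e, he, heF⟩ := Set.not_subset.1 fun hs => hFF (edgeSet_subset_edgeSet.1 hs)
      have h1 : F ≤ F'.deleteEdges {e} := by
        rw [← edgeSet_subset_edgeSet, edgeSet_deleteEdges]
        intro x hx
        exact ⟨edgeSet_mono h hx, fun hxe => heF (hxe ▸ hx)⟩
      have h2 : (edgesOf (F'.deleteEdges {e})).card = k := by
        rw [edgesOf_deleteEdge, Finset.card_erase_of_mem (mem_edgesOf.2 he), hk]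
        rfl
      have h3 := ih h1 (hF'.anti (deleteEdges_le _)) h2
      have h4 := componentCount_lt_deleteEdge hF' he
      omega

theorem IsAcyclic.componentCount_add_card_le {F : SimpleGraph (Fin n)} (hF : F.IsAcyclic) :
    componentCount F + (edgesOf F).card ≤ n := by
  have h1 := componentCount_add_card_edgesOf_le bot_le hF
  have h2 : edgesOf (⊥ : SimpleGraph (Fin n)) = ∅ := by
    ext e
    simp [mem_edgesOf]
  have h3 := componentCount_le (⊥ : SimpleGraph (Fin n))
  rw [h2, Finset.card_empty] at h1
  omega

theorem IsTree.card_edgesOf {T : SimpleGraph (Fin n)} (hT : T.IsTree) :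
    (edgesOf T).card + 1 = n := by
  classical
  have := hT.card_edgeFinset
  rw [Fintype.card_fin] at this
  have h : edgesOf T = T.edgeFinset := by
    ext e
    simp [mem_edgesOf]
  rwa [h]

theorem isTree_of_isAcyclic_of_card {F : SimpleGraph (Fin n)} (hF : F.IsAcyclic)
    (hcard : (edgesOf F).card + 1 = n) : F.IsTree := by
  have h1 := IsAcyclic.componentCount_add_card_le hF
  have h2 : componentCount F ≤ 1 := by omega
  have h3 : Subsingleton F.ConnectedComponent := Finite.card_le_one_iff_subsingleton.1 h2
  have : Nonempty (Fin n) := ⟨⟨0, by omega⟩⟩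
  exact ⟨⟨fun u v => ConnectedComponent.eq.1 (Subsingleton.elim _ _)⟩, hF⟩

/-- The light edges of a minimum spanning tree span the components of a threshold graph. -/
theorem IsMinSpanningTree.reachable_thresholdGraph {G T : SimpleGraph (Fin n)}
    {w : Sym2 (Fin n) → ℕ} (hT : IsMinSpanningTree G w T) {j : ℕ} {u v : Fin n}
    (huv : (thresholdGraph G w j).Adj u v) : (thresholdGraph T w j).Reachable u v := by
  classical
  by_contra hnr
  obtain ⟨hTG, htree, hmin⟩ := hT
  obtain ⟨p, hp, -⟩ := htree.existsUnique_path u v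
  -- The tree path from `u` to `v` leaves the light component of `u` somewhere, necessarily through
  -- an edge heavier than `j`.
  obtain ⟨d, hd, hd1, hd2⟩ := p.exists_boundary_dart {x | (thresholdGraph T w j).Reachable u x}
    (Reachable.refl u) hnr
  have hdadj : T.Adj d.fst d.snd := d.adj
  have hw : j < w d.edge := by
    by_contra hle
    exact hd2 (Reachable.trans hd1 (Adj.reachable ⟨hdadj, not_lt.1 hle⟩))
  have hnreach : ¬ (T.deleteEdges {d.edge}).Reachable u v := by
    rintro ⟨q⟩
    have hq := q.toPath.2
    have h1 := (htree.existsUnique_path u v).unique hp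
      ((hq : (q.toPath : (T.deleteEdges {d.edge}).Walk u v).IsPath).mapLe
        (deleteEdges_le {d.edge}))
    have h2 : d.edge ∈ p.edges := List.mem_map_of_mem hd
    rw [h1, Walk.edges_mapLe_eq_edges] at h2
    have h3 := Walk.edges_subset_edgeSet _ h2
    rw [edgeSet_deleteEdges] at h3
    exact h3.2 rfl
  have hne : u ≠ v := huv.1.ne
  -- Exchange: replacing that heavy edge by `uv` gives a spanning tree of smaller weight.
  have hacyc : (T.deleteEdges {d.edge} ⊔ edge u v).IsAcyclic :=
    (htree.isAcyclic.anti (deleteEdges_le _)).sup_edge_of_not_reachable hnreach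
  have huvT : s(u, v) ∉ edgesOf T := fun h => hnr (Adj.reachable ⟨mem_edgesOf.1 h, huv.2⟩)
  have hdT : d.edge ∈ edgesOf T := mem_edgesOf.2 d.edge_mem
  have hedges : edgesOf (T.deleteEdges {d.edge} ⊔ edge u v) =
      insert s(u, v) ((edgesOf T).erase d.edge) := by
    rw [← edgesOf_deleteEdge]
    ext e
    rw [mem_edgesOf, edgeSet_sup, edgeSet_edge_of_ne hne, Finset.mem_insert, mem_edgesOf,
      Set.mem_union, Set.mem_singleton_iff, or_comm]
  have hnot : s(u, v) ∉ (edgesOf T).erase d.edge := fun h => huvT (Finset.mem_of_mem_erase h)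
  have hcard := IsTree.card_edgesOf htree
  have hpos := Finset.card_pos.2 ⟨_, hdT⟩
  have htree' : (T.deleteEdges {d.edge} ⊔ edge u v).IsTree := by
    refine isTree_of_isAcyclic_of_card hacyc ?_
    rw [hedges, Finset.card_insert_of_notMem hnot, Finset.card_erase_of_mem hdT]
    omega
  have hle : T.deleteEdges {d.edge} ⊔ edge u v ≤ G :=
    sup_le ((deleteEdges_le _).trans hTG) ((edge_le _ _ _).2 fun e he => by
      rw [show e = s(u, v) from he.1]; exact huv.1)
  have h1 := hmin _ hle htree'
  rw [hedges, Finset.sum_insert hnot, ← Finset.add_sum_erase _ _ hdT] at h1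
  have h2 : w s(u, v) ≤ j := huv.2
  omega

/-- The light part of `T` is a forest with the same components as the threshold graph. Comparing
this forest with the empty graph bounds components plus edges above by `n`; comparing it with the
tree `T` bounds them below by `n`. -/
theorem IsMinSpanningTree.componentCount_thresholdGraph {G T : SimpleGraph (Fin n)}
    {w : Sym2 (Fin n) → ℕ} (hT : IsMinSpanningTree G w T) (j : ℕ) :
    componentCount (thresholdGraph G w j) + ((edgesOf T).filter fun e => w e ≤ j).card = n := by
  have hTj : (thresholdGraph T w j).IsAcyclic := hT.2.1.isAcyclic.anti (thresholdGraph_le T w j)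
  have hle := thresholdGraph_mono hT.1 w j
  have heq : componentCount (thresholdGraph G w j) = componentCount (thresholdGraph T w j) := by
    refine le_antisymm (ConnectedComponent.card_le_card_of_le hle) ?_
    refine Nat.card_le_card_of_injective (ConnectedComponent.map (Hom.ofLE hle)) ?_
    intro C D
    refine ConnectedComponent.ind₂ (fun x y hxy => ?_) C D
    rw [ConnectedComponent.map_mk, ConnectedComponent.map_mk] at hxy
    obtain ⟨p⟩ := ConnectedComponent.eq.1 hxy
    have hall : ∀ a b, (thresholdGraph G w j).Walk a b → (thresholdGraph T w j).Reachable a b := by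
      intro a b q
      induction q with
      | nil => rfl
      | cons h _ ih => exact (hT.reachable_thresholdGraph h).trans ih
    exact ConnectedComponent.eq.2 (hall x y p)
  have h1 := IsAcyclic.componentCount_add_card_le hTj
  have h2 := componentCount_add_card_edgesOf_le (thresholdGraph_le T w j) hT.2.1.isAcyclic
  have h3 := IsTree.card_edgesOf hT.2.1
  have h4 : 0 < componentCount T := by
    have := hT.2.1.connected.nonempty
    have : Nonempty T.ConnectedComponent := this.map T.connectedComponentMk
    exact Nat.card_pos
  rw [edgesOf_thresholdGraph] at h1 h2
  omega

/-! ### The costs in terms of component counts -/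

/-- In a sorted list the entries that are at most `j` come first, so they use up places among the
first `m`; the truncated subtraction covers the case in which they fill all of them. -/
theorem countP_lt_take_of_pairwise {l : List ℕ} (hl : l.Pairwise (· ≤ ·)) (j : ℕ) {m : ℕ}
    (hm : m ≤ l.length) :
    (l.take m).countP (fun x => decide (j < x)) = m - l.countP fun x => decide (x ≤ j) := by
  induction l generalizing m with
  | nil => simp_all
  | cons x l ih =>
    obtain _ | m := m
    · simp
    · have hpw := List.pairwise_cons.1 hl
      have hm' : m ≤ l.length := by simpa using hm
      have h1 := ih hpw.2 hm'
      rw [List.take_succ_cons, List.countP_cons, List.countP_cons, h1]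
      by_cases hx : x ≤ j
      · simp [hx]
      · have h0 : l.countP (fun x => decide (x ≤ j)) = 0 := by
          rw [List.countP_eq_zero]
          intro y hy
          have := hpw.1 y hy
          simp only [decide_eq_true_eq]
          omega
        simp [hx, h0, not_le.1 hx]

/-- Layer-cake summation: each x is the number of levels j < W below it. -/
theorem sum_eq_sum_countP {l : List ℕ} {W : ℕ} (hl : ∀ x ∈ l, x ≤ W) :
    l.sum = ∑ j ∈ Finset.range W, l.countP fun x => decide (j < x) := by
  induction l with
  | nil => simp
  | cons x l ih =>
    rw [List.sum_cons, ih fun y hy => hl y (List.mem_cons_of_mem _ hy)]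
    simp only [List.countP_cons, decide_eq_true_eq, Finset.sum_add_distrib]
    rw [add_comm]
    congr 1
    rw [← Finset.card_filter]
    have hx := hl x List.mem_cons_self
    have : (Finset.range W).filter (fun j => j < x) = Finset.range x := by
      ext j
      simp only [Finset.mem_filter, Finset.mem_range]
      omega
    rw [this, Finset.card_range]

/-- Of the n - k lightest tree edges, those heavier than `j` number (n - k) - (n - c_j), cut off at
0; summing over the levels gives the cost. The truncated subtraction is the positive part of c_j -
k. -/
theorem kClusteringCost_eq_sum {G T : SimpleGraph (Fin n)} {w : Sym2 (Fin n) → ℕ} {W : ℕ}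
    (hT : IsMinSpanningTree G w T) (hw : ∀ e ∈ G.edgeSet, 1 ≤ w e ∧ w e ≤ W) {k : ℕ}
    (hk : 1 ≤ k) (hkn : k ≤ n) :
    kClusteringCost w T k =
      ∑ j ∈ Finset.range W, (componentCount (thresholdGraph G w j) - k) := by
  have hperm : (sortedWeights w T : Multiset ℕ) = (edgesOf T).val.map w :=
    Multiset.sort_eq _ _
  have hlen : (sortedWeights w T).length + 1 = n := by
    rw [← Multiset.coe_card, hperm, Multiset.card_map]
    exact IsTree.card_edgesOf hT.2.1
  have hmem : ∀ x ∈ sortedWeights w T, x ≤ W := by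
    intro x hx
    rw [← Multiset.mem_coe, hperm, Multiset.mem_map] at hx
    obtain ⟨e, he, rfl⟩ := hx
    exact (hw e (edgeSet_mono hT.1 (mem_edgesOf.1 he))).2
  rw [kClusteringCost, sum_eq_sum_countP fun x hx => hmem x (List.mem_of_mem_take hx)]
  refine Finset.sum_congr rfl fun j _ => ?_
  have hsort : (sortedWeights w T).Pairwise (· ≤ ·) := Multiset.pairwise_sort _ _
  rw [countP_lt_take_of_pairwise hsort j (by omega)]
  have h1 : (sortedWeights w T).countP (fun x => decide (x ≤ j)) =
      ((edgesOf T).filter fun e => w e ≤ j).card := by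
    have := congrArg (Multiset.countP fun x => x ≤ j) hperm
    rw [Multiset.coe_countP, Multiset.countP_map] at this
    rw [this]
    rfl
  have h2 := hT.componentCount_thresholdGraph j
  omega

theorem IsMinSpanningTree.componentCount_thresholdGraph_zero {G T : SimpleGraph (Fin n)}
    {w : Sym2 (Fin n) → ℕ} {W : ℕ} (hT : IsMinSpanningTree G w T)
    (hw : ∀ e ∈ G.edgeSet, 1 ≤ w e ∧ w e ≤ W) : componentCount (thresholdGraph G w 0) = n := by
  have h := hT.componentCount_thresholdGraph 0
  have : ((edgesOf T).filter fun e => w e ≤ 0) = ∅ := by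
    refine Finset.filter_eq_empty_iff.2 fun e he => ?_
    have := (hw e (edgeSet_mono hT.1 (mem_edgesOf.1 he))).1
    omega
  rw [this] at h
  simpa using h

/-- The nonzero terms are c - 1, c - 2, …, and add up to a triangular number. Only this direction is
needed. -/
theorem le_sum_tsub {c n : ℕ} (hcn : c ≤ n) :
    ((c : ℝ) * (c - 1)) / 2 ≤ ∑ k ∈ Finset.Icc 1 n, ((c - k : ℕ) : ℝ) := by
  have h1 : ∑ k ∈ Finset.range c, ((c - (k + 1) : ℕ) : ℝ) = (c : ℝ) * (c - 1) / 2 := by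
    have := Finset.sum_range_reflect (fun i => (i : ℝ)) c
    have h2 : ∀ k ∈ Finset.range c, ((c - (k + 1) : ℕ) : ℝ) = ((c - 1 - k : ℕ) : ℝ) := by
      intro k _
      congr 1
      omega
    rw [Finset.sum_congr rfl h2, this]
    have h3 := Finset.sum_range_id_mul_two c
    have h4 : (∑ i ∈ Finset.range c, (i : ℝ)) * 2 = c * (c - 1) := by
      rcases Nat.eq_zero_or_pos c with rfl | hc
      · simp
      · rw [← Nat.cast_pred hc, ← Nat.cast_mul, ← h3]
        push_cast
        rfl
    linarith
  rw [← h1, Finset.range_eq_Ico, Finset.sum_Ico_add' (fun k => ((c - k : ℕ) : ℝ)) 0 c 1]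
  refine Finset.sum_le_sum_of_subset_of_nonneg (fun k hk => ?_) fun _ _ _ => Nat.cast_nonneg _
  rw [Finset.mem_Ico] at hk
  rw [Finset.mem_Icc]
  omega

theorem sum_componentCount_le_hierarchyCost {G T : SimpleGraph (Fin n)} {w : Sym2 (Fin n) → ℕ}
    {W : ℕ} (hT : IsMinSpanningTree G w T) (hw : ∀ e ∈ G.edgeSet, 1 ≤ w e ∧ w e ≤ W) :
    ∑ j ∈ Finset.range W, ((componentCount (thresholdGraph G w j) : ℝ) *
      (componentCount (thresholdGraph G w j) - 1)) / 2 ≤ hierarchyCost w T := by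
  have h1 : hierarchyCost w T = ∑ j ∈ Finset.range W, ∑ k ∈ Finset.Icc 1 n,
      (componentCount (thresholdGraph G w j) - k) := by
    rw [hierarchyCost, Finset.sum_comm]
    refine Finset.sum_congr rfl fun k hk => ?_
    rw [Finset.mem_Icc] at hk
    exact kClusteringCost_eq_sum hT hw hk.1 hk.2
  rw [h1]
  push_cast
  exact Finset.sum_le_sum fun j _ => le_sum_tsub (componentCount_le _)

end SpanningTrees

/-! ## The searches for the interval endpoints -/

section Searches

open RandComp

variable {n : ℕ} {c : ℕ → ℕ} {η L : ℝ} {W : ℕ} {δ : ℝ≥0∞}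

/-- The number `v` is an accurate estimate of `c j` in the range `[1, n]`. -/
def IsGoodEstimate (n : ℕ) (c : ℕ → ℕ) (η L : ℝ) (j : ℕ) (v : ℝ) : Prop :=
  |v - c j| ≤ η * max (c j : ℝ) L ∧ 1 ≤ v ∧ v ≤ n

/-- The index `j` is a possible result of a binary search for `B` in accurate estimates of
`c 1, …, c W`. -/
def IsSearchResult (n : ℕ) (c : ℕ → ℕ) (η L : ℝ) (W : ℕ) (B : ℝ) (j : ℕ) : Prop :=
  1 ≤ j ∧ j ≤ W ∧ (j = 1 ∨ ∃ v, IsGoodEstimate n c η L (j - 1) v ∧ B < v) ∧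
    (j = W ∨ ∃ v, IsGoodEstimate n c η L j v ∧ v ≤ B)

/-- All stored values are accurate estimates. -/
def IsGoodMemo (n : ℕ) (c : ℕ → ℕ) (η L : ℝ) (memo : ℕ → Option ℝ) : Prop :=
  ∀ j v, memo j = some v → IsGoodEstimate n c η L j v

/-- The number of indices for which no estimate is stored. -/
noncomputable def unsetCount (W : ℕ) (memo : ℕ → Option ℝ) : ℕ :=
  ((Finset.Icc 1 W).filter fun j => memo j = none).card

theorem unsetCount_update {memo : ℕ → Option ℝ} {j : ℕ} (hj : j ∈ Finset.Icc 1 W)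
    (hm : memo j = none) (v : ℝ) :
    unsetCount W (Function.update memo j (some v)) + 1 = unsetCount W memo := by
  unfold unsetCount
  have h : ((Finset.Icc 1 W).filter fun i => Function.update memo j (some v) i = none) =
      ((Finset.Icc 1 W).filter fun i => memo i = none).erase j := by
    ext i
    by_cases hij : i = j
    · subst hij
      simp
    · simp [hij]
  rw [h, Finset.card_erase_add_one]
  exact Finset.mem_filter.2 ⟨hj, hm⟩

variable [NeZero n] {adj : Fin n → List (Fin n × ℕ)} {κ ε d : ℝ}

/-- A potential argument: δ times the number of unset entries bounds the probability of a future
failure, and `F` is that probability for the rest of the run. A fresh estimate uses up one entry and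
fails with probability at most δ; a stored one costs nothing. Adaptive choices of `j` are therefore
harmless. -/
theorem ev_componentEstimate_le {j : ℕ} (hj : j ∈ Finset.Icc 1 W) (hc1 : 1 ≤ c j) (hcn : c j ≤ n)
    (hest : (medianTrick adj (fun x => decide (x ≤ j)) κ (ε / 8) (√(W : ℝ)) d
      (1 / (4 * (W : ℝ)))).prob (fun x => ¬ |x - c j| ≤ η * max (c j : ℝ) L) ≤ δ)
    {memo : ℕ → Option ℝ} (hmemo : IsGoodMemo n c η L memo)
    {F : ℝ × (ℕ → Option ℝ) → ℝ≥0∞} (hF1 : ∀ p, F p ≤ 1)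
    (hF : ∀ p, IsGoodEstimate n c η L j p.1 → IsGoodMemo n c η L p.2 →
      F p ≤ δ * unsetCount W p.2) :
    ev (componentEstimate adj κ ε W d j memo) F ≤ δ * unsetCount W memo := by
  classical
  rw [componentEstimate]
  rcases hm : memo j with _ | v
  · simp only [ev_bind, ev_charge, ev_pure]
    refine (ev_mono _ (h := fun x : ℝ => (if ¬ |x - c j| ≤ η * max (c j : ℝ) L then 1 else 0) +
      δ * (unsetCount W memo - 1 : ℕ)) fun x => ?_).trans ?_
    · by_cases hx : |x - c j| ≤ η * max (c j : ℝ) L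
      · rw [if_neg (not_not.2 hx), zero_add]
        have hc1' : (1 : ℝ) ≤ c j := by exact_mod_cast hc1
        have hcn' : (c j : ℝ) ≤ n := by exact_mod_cast hcn
        -- Clamping is a contraction that fixes `c j`, so it does not increase the error.
        have hgood : IsGoodEstimate n c η L j (min (max x 1) n) := by
          refine ⟨?_, le_min (le_max_right _ _) (hc1'.trans hcn'), min_le_right _ _⟩
          refine le_trans ?_ hx
          have h1 : |max x 1 - max (c j : ℝ) 1| ≤ |x - c j| := abs_max_sub_max_le_abs _ _ _
          have h2 : |min (max x 1) n - min (c j : ℝ) n| ≤ |max x 1 - c j| := by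
            have := abs_min_sub_min_le_max (max x 1) (n : ℝ) (c j) n
            simpa using this
          rw [min_eq_left hcn'] at h2
          rw [max_eq_left hc1'] at h1
          exact h2.trans h1
        have hcount := unsetCount_update hj hm (min (max x 1) n)
        refine (hF _ hgood ?_).trans ?_
        · intro i v hv
          by_cases hij : i = j
          · subst hij
            simp only [Function.update_self, Option.some.injEq] at hv
            exact hv ▸ hgood
          · change Function.update memo j _ i = some v at hv
            rw [Function.update_of_ne hij] at hv
            exact hmemo i v hv
        · rw [← hcount]
          simp
      · rw [if_pos hx]
        exact (hF1 _).trans le_self_add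
    · rw [ev_add, ev_const, ← prob_eq_ev]
      have hcount := unsetCount_update hj hm 0
      calc _ ≤ δ + δ * (unsetCount W memo - 1 : ℕ) := by gcongr
        _ = δ * unsetCount W memo := by
          rw [← hcount]
          push_cast
          rw [mul_add, mul_one, add_comm]
  · simp only [ev_bind, ev_charge, ev_pure]
    exact hF _ (hmemo j v hm) hmemo

/-- Loop invariant: the estimate just left of the interval exceeds `B` and the one at its right end
does not, unless that end is still the original one. Only tested indices enter, so no monotonicity
of the estimates is required. -/
theorem ev_binarySearch_le (hc1 : ∀ j, 1 ≤ c j) (hcn : ∀ j, c j ≤ n)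
    (hest : ∀ j ∈ Finset.Icc 1 W, (medianTrick adj (fun x => decide (x ≤ j)) κ (ε / 8) (√(W : ℝ)) d
      (1 / (4 * (W : ℝ)))).prob (fun x => ¬ |x - c j| ≤ η * max (c j : ℝ) L) ≤ δ) {B : ℝ}
    {F : ℕ × (ℕ → Option ℝ) → ℝ≥0∞} (hF1 : ∀ p, F p ≤ 1)
    (hF : ∀ p, IsSearchResult n c η L W B p.1 → IsGoodMemo n c η L p.2 →
      F p ≤ δ * unsetCount W p.2) (k : ℕ) :
    ∀ (l r : ℕ) (memo : ℕ → Option ℝ), r - l ≤ k → 1 ≤ l → l ≤ r → r ≤ W →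
      (l = 1 ∨ ∃ v, IsGoodEstimate n c η L (l - 1) v ∧ B < v) →
      (r = W ∨ ∃ v, IsGoodEstimate n c η L r v ∧ v ≤ B) → IsGoodMemo n c η L memo →
      ev (binarySearch adj κ ε W d B l r memo) F ≤ δ * unsetCount W memo := by
  induction k with
  | zero =>
    intro l r memo hk h1 hlr hrW hl hr hmemo
    obtain rfl : l = r := by omega
    rw [binarySearch, dif_pos le_rfl]
    simp only [ev_bind, ev_charge, ev_pure]
    exact hF _ ⟨h1, hrW, hl, hr⟩ hmemo
  | succ k ih =>
    intro l r memo hk h1 hlr hrW hl hr hmemo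
    rw [binarySearch]
    split_ifs with h
    · obtain rfl : l = r := by omega
      simp only [ev_bind, ev_charge, ev_pure]
      exact hF _ ⟨h1, hrW, hl, hr⟩ hmemo
    · simp only [ev_bind, ev_charge]
      have hm : (l + r) / 2 ∈ Finset.Icc 1 W := by
        rw [Finset.mem_Icc]
        omega
      refine ev_componentEstimate_le hm (hc1 _) (hcn _) (hest _ hm) hmemo
        (fun p => ev_le _ hF1) fun p hp hpm => ?_
      split_ifs with hB
      · exact ih _ _ _ (by omega) h1 (by omega) (by omega) hl (Or.inr ⟨p.1, hp, hB⟩) hpm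
      · exact ih _ _ _ (by omega) (by omega) (by omega) hrW
          (Or.inr ⟨p.1, by simpa using hp, not_le.1 hB⟩) hr hpm

/-- The table, and with it the potential, passes from one key to the next, so the bound does not
grow with the number of keys. -/
theorem ev_searchKeys_le (hW : 1 ≤ W) (hc1 : ∀ j, 1 ≤ c j) (hcn : ∀ j, c j ≤ n)
    (hest : ∀ j ∈ Finset.Icc 1 W, (medianTrick adj (fun x => decide (x ≤ j)) κ (ε / 8) (√(W : ℝ)) d
      (1 / (4 * (W : ℝ)))).prob (fun x => ¬ |x - c j| ≤ η * max (c j : ℝ) L) ≤ δ)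
    (keys : List ℝ) : ∀ {F : List ℕ → ℝ≥0∞}, (∀ js, F js ≤ 1) →
    (∀ js, List.Forall₂ (IsSearchResult n c η L W) keys js → F js = 0) →
    ∀ memo : ℕ → Option ℝ, IsGoodMemo n c η L memo →
    ev (searchKeys adj κ ε W d keys memo) F ≤ δ * unsetCount W memo := by
  induction keys with
  | nil =>
    intro F _ hF memo _
    rw [searchKeys, ev_pure, hF [] List.Forall₂.nil]
    exact zero_le
  | cons B keys ih =>
    intro F hF1 hF memo hmemo
    simp only [searchKeys, ev_bind, ev_pure]
    refine ev_binarySearch_le hc1 hcn hest (fun p => ev_le _ fun js => hF1 _) ?_ (W - 1) 1 W memo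
      le_rfl le_rfl hW le_rfl (Or.inl rfl) (Or.inl rfl) hmemo
    intro p hp hpm
    exact ih (fun js => hF1 _) (fun js hjs => hF _ (List.Forall₂.cons hp hjs)) _ hpm

/-- With probability at least `1 - δ W`, all binary searches return correct results. -/
theorem prob_searchKeys_le (hW : 1 ≤ W) (hc1 : ∀ j, 1 ≤ c j) (hcn : ∀ j, c j ≤ n)
    (hest : ∀ j ∈ Finset.Icc 1 W, (medianTrick adj (fun x => decide (x ≤ j)) κ (ε / 8) (√(W : ℝ)) d
      (1 / (4 * (W : ℝ)))).prob (fun x => ¬ |x - c j| ≤ η * max (c j : ℝ) L) ≤ δ)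
    (keys : List ℝ) :
    (searchKeys adj κ ε W d keys fun _ => none).prob
      (fun js => ¬ List.Forall₂ (IsSearchResult n c η L W) keys js) ≤ δ * W := by
  classical
  rw [prob_eq_ev]
  have := ev_searchKeys_le hW hc1 hcn hest keys
    (F := fun js => if ¬ List.Forall₂ (IsSearchResult n c η L W) keys js then 1 else 0)
    (fun js => by split_ifs <;> simp) (fun js hjs => by simp [hjs]) (fun _ => none)
    (fun j v h => by simp at h)
  simpa [unsetCount] using this

end Searches

/-! ## Accuracy of the profile, given correct searches -/

section Accuracy

variable {n : ℕ} {c : ℕ → ℕ} {η e L : ℝ} {W : ℕ}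

/-- The search constrains only c (j - 1); monotonicity of the true counts carries the bound to every
m < j. For j = 1 the index 0 was never estimated, and `hBn` takes over. -/
theorem IsSearchResult.lt_of_lt {B : ℝ} {j m : ℕ} (h : IsSearchResult n c η L W B j)
    (hc : Antitone c) (hη : 0 < η) (hL : 0 < L) (hBn : B ≤ c 0) (hm : m < j) :
    B - 2 * η * max B L < c m := by
  have hBL : 0 < max B L := lt_max_of_lt_right hL
  suffices h' : B - 2 * η * max B L < c (j - 1) from
    h'.trans_le (by exact_mod_cast hc (by omega))
  obtain ⟨h1, -, h2, -⟩ := h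
  rcases h2 with rfl | ⟨v, ⟨hv, -, -⟩, hvB⟩
  · have : 0 < 2 * η * max B L := by positivity
    simp only [Nat.sub_self]
    linarith
  · rcases le_or_gt B (c (j - 1)) with h3 | h3
    · have : 0 < 2 * η * max B L := by positivity
      linarith
    · have h4 : max (c (j - 1) : ℝ) L ≤ max B L := max_le_max h3.le le_rfl
      have h5 : η * max (c (j - 1) : ℝ) L ≤ η * max B L := by gcongr
      have h6 := (abs_le.1 hv).2
      nlinarith

/-- The error is relative to `c j` and not to `B`: from c ≤ B + η c and η ≤ 1/2 follows η c ≤ 2 η B.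
For j = W the search says nothing, and the range of `m` is empty. -/
theorem IsSearchResult.le_of_le {B : ℝ} {j m : ℕ} (h : IsSearchResult n c η L W B j)
    (hc : Antitone c) (hη : 0 < η) (hη2 : η ≤ 1 / 2) (hL : 0 < L) (hm : j ≤ m) (hmW : m < W) :
    (c m : ℝ) ≤ B + 2 * η * max B L := by
  suffices h' : (c j : ℝ) ≤ B + 2 * η * max B L from le_trans (by exact_mod_cast hc hm) h'
  obtain ⟨-, -, -, h2⟩ := h
  rcases h2 with rfl | ⟨v, ⟨hv, -, -⟩, hvB⟩
  · omega
  · have h6 := (abs_le.1 hv).1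
    rcases le_or_gt (c j : ℝ) L with h3 | h3
    · rw [max_eq_right h3] at h6
      have : η * L ≤ η * max B L := by gcongr; exact le_max_right _ _
      have : 0 < η * L := by positivity
      linarith
    · rw [max_eq_left h3.le] at h6
      have : η * B ≤ η * max B L := by gcongr; exact le_max_left _ _
      have h4 : (c j : ℝ) ≤ B + η * c j := by linarith
      have h5 := mul_le_mul_of_nonneg_left h4 hη.le
      have h7 : η * (η * c j) ≤ 1 / 2 * (η * c j) := by gcongr
      linarith

theorem sum_Ico_sub_telescope (f : ℕ → ℝ) {i : ℕ} (hi : 1 ≤ i) :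
    ∑ a ∈ Finset.Ico 1 i, (f a - f (a + 1)) = f 1 - f i := by
  induction i, hi using Nat.le_induction with
  | base => simp
  | succ i hi ih => rw [Finset.sum_Ico_succ_top hi, ih]; ring

/-- The contribution of one threshold graph to the estimate of one cost. -/
theorem abs_contribution_sub_le (hc : Antitone c) (hc0 : c 0 = n) (he : 0 < e) (he1 : e ≤ 1 / 20)
    (hL : 0 < L) {B : ℕ → ℝ} {jh : ℕ → ℕ} {i k m : ℕ} (hi : 1 ≤ i) (hB1 : B 1 = n)
    (hanti : ∀ a, 1 ≤ a → a < i → B (a + 1) ≤ B a)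
    (hgap : ∀ a, 1 ≤ a → a < i → B a - B (a + 1) ≤ 2 * e * max (B (a + 1)) L)
    (hres : ∀ a, 1 ≤ a → a ≤ i → IsSearchResult n c (e / 8) L W (B a) (jh a))
    (hBk : B i ≤ k) (hkB : ∀ a, 1 ≤ a → a < i → k < B a) (hkn : k ≤ n) (hm : m < W) :
    |∑ a ∈ Finset.Ico 1 i, (if m < jh (a + 1) then B a - B (a + 1) else 0) -
      ((c m - k : ℕ) : ℝ)| ≤
      if (k : ℝ) ≤ 2 * max (c m : ℝ) L then 10 * e * max (c m : ℝ) L else 0 := by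
  set M := max (c m : ℝ) L with hM
  have hLM : L ≤ M := le_max_right _ _
  have hcM : (c m : ℝ) ≤ M := le_max_left _ _
  have hM0 : 0 < M := hL.trans_le hLM
  have hcn : (c m : ℝ) ≤ n := by
    rw [← hc0]
    exact_mod_cast hc (Nat.zero_le m)
  -- Column `m` collects the strips [B_{a+1}, B_a] with m < ĵ_{a+1}. Each of them lies below `U`,
  -- and a strip left out lies above `V`; so the collected length is squeezed between the
  -- telescoping sums of the endpoints truncated at `V` and at `U`.
  set U := c m + 3 * e * M with hU
  set V := c m - e * M with hV
  have heM : 0 < e * M := by positivity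
  have hBn : ∀ a, 1 ≤ a → a ≤ i → B a ≤ n := by
    intro a ha
    induction a, ha using Nat.le_induction with
    | base => exact fun _ => hB1.le
    | succ a ha ih => exact fun hai => (hanti a ha (by omega)).trans (ih (by omega))
  have hupper : ∀ a ∈ Finset.Ico 1 i, (if m < jh (a + 1) then B a - B (a + 1) else 0) ≤
      min (B a) U - min (B (a + 1)) U := by
    intro a ha
    rw [Finset.mem_Ico] at ha
    have hmono := hanti a ha.1 ha.2
    split_ifs with h
    · have h1 := (hres (a + 1) (by omega) ha.2).lt_of_lt hc (by positivity) hL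
        (by rw [hc0]; exact hBn _ (by omega) ha.2) h
      have h2 := hgap a ha.1 ha.2
      have h3 : B a ≤ U := by
        rcases le_or_gt (B (a + 1)) L with h4 | h4
        · rw [max_eq_right h4] at h1 h2
          nlinarith
        · rw [max_eq_left h4.le] at h1 h2
          have h5 : B (a + 1) ≤ 4 / 3 * M := by nlinarith
          have h6 : B (a + 1) ≤ 21 / 20 * M := by nlinarith
          nlinarith
      rw [min_eq_left h3, min_eq_left (hmono.trans h3)]
    · linarith [min_le_min_right U hmono]
  have hlower : ∀ a ∈ Finset.Ico 1 i, min (B a) V - min (B (a + 1)) V ≤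
      (if m < jh (a + 1) then B a - B (a + 1) else 0) := by
    intro a ha
    rw [Finset.mem_Ico] at ha
    have hmono := hanti a ha.1 ha.2
    split_ifs with h
    · rcases le_total (B a) V with h1 | h1 <;> rcases le_total (B (a + 1)) V with h2 | h2 <;>
        simp only [min_eq_left, min_eq_right, h1, h2] <;> linarith
    · have h1 := (hres (a + 1) (by omega) ha.2).le_of_le hc (by positivity) (by linarith) hL
        (not_lt.1 h) hm
      have h2 : V ≤ B (a + 1) := by
        rcases le_or_gt (B (a + 1)) L with h4 | h4
        · rw [max_eq_right h4] at h1
          nlinarith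
        · rw [max_eq_left h4.le] at h1
          rcases le_or_gt (c m : ℝ) (B (a + 1)) with h5 | h5
          · linarith
          · nlinarith
      rw [min_eq_right h2, min_eq_right (h2.trans hmono), sub_self]
  have hup := Finset.sum_le_sum hupper
  have hlo := Finset.sum_le_sum hlower
  rw [sum_Ico_sub_telescope (fun a => min (B a) U) hi] at hup
  rw [sum_Ico_sub_telescope (fun a => min (B a) V) hi] at hlo
  simp only [hB1] at hup hlo
  rw [min_eq_right (show V ≤ n by linarith)] at hlo
  have hmin : min (n : ℝ) U ≤ U := min_le_right _ _
  set X := ∑ a ∈ Finset.Ico 1 i, (if m < jh (a + 1) then B a - B (a + 1) else 0) with hX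
  have hX0 : 0 ≤ X := Finset.sum_nonneg fun a ha => by
    rw [Finset.mem_Ico] at ha
    have := hanti a ha.1 ha.2
    split_ifs <;> linarith
  have hXV : V - B i ≤ X := by linarith [min_le_left (B i) V]
  have hXU : X ≤ max (U - B i) 0 := by
    rcases le_total (B i) U with h | h
    · rw [min_eq_left h] at hup
      exact le_max_of_le_left (by linarith)
    · rw [min_eq_right h] at hup
      exact le_max_of_le_right (by linarith)
  -- Rounding `k` down to B_i loses at most the gap below B_{i-1} > k; for i = 1, k ≤ n = B_1.
  have hkBi : (k : ℝ) - B i ≤ 2 * e * max (k : ℝ) L := by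
    have hkL : 0 < max (k : ℝ) L := lt_max_of_lt_right hL
    rcases hi.eq_or_lt with rfl | hi1
    · rw [hB1]
      have : (k : ℝ) ≤ n := by exact_mod_cast hkn
      have : 0 < 2 * e * max (k : ℝ) L := by positivity
      linarith
    · obtain ⟨i, rfl⟩ : ∃ i', i = i' + 1 := ⟨i - 1, by omega⟩
      have h1 := hkB i (by omega) (by omega)
      have h2 := hgap i (by omega) (by omega)
      have h3 : max (B (i + 1)) L ≤ max (k : ℝ) L := max_le_max hBk le_rfl
      have h4 : 2 * e * max (B (i + 1)) L ≤ 2 * e * max (k : ℝ) L := by gcongr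
      linarith
  have hsub : ((c m - k : ℕ) : ℝ) = max ((c m : ℝ) - k) 0 := by
    rcases le_total k (c m) with h | h
    · rw [Nat.cast_sub h, max_eq_left]
      have : (k : ℝ) ≤ c m := by exact_mod_cast h
      linarith
    · rw [Nat.sub_eq_zero_of_le h, Nat.cast_zero, max_eq_right]
      have : (c m : ℝ) ≤ k := by exact_mod_cast h
      linarith
  rw [hsub]
  split_ifs with hkM
  · have h1 : max (k : ℝ) L ≤ 2 * M := max_le hkM (by linarith)
    have h2 : (k : ℝ) - B i ≤ 4 * (e * M) := by nlinarith
    rw [abs_le]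
    constructor
    · rcases le_total ((c m : ℝ) - k) 0 with h3 | h3
      · rw [max_eq_right h3]
        linarith
      · rw [max_eq_left h3]
        linarith
    · have h3 : max (U - B i) 0 ≤ max ((c m : ℝ) - k) 0 + 10 * (e * M) := by
        refine max_le ?_ ?_
        · linarith [le_max_left ((c m : ℝ) - k) 0]
        · linarith [le_max_right ((c m : ℝ) - k) 0]
      linarith
  -- For k > 2M even the endpoint B_i lies above `U`, so no strip is collected and the true term is
  -- 0.
  · push Not at hkM
    have h1 : max (k : ℝ) L = k := max_eq_left (by linarith)
    rw [h1] at hkBi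
    have h2 : U ≤ B i := by nlinarith
    have h3 : X = 0 := by
      rw [max_eq_right (by linarith)] at hXU
      linarith
    have h4 : max ((c m : ℝ) - k) 0 = 0 := max_eq_right (by linarith)
    rw [h3, h4]
    simp

/-- Abel summation. The leading n is B_1 ĵ_1, which is why ĵ_1 = 1 is needed. Lists count from 0, so
`js.getD a 0` is ĵ_{a+1}. -/
theorem endpointCost_eq_sum {js : List ℕ} (hB1 : endpoint n e W 1 = n) (hj1 : js.getD 0 0 = 1)
    {i : ℕ} (hi : 1 ≤ i) :
    endpointCost n e W js i = ∑ a ∈ Finset.Ico 1 i,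
      (js.getD a 0 : ℝ) * (endpoint n e W a - endpoint n e W (a + 1)) := by
  have key : (n : ℝ) - endpoint n e W i * (js.getD (i - 1) 0 : ℕ) +
      ∑ a ∈ Finset.Ico 1 i, (((js.getD (a + 1 - 1) 0 : ℕ) : ℝ) - (js.getD (a - 1) 0 : ℕ)) *
        endpoint n e W a = ∑ a ∈ Finset.Ico 1 i,
      (js.getD a 0 : ℝ) * (endpoint n e W a - endpoint n e W (a + 1)) := by
    induction i, hi using Nat.le_induction with
    | base =>
      rw [Nat.sub_self, hj1, hB1]
      simp
    | succ i hi ih =>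
      rw [Finset.sum_Ico_succ_top hi, Finset.sum_Ico_succ_top hi, ← ih]
      simp only [Nat.add_sub_cancel]
      ring
  rw [endpointCost]
  split_ifs with h
  · simp [h]
  · exact key

/-- The estimated cost is close to the true one for every `k`, in total over all `k`. -/
theorem sum_abs_sub_le (hn : 2 ≤ n) (hW : 1 ≤ W) (hc0 : c 0 = n)
    (hc1 : ∀ j, 1 ≤ c j) (he : 0 < e) (he1 : e ≤ 1 / 20) (hL : 1 ≤ L) (hLW : L ^ 2 * W = n ^ 2)
    {f : ℕ → ℝ} {cost : ℝ}
    (hcost : ∑ j ∈ Finset.range W, (c j : ℝ) * (c j - 1) / 2 ≤ cost)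
    (hf : ∀ k ∈ Finset.Icc 1 n, |f k - ∑ m ∈ Finset.range W, ((c m - k : ℕ) : ℝ)| ≤
      ∑ m ∈ Finset.range W,
        if (k : ℝ) ≤ 2 * max (c m : ℝ) L then 10 * e * max (c m : ℝ) L else 0) :
    ∑ k ∈ Finset.Icc 1 n, |f k - ∑ m ∈ Finset.range W, ((c m - k : ℕ) : ℝ)| ≤
      160 * e * cost := by
  -- At most 2M values of `k` contribute, each 10 e M.
  have hterm : ∀ m, ∑ k ∈ Finset.Icc 1 n,
      (if (k : ℝ) ≤ 2 * max (c m : ℝ) L then 10 * e * max (c m : ℝ) L else 0) ≤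
      20 * e * (4 * ((c m : ℝ) * (c m - 1) / 2) + L ^ 2) := by
    intro m
    set M := max (c m : ℝ) L with hM
    have hM0 : 0 < M := lt_max_of_lt_right (by linarith)
    rw [← Finset.sum_filter, Finset.sum_const, nsmul_eq_mul]
    have hcard : (((Finset.Icc 1 n).filter fun k : ℕ => (k : ℝ) ≤ 2 * M).card : ℝ) ≤ 2 * M := by
      have hsub : ((Finset.Icc 1 n).filter fun k : ℕ => (k : ℝ) ≤ 2 * M) ⊆
          Finset.Icc 1 ⌊2 * M⌋₊ := by
        intro k hk
        rw [Finset.mem_filter, Finset.mem_Icc] at hk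
        exact Finset.mem_Icc.2 ⟨hk.1.1, Nat.le_floor hk.2⟩
      have := Finset.card_le_card hsub
      rw [Nat.card_Icc, Nat.add_sub_cancel] at this
      exact le_trans (by exact_mod_cast this) (Nat.floor_le (by positivity))
    -- The bound c² ≤ 2c(c - 1) fails only at c = 1, where L ≥ 1 covers it.
    have hM2 : M ^ 2 ≤ 4 * ((c m : ℝ) * (c m - 1) / 2) + L ^ 2 := by
      have h1 : (1 : ℝ) ≤ c m := by exact_mod_cast hc1 m
      rcases le_or_gt (c m : ℝ) L with h | h
      · rw [hM, max_eq_right h]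
        nlinarith
      · rw [hM, max_eq_left h.le]
        have h2 : (2 : ℝ) ≤ c m := by
          have : (1 : ℝ) < c m := by linarith
          exact_mod_cast (by exact_mod_cast this : 1 < c m)
        nlinarith
    calc _ ≤ 2 * M * (10 * e * M) := by gcongr
      _ = 20 * e * M ^ 2 := by ring
      _ ≤ _ := by gcongr
  have hn2 : (2 : ℝ) ≤ n := by exact_mod_cast hn
  -- The term j = 0, where c_0 = n. As n ≥ 2, it yields n² ≤ 4 cost, which pays for the W copies of
  -- L².
  have h0 : (n : ℝ) * (n - 1) / 2 ≤ cost := by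
    refine le_trans ?_ hcost
    have := Finset.single_le_sum (f := fun j => (c j : ℝ) * (c j - 1) / 2) (fun j _ => by
      have h1 : (1 : ℝ) ≤ c j := by exact_mod_cast hc1 j
      have : 0 ≤ (c j : ℝ) * (c j - 1) := by nlinarith
      linarith) (Finset.mem_range.2 hW)
    simpa [hc0] using this
  calc _ ≤ ∑ k ∈ Finset.Icc 1 n, ∑ m ∈ Finset.range W,
        (if (k : ℝ) ≤ 2 * max (c m : ℝ) L then 10 * e * max (c m : ℝ) L else 0) :=
        Finset.sum_le_sum hf
    _ ≤ ∑ m ∈ Finset.range W, 20 * e * (4 * ((c m : ℝ) * (c m - 1) / 2) + L ^ 2) := by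
        rw [Finset.sum_comm]
        exact Finset.sum_le_sum fun m _ => hterm m
    _ = 20 * e * (4 * ∑ m ∈ Finset.range W, (c m : ℝ) * (c m - 1) / 2 + L ^ 2 * W) := by
        rw [← Finset.mul_sum, Finset.sum_add_distrib, ← Finset.mul_sum, Finset.sum_const,
          Finset.card_range, nsmul_eq_mul, mul_comm (L ^ 2)]
    _ ≤ 20 * e * (4 * cost + 4 * cost) := by
        rw [hLW]
        gcongr
        nlinarith
    _ = 160 * e * cost := by ring

end Accuracy

/-! ## The interval endpoints -/

section Endpoints

variable {n : ℕ} {c : ℕ → ℕ} {e L : ℝ} {W : ℕ}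

theorem one_le_tOne (he : 0 < e) (hW : 1 ≤ W) : 1 ≤ tOne e W := by
  rw [tOne, Nat.one_le_floor_iff]
  have hs : 1 ≤ √(W : ℝ) := Real.one_le_sqrt.2 (by exact_mod_cast hW)
  have := Real.logb_nonneg (by linarith : 1 < 1 + e) hs
  linarith

theorem one_le_tTwo (he : 0 < e) (he1 : e ≤ 1 / 2) : 1 ≤ tTwo e := by
  rw [tTwo, Nat.one_le_floor_iff]
  have : 2 ≤ 1 / e := by
    rw [le_div_iff₀ he]
    linarith
  linarith

/-- This places the last geometric endpoint between L and (1 + e) L. -/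
theorem pow_tOne (he : 0 < e) (hW : 1 ≤ W) :
    (1 + e) ^ (tOne e W - 1) ≤ √(W : ℝ) ∧ √(W : ℝ) ≤ (1 + e) ^ tOne e W := by
  have hs : 1 ≤ √(W : ℝ) := Real.one_le_sqrt.2 (by exact_mod_cast hW)
  have hb : 1 < 1 + e := by linarith
  have hx := Real.logb_nonneg hb hs
  have h1 := one_le_tOne he hW
  have h2 : (tOne e W : ℝ) ≤ Real.logb (1 + e) (√(W : ℝ)) + 1 := Nat.floor_le (by linarith)
  have h3 : Real.logb (1 + e) (√(W : ℝ)) + 1 < tOne e W + 1 := Nat.lt_floor_add_one _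
  rw [← Real.rpow_natCast, ← Real.rpow_natCast, ← Real.le_logb_iff_rpow_le hb (by linarith),
    ← Real.logb_le_iff_le_rpow hb (by linarith), Nat.cast_sub h1, Nat.cast_one]
  constructor <;> linarith

/-- The arithmetic endpoints stay nonnegative and end at most 2 e L above 0. -/
theorem mul_tTwo (he : 0 < e) (he1 : e ≤ 1 / 2) : e * tTwo e ≤ 1 ∧ 1 ≤ e * tTwo e + 2 * e := by
  have h0 : 2 ≤ 1 / e := by
    rw [le_div_iff₀ he]
    linarith
  have h1 : (tTwo e : ℝ) ≤ 1 / e - 1 := Nat.floor_le (by linarith)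
  have h2 : 1 / e - 1 < tTwo e + 1 := Nat.lt_floor_add_one _
  have h3 : e * (1 / e) = 1 := by field_simp
  constructor <;> nlinarith

theorem endpoint_one (he : 0 < e) (hW : 1 ≤ W) : endpoint n e W 1 = n := by
  rw [endpoint, if_pos (one_le_tOne he hW)]
  simp

theorem endpoint_numEndpoints : endpoint n e W (numEndpoints e W) = 1 := by
  rw [endpoint, numEndpoints, if_neg (by omega), if_neg (by omega)]

/-- Consecutive endpoints are close, and decreasing except possibly for the last one. -/
theorem endpoint_sub_le (he : 0 < e) (he1 : e ≤ 1 / 2) (hW : 1 ≤ W) (hL : L = n / √(W : ℝ))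
    {a : ℕ} (ha : 1 ≤ a) (hat : a < numEndpoints e W) :
    endpoint n e W a - endpoint n e W (a + 1) ≤ 2 * e * max (endpoint n e W (a + 1)) L ∧
      (a + 1 < numEndpoints e W → endpoint n e W (a + 1) ≤ endpoint n e W a) := by
  have hs : 1 ≤ √(W : ℝ) := Real.one_le_sqrt.2 (by exact_mod_cast hW)
  have hL0 : 0 ≤ L := by rw [hL]; positivity
  have ht1 := one_le_tOne he hW
  have ht2 := one_le_tTwo he he1
  rw [numEndpoints] at hat ⊢
  -- Geometric steps, the passage from B_{t₁} to L (1 - e), then arithmetic steps. The final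
  -- endpoint 1 is treated in the last case; it may exceed its predecessor, which is only known to
  -- be at most 2 e L.
  rcases lt_trichotomy a (tOne e W) with h | h | h
  · have h1 : endpoint n e W a = (1 + e) * endpoint n e W (a + 1) := by
      rw [endpoint, endpoint, if_pos h.le, if_pos (by omega)]
      obtain ⟨a, rfl⟩ : ∃ b, a = b + 1 := ⟨a - 1, by omega⟩
      simp only [Nat.add_sub_cancel]
      rw [pow_succ]
      field_simp
    have h2 : 0 ≤ endpoint n e W (a + 1) := by
      rw [endpoint, if_pos (by omega)]
      positivity
    have h3 := le_max_left (endpoint n e W (a + 1)) L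
    rw [h1]
    constructor
    · nlinarith
    · intro
      nlinarith
  · obtain ⟨h1, h2⟩ := pow_tOne he hW
    have hB : endpoint n e W (a + 1) = L * (1 - e) := by
      rw [endpoint, if_neg (by omega), if_pos (by omega), ← hL, h]
      push_cast
      ring
    have hBa : endpoint n e W a = n / (1 + e) ^ (tOne e W - 1) := by
      rw [endpoint, if_pos h.le, h]
    have h3 : L ≤ endpoint n e W a := by
      rw [hBa, hL]
      gcongr
    have h4 : endpoint n e W a ≤ (1 + e) * L := by
      have h5 : (1 + e) ^ tOne e W = (1 + e) ^ (tOne e W - 1) * (1 + e) := by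
        rw [← pow_succ, Nat.sub_add_cancel ht1]
      rw [hBa, hL, div_le_iff₀ (by positivity)]
      rw [h5] at h2
      calc (n : ℝ) = n / √(W : ℝ) * √(W : ℝ) := by field_simp
        _ ≤ n / √(W : ℝ) * ((1 + e) ^ (tOne e W - 1) * (1 + e)) := by gcongr
        _ = _ := by ring
    have h5 := le_max_right (endpoint n e W (a + 1)) L
    have h6 : 2 * e * L ≤ 2 * e * max (endpoint n e W (a + 1)) L := by gcongr
    constructor
    · nlinarith
    · intro
      nlinarith
  · have h5 : 2 * e * L ≤ 2 * e * max (endpoint n e W (a + 1)) L := by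
      gcongr
      exact le_max_right _ _
    have hBa : endpoint n e W a = L * (1 - e * ((a : ℝ) - tOne e W)) := by
      rw [endpoint, if_neg (by omega), if_pos (by omega), ← hL]
    rcases lt_or_ge a (tOne e W + tTwo e) with h1 | h1
    · have hB : endpoint n e W (a + 1) = L * (1 - e * ((a : ℝ) + 1 - tOne e W)) := by
        rw [endpoint, if_neg (by omega), if_pos (by omega), ← hL]
        push_cast
        ring
      have h6 : endpoint n e W a - endpoint n e W (a + 1) = e * L := by
        rw [hBa, hB]
        ring
      have h7 : 0 ≤ e * L := by positivity
      constructor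
      · linarith
      · intro
        linarith
    · obtain rfl : a = tOne e W + tTwo e := by omega
      refine ⟨?_, fun h => absurd h (by omega)⟩
      have hB : endpoint n e W (tOne e W + tTwo e + 1) = 1 := endpoint_numEndpoints
      have h6 := (mul_tTwo he he1).2
      push_cast at hBa
      have h7 : endpoint n e W (tOne e W + tTwo e) ≤ 2 * e * L := by
        rw [hBa]
        nlinarith
      linarith

/-- The estimate of `cost k` computed from correct search results. -/
theorem abs_profileOracle_sub_le (hc : Antitone c) (hc0 : c 0 = n) (he : 0 < e)
    (he1 : e ≤ 1 / 20) (hn : 0 < n) (hW : 1 ≤ W) (hL : L = n / √(W : ℝ)) {js : List ℕ}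
    (hjs : List.Forall₂ (IsSearchResult n c (e / 8) L W)
      ((List.range (numEndpoints e W)).map fun i => endpoint n e W (i + 1)) js)
    {k : ℕ} (hk : 1 ≤ k) (hkn : k ≤ n) :
    |profileOracle ((List.range (numEndpoints e W)).map fun i =>
        (endpoint n e W (i + 1), endpointCost n e W js (i + 1))) k -
      ∑ m ∈ Finset.range W, ((c m - k : ℕ) : ℝ)| ≤
      ∑ m ∈ Finset.range W,
        if (k : ℝ) ≤ 2 * max (c m : ℝ) L then 10 * e * max (c m : ℝ) L else 0 := by
  have hs : 1 ≤ √(W : ℝ) := Real.one_le_sqrt.2 (by exact_mod_cast hW)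
  have hL0 : 0 < L := by
    rw [hL]
    have : (0 : ℝ) < n := by exact_mod_cast hn
    positivity
  have ht : 1 ≤ numEndpoints e W := by rw [numEndpoints]; omega
  have hB1 : endpoint n e W 1 = n := endpoint_one he hW
  have hk1 : (1 : ℝ) ≤ k := by exact_mod_cast hk
  have hres : ∀ a, 1 ≤ a → a ≤ numEndpoints e W →
      IsSearchResult n c (e / 8) L W (endpoint n e W a) (js.getD (a - 1) 0) := by
    intro a ha hat
    have hlen := hjs.length_eq
    rw [List.length_map, List.length_range] at hlen
    have h1 := (List.forall₂_iff_get.1 hjs).2 (a - 1) (by simp; omega) (by omega)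
    rw [List.getD_eq_getElem _ _ (by omega)]
    simpa [Nat.sub_add_cancel ha] using h1
  -- Clamped estimates never exceed n = B_1, so the first search always goes left.
  have hj1 : js.getD 0 0 = 1 := by
    obtain ⟨-, -, h | ⟨v, ⟨-, -, hv⟩, hvB⟩, -⟩ := hres 1 le_rfl ht
    · exact h
    · rw [hB1] at hvB
      linarith
  classical
  have hex : ∃ i, 1 ≤ i ∧ endpoint n e W i ≤ k := ⟨numEndpoints e W, ht, by
    rw [endpoint_numEndpoints]
    exact hk1⟩
  set i := Nat.find hex with hi
  obtain ⟨hi1, hBi⟩ : 1 ≤ i ∧ endpoint n e W i ≤ k := Nat.find_spec hex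
  have hit : i ≤ numEndpoints e W := Nat.find_min' hex ⟨ht, by
    rw [endpoint_numEndpoints]
    exact hk1⟩
  have hmin : ∀ a, 1 ≤ a → a < i → k < endpoint n e W a := by
    intro a ha hai
    have := Nat.find_min hex hai
    exact not_le.1 fun h => this ⟨ha, h⟩
  have horacle : profileOracle ((List.range (numEndpoints e W)).map fun i =>
        (endpoint n e W (i + 1), endpointCost n e W js (i + 1))) k = endpointCost n e W js i := by
    have hfind : (List.range (numEndpoints e W)).find?
        (fun a => decide (endpoint n e W (a + 1) ≤ k)) = some (i - 1) := by
      rw [List.find?_range_eq_some]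
      refine ⟨by simpa [Nat.sub_add_cancel hi1] using hBi, by simp; omega, ?_⟩
      intro a ha
      simpa using hmin (a + 1) (by omega) (by omega)
    rw [profileOracle, List.find?_map]
    simp only [Function.comp_def]
    rw [hfind]
    simp [Nat.sub_add_cancel hi1]
  -- Writing ĵ as the number of m < ĵ turns horizontal strips into columns, to be compared with the
  -- layers of cost_k.
  have hcost : endpointCost n e W js i = ∑ m ∈ Finset.range W, ∑ a ∈ Finset.Ico 1 i,
      (if m < js.getD (a + 1 - 1) 0 then endpoint n e W a - endpoint n e W (a + 1) else 0) := by
    rw [endpointCost_eq_sum hB1 hj1 hi1, Finset.sum_comm]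
    refine Finset.sum_congr rfl fun a ha => ?_
    rw [Finset.mem_Ico] at ha
    have hle : js.getD a 0 ≤ W := (hres (a + 1) (by omega) (by omega)).2.1
    rw [← Finset.sum_filter, Finset.sum_const, nsmul_eq_mul]
    congr 2
    have : (Finset.range W).filter (fun m => m < js.getD (a + 1 - 1) 0) =
        Finset.range (js.getD a 0) := by
      ext m
      simp only [Finset.mem_filter, Finset.mem_range, Nat.add_sub_cancel]
      omega
    rw [this, Finset.card_range]
  rw [horacle, hcost, ← Finset.sum_sub_distrib]
  refine (Finset.abs_sum_le_sum_abs _ _).trans (Finset.sum_le_sum fun m hm => ?_)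
  refine abs_contribution_sub_le (jh := fun a => js.getD (a - 1) 0) hc hc0 he he1 hL0 hi1 hB1 ?_
    (fun a ha hai => (endpoint_sub_le he (by linarith) hW hL ha (by omega)).1)
    (fun a ha hai => hres a ha (by omega)) hBi hmin hkn (Finset.mem_range.1 hm)
  intro a ha hai
  -- Before index `i` the endpoints exceed k ≥ 1, so even the final endpoint 1 is a step down when
  -- it is used.
  rcases (show a + 1 ≤ numEndpoints e W by omega).eq_or_lt with h | h
  · rw [h, endpoint_numEndpoints]
    exact hk1.trans (hmin a ha hai).le
  · exact (endpoint_sub_le he (by linarith) hW hL ha (by omega)).2 h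

end Endpoints

/-! ## Accuracy of the profile algorithm -/

/-! ### Degrees and threshold graphs in terms of adjacency lists. -/

section AdjacencyLists

variable {n : ℕ} {G : SimpleGraph (Fin n)} {w : Sym2 (Fin n) → ℕ}
  {adj : Fin n → List (Fin n × ℕ)}

theorem IsAdjList.ne_nil (h : IsAdjList G w adj) (hG : G.Connected) (hn : 2 ≤ n) (v : Fin n) :
    adj v ≠ [] := by
  have : Nontrivial (Fin n) := Fin.nontrivial_iff_two_le.2 hn
  obtain ⟨u, hu⟩ := hG.preconnected.exists_adj_of_nontrivial v
  exact List.ne_nil_of_mem ((h.mem_iff v u _).2 ⟨hu, rfl⟩)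

theorem IsAdjList.sum_length (h : IsAdjList G w adj) (hn : 0 < n) :
    ∑ v, ((adj v).length : ℝ) = averageDegree G * n := by
  classical
  have hlen : ∀ v, (adj v).length = G.degree v := by
    intro v
    rw [← List.toFinset_card_of_nodup (h.nodup v), ← SimpleGraph.card_neighborFinset_eq_degree]
    refine (Finset.card_bij (fun u _ => (u, w s(v, u))) ?_ ?_ ?_).symm
    · intro u hu
      rw [SimpleGraph.mem_neighborFinset] at hu
      simpa using (h.mem_iff v u _).2 ⟨hu, rfl⟩
    · intro u _ u' _ huu
      exact (Prod.ext_iff.1 huu).1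
    · rintro ⟨u, x⟩ hux
      rw [List.mem_toFinset, h.mem_iff] at hux
      exact ⟨u, by simpa using hux.1, by rw [hux.2]⟩
  have hn' : (n : ℝ) ≠ 0 := by exact_mod_cast hn.ne'
  rw [averageDegree, div_mul_cancel₀ _ hn']
  simp_rw [hlen]
  rw [← Nat.cast_sum, G.sum_degrees_eq_twice_card_edges]
  push_cast
  rw [← Set.ncard_coe_finset, SimpleGraph.coe_edgeFinset]

theorem IsAdjList.thresholdGraph_adj (h : IsAdjList G w adj) (j : ℕ) (u v : Fin n) :
    (thresholdGraph G w j).Adj u v ↔ ∃ x, (v, x) ∈ adj u ∧ decide (x ≤ j) = true := by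
  constructor
  · rintro ⟨h1, h2⟩
    exact ⟨_, (h.mem_iff u v _).2 ⟨h1, rfl⟩, by simpa using h2⟩
  · rintro ⟨x, hx, hxj⟩
    obtain ⟨h1, rfl⟩ := (h.mem_iff u v x).1 hx
    exact ⟨h1, by simpa using hxj⟩

theorem averageDegree_ge_one (hG : G.Connected) (hn : 2 ≤ n) : 1 ≤ averageDegree G := by
  have h := hG.card_vert_le_card_edgeSet_add_one
  rw [Nat.card_eq_fintype_card, Fintype.card_fin, Nat.card_coe_set_eq] at h
  have hn' : (2 : ℝ) ≤ n := by exact_mod_cast hn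
  have h' : (n : ℝ) ≤ G.edgeSet.ncard + 1 := by exact_mod_cast h
  rw [averageDegree, le_div_iff₀ (by linarith)]
  linarith

end AdjacencyLists

/-! ### Success probability of the profile algorithm. -/

section ProfileAccuracy

open RandComp

variable {n : ℕ} [NeZero n] {G : SimpleGraph (Fin n)} {w : Sym2 (Fin n) → ℕ}
  {adj : Fin n → List (Fin n × ℕ)} {W : ℕ}

theorem le_prob_appProfile (hn : 2 ≤ n) (hW : 1 ≤ W) (hWn : √(W : ℝ) ≤ n) {e : ℝ} (he : 0 < e)
    (he1 : e ≤ 1 / 20) (hG : G.Connected) (hw : ∀ e ∈ G.edgeSet, 1 ≤ w e ∧ w e ≤ W)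
    (hadj : IsAdjList G w adj) {T : SimpleGraph (Fin n)} (hT : IsMinSpanningTree G w T) :
    3 / 4 ≤ (appProfile adj 4 e W (averageDegree G)).prob fun rep =>
      ∑ k ∈ Finset.Icc 1 n, |profileOracle rep k - (kClusteringCost w T k : ℝ)| ≤
        160 * e * (hierarchyCost w T : ℝ) := by
  classical
  set c : ℕ → ℕ := fun j => componentCount (thresholdGraph G w j) with hc
  set L : ℝ := n / √(W : ℝ) with hL
  have hW' : (1 : ℝ) ≤ W := by exact_mod_cast hW
  have hs : 1 ≤ √(W : ℝ) := Real.one_le_sqrt.2 hW'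
  have hd := averageDegree_ge_one hG hn
  have hc1 : ∀ j, 1 ≤ c j := by
    intro j
    have : Nonempty (thresholdGraph G w j).ConnectedComponent :=
      ⟨(thresholdGraph G w j).connectedComponentMk 0⟩
    exact Nat.card_pos
  have hcn : ∀ j, c j ≤ n := fun j => componentCount_le _
  have hanti : Antitone c := fun i j hij =>
    SimpleGraph.ConnectedComponent.card_le_card_of_le fun x y hxy => ⟨hxy.1, hxy.2.trans hij⟩
  have hc0 : c 0 = n := hT.componentCount_thresholdGraph_zero hw
  have hest : ∀ j ∈ Finset.Icc 1 W, (medianTrick adj (fun x => decide (x ≤ j)) 4 (e / 8)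
      (√(W : ℝ)) (averageDegree G) (1 / (4 * (W : ℝ)))).prob
        (fun x => ¬ |x - c j| ≤ e / 8 * max (c j : ℝ) L) ≤ ENNReal.ofReal (1 / (4 * (W : ℝ))) :=
    fun j _ => prob_medianTrick_le (H := thresholdGraph G w j) (hadj.ne_nil hG hn)
      (hadj.thresholdGraph_adj j) (by positivity) (by linarith) (by linarith)
      (hadj.sum_length (by omega)) (by positivity)
  have hsearch := prob_searchKeys_le hW hc1 hcn hest
    ((List.range (numEndpoints e W)).map fun i => endpoint n e W (i + 1))
  -- The union bound over at most W estimates uses up exactly the allowed failure probability.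
  have hδ : ENNReal.ofReal (1 / (4 * (W : ℝ))) * W = 1 / 4 := by
    rw [← ENNReal.ofReal_natCast W, ← ENNReal.ofReal_mul (by positivity)]
    rw [show 1 / (4 * (W : ℝ)) * W = 1 / 4 by field_simp, ENNReal.ofReal_div_of_pos (by norm_num)]
    simp
  rw [hδ] at hsearch
  have hgood : ∀ js : List ℕ, List.Forall₂ (IsSearchResult n c (e / 8) L W)
      ((List.range (numEndpoints e W)).map fun i => endpoint n e W (i + 1)) js →
      ∑ k ∈ Finset.Icc 1 n, |profileOracle ((List.range (numEndpoints e W)).map fun i =>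
        (endpoint n e W (i + 1), endpointCost n e W js (i + 1))) k -
          (kClusteringCost w T k : ℝ)| ≤ 160 * e * (hierarchyCost w T : ℝ) := by
    intro js hjs
    have hcost : ∀ k ∈ Finset.Icc 1 n, (kClusteringCost w T k : ℝ) =
        ∑ m ∈ Finset.range W, ((c m - k : ℕ) : ℝ) := by
      intro k hk
      rw [Finset.mem_Icc] at hk
      rw [kClusteringCost_eq_sum hT hw hk.1 hk.2]
      push_cast
      rfl
    rw [Finset.sum_congr rfl fun k hk => by rw [hcost k hk]]
    refine sum_abs_sub_le (c := c) (L := L) hn hW hc0 hc1 he he1 ?_ ?_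
      (sum_componentCount_le_hierarchyCost hT hw) fun k hk => ?_
    · rw [hL, le_div_iff₀ (by linarith)]
      linarith
    · rw [hL, div_pow, Real.sq_sqrt (by linarith)]
      field_simp
    · rw [Finset.mem_Icc] at hk
      exact abs_profileOracle_sub_le hanti hc0 he he1 (by omega) hW hL hjs hk.1 hk.2
  have hprob : (searchKeys adj 4 e W (averageDegree G)
      ((List.range (numEndpoints e W)).map fun i => endpoint n e W (i + 1)) fun _ => none).prob
        (fun js => List.Forall₂ (IsSearchResult n c (e / 8) L W)
          ((List.range (numEndpoints e W)).map fun i => endpoint n e W (i + 1)) js) ≤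
      (appProfile adj 4 e W (averageDegree G)).prob fun rep =>
        ∑ k ∈ Finset.Icc 1 n, |profileOracle rep k - (kClusteringCost w T k : ℝ)| ≤
          160 * e * (hierarchyCost w T : ℝ) := by
    rw [prob_eq_ev, prob_eq_ev, appProfile, appCostIndices]
    simp only [ev_bind, ev_charge, ev_pure]
    refine ev_mono _ fun js => ?_
    by_cases h : List.Forall₂ (IsSearchResult n c (e / 8) L W)
          ((List.range (numEndpoints e W)).map fun i => endpoint n e W (i + 1)) js
    · rw [if_pos h, if_pos (hgood js h)]
    · rw [if_neg h]
      exact zero_le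
  refine le_trans ?_ hprob
  have hadd := prob_add_prob_not (searchKeys adj 4 e W (averageDegree G)
      ((List.range (numEndpoints e W)).map fun i => endpoint n e W (i + 1)) fun _ => none)
        (fun js => List.Forall₂ (IsSearchResult n c (e / 8) L W)
          ((List.range (numEndpoints e W)).map fun i => endpoint n e W (i + 1)) js)
  have h34 : (3 / 4 : ℝ≥0∞) + 1 / 4 = 1 := by
    rw [← ENNReal.add_div]
    norm_num
    exact ENNReal.div_self (by norm_num) (by norm_num)
  rw [← ENNReal.add_le_add_iff_right (a := 1 / 4)
    (ENNReal.div_ne_top ENNReal.one_ne_top (by norm_num))]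
  exact h34.le.trans (hadd.ge.trans (add_le_add_right hsearch _))

end ProfileAccuracy

/-! ## Running time -/

section RunningTime

open RandComp

variable {n : ℕ} {adj : Fin n → List (Fin n × ℕ)} {inH : ℕ → Bool} {dG : ℝ} {Γ : ℕ}

/-! ### Queries are bounded by steps -/

theorem queryBounded_coinLoop (du fuel : ℕ) : ∀ (flips : ℕ) (s : BFS n),
    QueryBounded (coinLoop adj inH Γ dG du fuel flips s) := by
  induction fuel with
  | zero => exact fun _ _ => .pure _
  | succ fuel ih =>
    intro flips s
    rw [coinLoop]
    exact .bind .coin fun _ => .ite (.bind (.charge (by omega)) fun _ => .ite (.pure _) (ih _ _))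
      (.pure _)

theorem queryBounded_vertexEstimate (u : Fin n) :
    QueryBounded (vertexEstimate adj inH Γ dG u) := by
  rw [vertexEstimate]
  exact .bind (.charge (by omega)) fun _ => .ite (.pure _) (queryBounded_coinLoop _ _ _ _)

variable [NeZero n]

theorem queryBounded_sampleSum (r : ℕ) : QueryBounded (sampleSum adj inH Γ dG r) := by
  induction r with
  | zero => exact .pure _
  | succ r ih =>
    rw [sampleSum]
    exact .bind (.vertex n) fun _ => .bind (queryBounded_vertexEstimate _) fun _ =>
      .bind (.charge (by omega)) fun _ => .bind ih fun _ => .pure _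

theorem queryBounded_repeatRuns {p : RandComp ℝ} (hp : QueryBounded p) (R : ℕ) :
    QueryBounded (repeatRuns p R) := by
  induction R with
  | zero => exact .pure _
  | succ R ih =>
    rw [repeatRuns]
    exact .bind hp fun _ => .bind (.charge (by omega)) fun _ => .bind ih fun _ => .pure _

theorem queryBounded_medianTrick (κ ε k d δ : ℝ) :
    QueryBounded (medianTrick adj inH κ ε k d δ) := by
  rw [medianTrick]
  refine .bind (queryBounded_repeatRuns ?_ _) fun _ => .bind (.charge (by omega)) fun _ => .pure _
  rw [approxComponents]
  exact .bind (.charge (by omega)) fun _ => .bind (queryBounded_sampleSum _) fun _ => .pure _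

variable {κ ε d : ℝ} {W : ℕ}

theorem queryBounded_componentEstimate (j : ℕ) (memo : ℕ → Option ℝ) :
    QueryBounded (componentEstimate adj κ ε W d j memo) := by
  rw [componentEstimate]
  rcases memo j with _ | v
  · exact .bind (queryBounded_medianTrick _ _ _ _ _) fun _ => .bind (.charge (by omega)) fun _ =>
      .pure _
  · exact .bind (.charge (by omega)) fun _ => .pure _

theorem queryBounded_binarySearch (B : ℝ) (k : ℕ) : ∀ (l r : ℕ) (memo : ℕ → Option ℝ), r - l ≤ k →
    QueryBounded (binarySearch adj κ ε W d B l r memo) := by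
  induction k with
  | zero =>
    intro l r memo hk
    rw [binarySearch, dif_pos (by omega)]
    exact .bind (.charge (by omega)) fun _ => .pure _
  | succ k ih =>
    intro l r memo hk
    rw [binarySearch]
    split_ifs with h
    · exact .bind (.charge (by omega)) fun _ => .pure _
    · exact .bind (queryBounded_componentEstimate _ _) fun _ => .bind (.charge (by omega)) fun _ =>
        .ite (ih _ _ _ (by omega)) (ih _ _ _ (by omega))

theorem queryBounded_searchKeys (keys : List ℝ) : ∀ memo : ℕ → Option ℝ,
    QueryBounded (searchKeys adj κ ε W d keys memo) := by
  induction keys with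
  | nil => exact fun _ => .pure _
  | cons B keys ih =>
    intro memo
    rw [searchKeys]
    exact .bind (queryBounded_binarySearch B _ _ _ _ le_rfl) fun _ => .bind (ih _) fun _ => .pure _

theorem queryBounded_appProfile : QueryBounded (appProfile adj κ ε W d) := by
  rw [appProfile]
  refine .bind ?_ fun _ => .bind (.charge (by omega)) fun _ => .pure _
  rw [appCostIndices]
  exact .bind (.charge (by omega)) fun _ => queryBounded_searchKeys _ _

/-! ### Expected running times of the parts -/

/-- The time for a vertex is proportional to its degree, and a uniform vertex has mean degree `d`,
so large degrees average out. The exponent `l` bounds the number of doublings. -/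
theorem expTime_sampleSum_le {H : SimpleGraph (Fin n)} (hadj : ∀ v, adj v ≠ []) (hdG : 0 ≤ dG)
    (hH : ∀ u v, H.Adj u v ↔ ∃ x, (v, x) ∈ adj u ∧ inH x = true)
    (hsum : ∑ v, ((adj v).length : ℝ) = d * n) (hd : 0 ≤ d) {l : ℕ} (hl : Γ * dG < 2 ^ l)
    (r : ℕ) :
    expTime (sampleSum adj inH Γ dG r) ≤ ENNReal.ofReal (r * (2 + d * (l + 5))) := by
  have hn : (0 : ℝ) < n := by exact_mod_cast Nat.pos_of_ne_zero (NeZero.ne n)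
  have hmean : ev (vertex n) (fun u => expTime (vertexEstimate adj inH Γ dG u)) ≤
      ENNReal.ofReal (d * (l + 5)) := by
    refine (ev_mono _ fun u => expTime_vertexEstimate_le hadj hdG hH u hl).trans (le_of_eq ?_)
    have hinv : (n : ℝ≥0∞)⁻¹ = ENNReal.ofReal (n : ℝ)⁻¹ := by
      rw [ENNReal.ofReal_inv_of_pos hn, ENNReal.ofReal_natCast]
    rw [ev_vertex, hinv, ← Finset.mul_sum, ← Nat.cast_sum, ← ENNReal.ofReal_natCast,
      ← ENNReal.ofReal_mul (by positivity)]
    congr 1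
    push_cast
    rw [← Finset.sum_mul, hsum]
    field_simp
  induction r with
  | zero => simp [sampleSum, expTime_pure]
  | succ r ih =>
    have hstep : expTime (sampleSum adj inH Γ dG (r + 1)) =
        1 + (ev (vertex n) (fun u => expTime (vertexEstimate adj inH Γ dG u)) +
          (1 + expTime (sampleSum adj inH Γ dG r))) := by
      simp only [sampleSum, expTime_bind, expTime_vertex, expTime_charge, expTime_pure,
        ev_const, add_zero, Nat.cast_one, ev_add]
    rw [hstep]
    refine (add_le_add_right (add_le_add hmean (add_le_add_right ih _)) _).trans (le_of_eq ?_)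
    rw [← ENNReal.ofReal_one, ← ENNReal.ofReal_add (by positivity) (by positivity),
      ← ENNReal.ofReal_add (by positivity) (by positivity),
      ← ENNReal.ofReal_add (by positivity) (by positivity)]
    congr 1
    push_cast
    ring

theorem expTime_repeatRuns_le {p : RandComp ℝ} {x : ℝ} (hx : 0 ≤ x)
    (hp : expTime p ≤ ENNReal.ofReal x) (R : ℕ) :
    expTime (repeatRuns p R) ≤ ENNReal.ofReal (R * (x + 1)) := by
  induction R with
  | zero => simp [repeatRuns, expTime_pure]
  | succ R ih =>
    have hstep : expTime (repeatRuns p (R + 1)) = expTime p + (1 + expTime (repeatRuns p R)) := by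
      simp only [repeatRuns, expTime_bind, expTime_charge, expTime_pure, ev_const,
        add_zero, Nat.cast_one]
    rw [hstep]
    refine (add_le_add hp (add_le_add_right ih _)).trans (le_of_eq ?_)
    rw [← ENNReal.ofReal_one, ← ENNReal.ofReal_add (by positivity) (by positivity),
      ← ENNReal.ofReal_add (by positivity) (by positivity)]
    congr 1
    push_cast
    ring

theorem expTime_medianTrick_le {H : SimpleGraph (Fin n)} (hadj : ∀ v, adj v ≠ [])
    (hH : ∀ u v, H.Adj u v ↔ ∃ x, (v, x) ∈ adj u ∧ inH x = true)
    (hsum : ∑ v, ((adj v).length : ℝ) = d * n) (hd : 0 ≤ d) {k δ : ℝ} {l : ℕ}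
    (hl : (⌈4 * k / ε⌉₊ : ℝ) * (d * ⌈4 * k / ε⌉₊) < 2 ^ l) :
    expTime (medianTrick adj inH κ ε k d δ) ≤ ENNReal.ofReal
      (⌈κ * Real.log (1 / δ)⌉₊ * (⌈64 * k / ε ^ 2⌉₊ * (2 + d * (l + 5)) + 2) +
        ⌈κ * Real.log (1 / δ)⌉₊ ^ 2 + 1) := by
  set R := ⌈κ * Real.log (1 / δ)⌉₊
  set r := ⌈64 * k / ε ^ 2⌉₊
  have h1 : expTime (approxComponents adj inH ε k d) ≤
      ENNReal.ofReal (r * (2 + d * (l + 5)) + 1) := by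
    have hstep : expTime (approxComponents adj inH ε k d) =
        1 + expTime (sampleSum adj inH ⌈4 * k / ε⌉₊ (d * ⌈4 * k / ε⌉₊) r) := by
      simp only [approxComponents, expTime_bind, expTime_charge, expTime_pure, ev_const,
        add_zero, Nat.cast_one]
      rfl
    rw [hstep, add_comm, ENNReal.ofReal_add (by positivity) (by positivity), ENNReal.ofReal_one]
    exact add_le_add_left (expTime_sampleSum_le hadj (by positivity) hH hsum hd hl r) _
  have h2 := expTime_repeatRuns_le (by positivity) h1 R
  have hstep : expTime (medianTrick adj inH κ ε k d δ) =
      expTime (repeatRuns (approxComponents adj inH ε k d) R) + ((R ^ 2 + 1 : ℕ) : ℝ≥0∞) := by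
    simp only [medianTrick, expTime_bind, expTime_charge, expTime_pure, ev_const,
      add_zero]
    rfl
  rw [hstep]
  refine (add_le_add_left h2 _).trans (le_of_eq ?_)
  rw [← ENNReal.ofReal_natCast, ← ENNReal.ofReal_add (by positivity) (by positivity)]
  congr 1
  push_cast
  ring

theorem expTime_componentEstimate_le {j : ℕ} {x : ℝ≥0∞}
    (hx : expTime (medianTrick adj (fun x => decide (x ≤ j)) κ (ε / 8) (√(W : ℝ)) d
      (1 / (4 * (W : ℝ)))) ≤ x) (memo : ℕ → Option ℝ) :
    expTime (componentEstimate adj κ ε W d j memo) ≤ x + 1 := by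
  rw [componentEstimate]
  rcases memo j with _ | v
  · simp only [expTime_bind, expTime_charge, expTime_pure, ev_const, add_zero,
      Nat.cast_one]
    exact add_le_add_left hx _
  · simp only [expTime_bind, expTime_charge, ev_charge, expTime_pure, add_zero, Nat.cast_one]
    exact le_add_self

/-- At most `h` halvings shrink the interval to a point. Every probe is charged as a fresh estimate;
the savings from the table are not needed. -/
theorem expTime_binarySearch_le {x : ℝ≥0∞}
    (hx : ∀ j, expTime (medianTrick adj (fun x => decide (x ≤ j)) κ (ε / 8) (√(W : ℝ)) d
      (1 / (4 * (W : ℝ)))) ≤ x) (B : ℝ) (h : ℕ) : ∀ (l r : ℕ) (memo : ℕ → Option ℝ),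
    r - l < 2 ^ h → expTime (binarySearch adj κ ε W d B l r memo) ≤ h * (x + 2) + 1 := by
  induction h with
  | zero =>
    intro l r memo hlr
    rw [binarySearch, dif_pos (by simp at hlr; omega)]
    simp only [expTime_bind, expTime_charge, ev_charge, expTime_pure, add_zero, Nat.cast_one]
    exact le_add_self
  | succ h ih =>
    intro l r memo hlr
    rw [pow_succ] at hlr
    rw [binarySearch]
    split_ifs with hle
    · simp only [expTime_bind, expTime_charge, ev_charge, expTime_pure, add_zero, Nat.cast_one]
      exact le_add_self
    · have hpow : 0 < 2 ^ h := by positivity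
      refine (expTime_bind_le _ _ (b := 1 + (h * (x + 2) + 1))
        (expTime_componentEstimate_le (hx _) memo) fun p => ?_).trans (le_of_eq ?_)
      · simp only [expTime_bind, expTime_charge, ev_charge, Nat.cast_one]
        refine add_le_add_right ?_ _
        split_ifs
        · exact ih _ _ _ (by omega)
        · exact ih _ _ _ (by omega)
      · push_cast
        ring

theorem expTime_searchKeys_le {x : ℝ≥0∞}
    (hx : ∀ j, expTime (medianTrick adj (fun x => decide (x ≤ j)) κ (ε / 8) (√(W : ℝ)) d
      (1 / (4 * (W : ℝ)))) ≤ x) {h : ℕ} (hh : W - 1 < 2 ^ h) (keys : List ℝ) :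
    ∀ memo : ℕ → Option ℝ,
    expTime (searchKeys adj κ ε W d keys memo) ≤ keys.length * (h * (x + 2) + 1) := by
  induction keys with
  | nil =>
    intro memo
    simp [searchKeys, expTime_pure]
  | cons B keys ih =>
    intro memo
    rw [searchKeys]
    refine (expTime_bind_le _ _ (expTime_binarySearch_le hx B h 1 W memo hh) fun p =>
      expTime_bind_le _ _ (ih p.2) fun js => (expTime_pure _).le).trans (le_of_eq ?_)
    rw [List.length_cons]
    push_cast
    ring

theorem expTime_appProfile_le {x : ℝ≥0∞}
    (hx : ∀ j, expTime (medianTrick adj (fun x => decide (x ≤ j)) κ (ε / 8) (√(W : ℝ)) d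
      (1 / (4 * (W : ℝ)))) ≤ x) {h : ℕ} (hh : W - 1 < 2 ^ h) :
    expTime (appProfile adj κ ε W d) ≤ numEndpoints ε W * (h * (x + 2) + 1) +
      (numEndpoints ε W ^ 2 + 2 * numEndpoints ε W + 2 : ℕ) := by
  have h1 := expTime_searchKeys_le hx hh
    ((List.range (numEndpoints ε W)).map fun i => endpoint n ε W (i + 1)) fun _ => none
  rw [List.length_map, List.length_range] at h1
  simp only [appProfile, appCostIndices, expTime_bind, expTime_charge, expTime_pure,
    ev_const, add_zero]
  refine (add_le_add_left (add_le_add_right h1 _) _).trans (le_of_eq ?_)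
  push_cast
  ring

end RunningTime

/-! ## The final bounds -/

section FinalBounds

/-- The geometric part is bounded through log(1 + e) ≥ e/2. -/
theorem numEndpoints_le {e : ℝ} (he : 0 < e) (he1 : e ≤ 1 / 2) {W : ℕ} (hW : 1 ≤ W) :
    (numEndpoints e W : ℝ) ≤ (Real.log W + 3) / e := by
  have hW' : (1 : ℝ) ≤ W := by exact_mod_cast hW
  have hs : 1 ≤ √(W : ℝ) := Real.one_le_sqrt.2 hW'
  have hlogW : 0 ≤ Real.log W := Real.log_nonneg hW'
  have h0 : 2 ≤ 1 / e := by
    rw [le_div_iff₀ he]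
    linarith
  have hx := Real.logb_nonneg (by linarith : 1 < 1 + e) hs
  have h1 : (tOne e W : ℝ) ≤ Real.logb (1 + e) (√(W : ℝ)) + 1 := Nat.floor_le (by linarith)
  have h2 : (tTwo e : ℝ) ≤ 1 / e - 1 := Nat.floor_le (by linarith)
  have h3 : e / 2 ≤ Real.log (1 + e) := by
    have := Real.one_sub_inv_le_log_of_pos (show 0 < 1 + e by linarith)
    have h4 : e / 2 ≤ 1 - (1 + e)⁻¹ := by
      rw [← sub_nonneg, show 1 - (1 + e)⁻¹ - e / 2 = e * (1 - e) / (2 * (1 + e)) by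
        field_simp; ring]
      have : 0 ≤ 1 - e := by linarith
      positivity
    linarith
  have h4 : Real.logb (1 + e) (√(W : ℝ)) ≤ Real.log W / e := by
    rw [Real.logb, Real.log_sqrt (by linarith)]
    calc Real.log W / 2 / Real.log (1 + e) ≤ Real.log W / 2 / (e / 2) := by gcongr
      _ = Real.log W / e := by field_simp
  rw [numEndpoints]
  push_cast
  rw [add_div, show (3 : ℝ) / e = 3 * (1 / e) by ring]
  linarith

/-- Arithmetic behind the running time bound. -/
theorem total_time_le {a y E s d R r l h t : ℝ} (ha : 1 ≤ a) (hy : 1 ≤ y) (hE : 1 ≤ E)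
    (hs : 1 ≤ s) (hd : 1 ≤ d) (hR0 : 0 ≤ R) (hr0 : 0 ≤ r) (hl0 : 0 ≤ l) (hh0 : 0 ≤ h)
    (ht0 : 0 ≤ t) (hR : R ≤ 7 * y) (hr : r ≤ a * (s * E ^ 2)) (hl : l ≤ 30 * y) (hh : h ≤ 2 * y)
    (ht : t ≤ 560 * (y * E)) :
    t * (h * (R * (r * (2 + d * (l + 5)) + 2) + R ^ 2 + 1 + 2) + 1) + (t ^ 2 + 2 * t + 2) ≤
      (560 * (2 * (259 * a + 64) + 5) + 560 ^ 2 + 1122) * (y ^ 4 * (s * d * E ^ 3)) := by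
  -- Here y stands for the logarithm, E for 1/ε and s for √W. Each of `l`, `R`, `h`, `t` contributes
  -- one factor y, and `t` also the third factor E; all additive terms are absorbed since every
  -- quantity is at least 1.
  set P := s * d * E ^ 2 with hP
  have hP1 : 1 ≤ P := one_le_mul_of_one_le_of_one_le (one_le_mul_of_one_le_of_one_le hs hd)
    (one_le_pow₀ hE)
  have h1 : 2 + d * (l + 5) ≤ 37 * (d * y) := by nlinarith [mul_le_mul hd hy zero_le_one (by linarith)]
  have h2 : r * (2 + d * (l + 5)) + 2 ≤ (37 * a + 2) * (P * y) := by
    have h3 : r * (2 + d * (l + 5)) ≤ a * (s * E ^ 2) * (37 * (d * y)) := by gcongr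
    have h4 : 1 ≤ P * y := one_le_mul_of_one_le_of_one_le hP1 hy
    have h5 : a * (s * E ^ 2) * (37 * (d * y)) = 37 * a * (P * y) := by rw [hP]; ring
    linarith
  have hPy : y ^ 2 ≤ P * y ^ 2 := le_mul_of_one_le_left (by positivity) hP1
  have h1y : 1 ≤ y ^ 2 := one_le_pow₀ hy
  have h3 : R * (r * (2 + d * (l + 5)) + 2) + R ^ 2 + 1 ≤ (259 * a + 64) * (P * y ^ 2) := by
    have h4 : R * (r * (2 + d * (l + 5)) + 2) ≤ 7 * y * ((37 * a + 2) * (P * y)) := by gcongr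
    have h5 : R ^ 2 ≤ (7 * y) ^ 2 := by gcongr
    have h6 : 7 * y * ((37 * a + 2) * (P * y)) = (259 * a + 14) * (P * y ^ 2) := by ring
    linarith
  set x := R * (r * (2 + d * (l + 5)) + 2) + R ^ 2 + 1 with hx
  have h4 : h * (x + 2) + 1 ≤ (2 * (259 * a + 64) + 5) * (P * y ^ 3) := by
    have h5 : x + 2 ≤ (259 * a + 66) * (P * y ^ 2) := by linarith
    have hx0 : 0 ≤ x + 2 := by positivity
    have h6 : h * (x + 2) ≤ 2 * y * ((259 * a + 66) * (P * y ^ 2)) := by gcongr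
    have h7 : 1 ≤ P * y ^ 3 := one_le_mul_of_one_le_of_one_le hP1 (one_le_pow₀ hy)
    have h8 : 2 * y * ((259 * a + 66) * (P * y ^ 2)) = (2 * (259 * a + 64) + 4) * (P * y ^ 3) := by
      ring
    linarith
  have h5 : t * (h * (x + 2) + 1) ≤
      560 * (y * E) * ((2 * (259 * a + 64) + 5) * (P * y ^ 3)) := by
    have hx0 : 0 ≤ h * (x + 2) + 1 := by positivity
    gcongr
  have h6 : t ^ 2 + 2 * t + 2 ≤ (560 ^ 2 + 1122) * (y ^ 2 * E ^ 2) := by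
    have h7 : t ^ 2 ≤ (560 * (y * E)) ^ 2 := by gcongr
    have h8 : 1 ≤ y * E := one_le_mul_of_one_le_of_one_le hy hE
    nlinarith
  have h7 : y ^ 2 * E ^ 2 ≤ y ^ 4 * (s * d * E ^ 3) := by
    have hyy : y ^ 2 ≤ y ^ 4 := pow_le_pow_right₀ hy (by norm_num)
    have hEE : E ^ 2 ≤ E ^ 3 := pow_le_pow_right₀ hE (by norm_num)
    have hsd : 1 ≤ s * d := one_le_mul_of_one_le_of_one_le hs hd
    have hEE' : E ^ 2 ≤ s * d * E ^ 3 := hEE.trans (le_mul_of_one_le_left (by positivity) hsd)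
    gcongr
  calc _ ≤ 560 * (y * E) * ((2 * (259 * a + 64) + 5) * (P * y ^ 3)) +
        (560 ^ 2 + 1122) * (y ^ 4 * (s * d * E ^ 3)) := by
        have := mul_le_mul_of_nonneg_left h7 (show (0 : ℝ) ≤ 560 ^ 2 + 1122 by norm_num)
        linarith
    _ = _ := by rw [hP]; ring

open RandComp in
theorem expTime_appProfile_le_ofReal {n : ℕ} [NeZero n] {G : SimpleGraph (Fin n)}
    {w : Sym2 (Fin n) → ℕ} {adj : Fin n → List (Fin n × ℕ)} {W : ℕ} {ε : ℝ} (hn : 2 ≤ n)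
    (hW : 1 ≤ W) (hε : 0 < ε) (hε1 : ε < 1) (hG : G.Connected) (hadj : IsAdjList G w adj) :
    expTime (appProfile adj 4 (1 / 160 * ε) W (averageDegree G)) ≤
      ENNReal.ofReal (16 * (560 * (2 * (259 * 104857601 + 64) + 5) + 560 ^ 2 + 1122) *
        (√(W : ℝ) * averageDegree G / ε ^ 3 * Real.log (2 * W * averageDegree G / ε) ^ 4)) := by
  set d := averageDegree G with hd
  set e := 1 / 160 * ε with he
  set s := √(W : ℝ) with hsdef
  set Λ := Real.log (2 * W * d / ε) with hΛ
  have hd1 : 1 ≤ d := averageDegree_ge_one hG hn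
  have hW' : (1 : ℝ) ≤ W := by exact_mod_cast hW
  have hs : 1 ≤ s := Real.one_le_sqrt.2 hW'
  have hs2 : s ^ 2 = W := Real.sq_sqrt (by linarith)
  have hE : 1 ≤ 1 / ε := by rw [le_div_iff₀ hε]; linarith
  have he0 : 0 < e := by positivity
  have hlog2 : (1 : ℝ) / 2 ≤ Real.log 2 := by linarith [Real.log_two_gt_d9]
  have hΛeq : Λ = Real.log 2 + Real.log W + Real.log d + Real.log (1 / ε) := by
    rw [hΛ, show 2 * W * d / ε = 2 * W * d * (1 / ε) by ring,
      Real.log_mul (by positivity) (by positivity), Real.log_mul (by positivity) (by positivity),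
      Real.log_mul (by positivity) (by positivity)]
  have hlW := Real.log_nonneg hW'
  have hld := Real.log_nonneg hd1
  have hlE := Real.log_nonneg hE
  have hy : 1 ≤ 2 * Λ := by linarith
  have hR : (⌈4 * Real.log (1 / (1 / (4 * (W : ℝ))))⌉₊ : ℝ) ≤ 7 * (2 * Λ) := by
    rw [one_div_one_div]
    have h4 : Real.log (4 * W) = 2 * Real.log 2 + Real.log W := by
      rw [Real.log_mul (by norm_num) (by positivity), show (4 : ℝ) = 2 ^ 2 by norm_num,
        Real.log_pow]
      norm_num
    have h5 : 0 ≤ Real.log (4 * (W : ℝ)) := Real.log_nonneg (by linarith)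
    have := Nat.ceil_lt_add_one (show 0 ≤ 4 * Real.log (4 * (W : ℝ)) by positivity)
    rw [h4] at this ⊢
    linarith
  -- 64 · (8 · 160)² = 104857600, and 1 more for rounding up.
  have hr : (⌈64 * s / (e / 8) ^ 2⌉₊ : ℝ) ≤ 104857601 * (s * (1 / ε) ^ 2) := by
    have := Nat.ceil_lt_add_one (show 0 ≤ 64 * s / (e / 8) ^ 2 by positivity)
    have h1 : 64 * s / (e / 8) ^ 2 = 104857600 * (s * (1 / ε) ^ 2) := by
      rw [he]
      field_simp
      norm_num
    have h2 : 1 ≤ s * (1 / ε) ^ 2 := one_le_mul_of_one_le_of_one_le hs (one_le_pow₀ hE)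
    linarith
  -- Chosen so that 2^l exceeds Γ² d ≤ 2^26 W d / ε²: the logarithm of the latter is at most 28 Λ,
  -- and log 2 ≥ 1/2.
  set l := ⌈56 * Λ⌉₊ + 1 with hl
  have hl30 : (l : ℝ) ≤ 30 * (2 * Λ) := by
    have := Nat.ceil_lt_add_one (show 0 ≤ 56 * Λ by linarith)
    rw [hl]
    push_cast
    linarith
  set h := ⌈2 * Λ⌉₊ with hh
  have hh2 : (h : ℝ) ≤ 2 * (2 * Λ) := by
    have := Nat.ceil_lt_add_one (show 0 ≤ 2 * Λ by linarith)
    linarith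
  have ht : (numEndpoints e W : ℝ) ≤ 560 * (2 * Λ * (1 / ε)) := by
    refine (numEndpoints_le he0 (by rw [he]; linarith) hW).trans ?_
    have : (Real.log W + 3) / e = 160 * (Real.log W + 3) * (1 / ε) := by
      rw [he]
      field_simp
    rw [this, ← mul_assoc]
    exact mul_le_mul_of_nonneg_right (by linarith) (by linarith)
  have hhW : W - 1 < 2 ^ h := by
    suffices (W : ℝ) ≤ 2 ^ h by
      have : W ≤ 2 ^ h := by exact_mod_cast this
      omega
    rw [← Real.log_le_log_iff (by linarith) (by positivity), Real.log_pow]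
    have h1 : 2 * Λ ≤ h := Nat.le_ceil _
    nlinarith
  have hΓ : (⌈4 * s / (e / 8)⌉₊ : ℝ) * (d * ⌈4 * s / (e / 8)⌉₊) < 2 ^ l := by
    have h1 : (⌈4 * s / (e / 8)⌉₊ : ℝ) ≤ 2 ^ 13 * (s * (1 / ε)) := by
      have := Nat.ceil_lt_add_one (show 0 ≤ 4 * s / (e / 8) by positivity)
      have h1 : 4 * s / (e / 8) = 5120 * (s * (1 / ε)) := by
        rw [he]
        field_simp
        norm_num
      have h2 : 1 ≤ s * (1 / ε) := one_le_mul_of_one_le_of_one_le hs hE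
      linarith
    have h2 : (⌈4 * s / (e / 8)⌉₊ : ℝ) * (d * ⌈4 * s / (e / 8)⌉₊) ≤
        2 ^ 26 * W * d * (1 / ε) ^ 2 := by
      calc _ ≤ 2 ^ 13 * (s * (1 / ε)) * (d * (2 ^ 13 * (s * (1 / ε)))) := by gcongr
        _ = 2 ^ 26 * s ^ 2 * d * (1 / ε) ^ 2 := by ring
        _ = _ := by rw [hs2]
    refine h2.trans_lt ?_
    rw [← Real.log_lt_log_iff (by positivity) (by positivity), Real.log_pow,
      Real.log_mul (by positivity) (by positivity), Real.log_mul (by positivity) (by positivity),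
      Real.log_mul (by positivity) (by positivity), Real.log_pow, Real.log_pow]
    have h3 : 56 * Λ ≤ ⌈56 * Λ⌉₊ := Nat.le_ceil _
    have h4 : (l : ℝ) = ⌈56 * Λ⌉₊ + 1 := by rw [hl]; push_cast; rfl
    push_cast
    nlinarith
  set x : ℝ := ⌈4 * Real.log (1 / (1 / (4 * (W : ℝ))))⌉₊ *
    (⌈64 * s / (e / 8) ^ 2⌉₊ * (2 + d * (l + 5)) + 2) +
      ⌈4 * Real.log (1 / (1 / (4 * (W : ℝ))))⌉₊ ^ 2 + 1 with hx
  have hmed : ∀ j, expTime (medianTrick adj (fun x => decide (x ≤ j)) 4 (e / 8) (√(W : ℝ)) d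
      (1 / (4 * (W : ℝ)))) ≤ ENNReal.ofReal x := fun j =>
    expTime_medianTrick_le (H := thresholdGraph G w j) (hadj.ne_nil hG hn)
      (hadj.thresholdGraph_adj j) (hadj.sum_length (by omega)) (by linarith) hΓ
  refine (expTime_appProfile_le hmed hhW).trans ?_
  have hbound := total_time_le (a := 104857601) (by norm_num) hy hE hs hd1 (Nat.cast_nonneg _)
    (Nat.cast_nonneg _) (Nat.cast_nonneg _) (Nat.cast_nonneg _) (Nat.cast_nonneg _) hR hr hl30 hh2
    ht
  rw [← hx] at hbound
  have hx0 : 0 ≤ x := by positivity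
  clear_value x
  have hconv : (numEndpoints e W : ℝ≥0∞) * (h * (ENNReal.ofReal x + 2) + 1) +
      ((numEndpoints e W ^ 2 + 2 * numEndpoints e W + 2 : ℕ) : ℝ≥0∞) =
      ENNReal.ofReal (numEndpoints e W * (h * (x + 2) + 1) +
        (numEndpoints e W ^ 2 + 2 * numEndpoints e W + 2)) := by
    rw [ENNReal.ofReal_add (by positivity) (by positivity), ENNReal.ofReal_mul (by positivity),
      ENNReal.ofReal_add (by positivity) (by positivity), ENNReal.ofReal_mul (by positivity),
      ENNReal.ofReal_add hx0 (by positivity), ENNReal.ofReal_natCast, ENNReal.ofReal_natCast,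
      ENNReal.ofReal_one, ENNReal.ofReal_ofNat]
    congr 1
    rw [← ENNReal.ofReal_natCast]
    congr 1
    push_cast
    rfl
  rw [hconv]
  refine ENNReal.ofReal_le_ofReal (hbound.trans (le_of_eq ?_))
  field_simp
  ring

end FinalBounds

/-! ### The main theorem and its constants. -/

theorem mainTheorem2 :
    ∃ κ c₀ C : ℝ, 0 < κ ∧ 0 < c₀ ∧ c₀ ≤ 1 ∧ 0 < C ∧
      ∀ (n : ℕ) [NeZero n] (W : ℕ) (ε : ℝ) (G : SimpleGraph (Fin n)) (w : Sym2 (Fin n) → ℕ)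
        (adj : Fin n → List (Fin n × ℕ)),
        2 ≤ n → 1 ≤ W → √(W : ℝ) ≤ n → 0 < ε → ε < 1 →
        G.Connected → (∀ e ∈ G.edgeSet, 1 ≤ w e ∧ w e ≤ W) → IsAdjList G w adj →
        -- accuracy
        (∀ T : SimpleGraph (Fin n), IsMinSpanningTree G w T →
          3 / 4 ≤ (appProfile adj κ (c₀ * ε) W (averageDegree G)).prob fun rep =>
            ∑ k ∈ Finset.Icc 1 n, |profileOracle rep k - (kClusteringCost w T k : ℝ)| ≤
              ε * (hierarchyCost w T : ℝ)) ∧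
        -- expected running time and query complexity
        (appProfile adj κ (c₀ * ε) W (averageDegree G)).expTime ≤
          ENNReal.ofReal (C * (√(W : ℝ) * averageDegree G / ε ^ 3 *
            Real.log (2 * W * averageDegree G / ε) ^ 4)) ∧
        (appProfile adj κ (c₀ * ε) W (averageDegree G)).expQueries ≤
          ENNReal.ofReal (C * (√(W : ℝ) * averageDegree G / ε ^ 3 *
            Real.log (2 * W * averageDegree G / ε) ^ 4)) ∧
        -- size of the representation
        (appProfile adj κ (c₀ * ε) W (averageDegree G)).Always fun rep =>
          (rep.length : ℝ) ≤ C * ((1 + Real.log W) / ε) := by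
  -- 1/160 undoes the factor in the accuracy bound 160 e · cost(G); the 16 is 2⁴, since the time
  -- bound is expressed through y = 2Λ, which is at least 1.
  refine ⟨4, 1 / 160, 16 * (560 * (2 * (259 * 104857601 + 64) + 5) + 560 ^ 2 + 1122), by norm_num,
    by norm_num, by norm_num, by norm_num, ?_⟩
  intro n _ W ε G w adj hn hW hWn hε hε1 hG hw hadj
  have htime := expTime_appProfile_le_ofReal hn hW hε hε1 hG hadj
  refine ⟨fun T hT => ?_, htime, queryBounded_appProfile.expQueries_le.trans htime, ?_⟩
  · have := le_prob_appProfile hn hW hWn (show 0 < 1 / 160 * ε by positivity) (by linarith) hG hw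
      hadj hT
    rwa [show 160 * (1 / 160 * ε) = ε by ring] at this
  · rw [appProfile]
    refine RandComp.Always.bind fun js => RandComp.Always.bind fun _ => RandComp.Always.pure ?_
    have hW' : (1 : ℝ) ≤ W := by exact_mod_cast hW
    have hlW := Real.log_nonneg hW'
    rw [List.length_map, List.length_range]
    refine (numEndpoints_le (by positivity) (by linarith) hW).trans ?_
    rw [show (Real.log W + 3) / (1 / 160 * ε) = (160 * (Real.log W + 3)) / ε by field_simp,
      ← mul_div_assoc]
    exact div_le_div_of_nonneg_right (by linarith) hε.le
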